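/- **Theorem (path integral).** Let $\mathbb K$ be a field of characteristic $0$ and let $\mathfrak g$ be a Lie superalgebra over $\mathbb K$ (of any dimension), decomposed as a direct sum of subspaces $\mathfrak g=\mathfrak g_-\oplus\mathfrak h$, where $\mathfrak g_-$ and $\mathfrak h$ are Lie subsuperalgebras; let $\Pi_{\mathfrak g_-},\Pi_{\mathfrak h}$ be the corresponding projections. Let $P=(P_i)_{i\in I}$ be a basis of $\mathfrak g_-$ consisting of homogeneous elements, let $(X_i)_{i\in I}$ be the dual topological basis of $\mathfrak g_-^*$, so that $S(\mathfrak g_-)^*=\mathbb K[[X]]$ is the superalgebra of formal power series in the supercommuting variables $X_i$ with $|X_i|=|P_i|$, and put $XP=\sum_i X_i\otimes P_i$. Let $Q=(Q_j)_{j\in J}$ be a basis of $\mathfrak h$. Let $\varepsilon_{\bar 0}$ (even) and $\varepsilon_{\bar 1}$ (odd) be parameters of square zero, and $A=\mathbb K[\varepsilon_{\bar 0},\varepsilon_{\bar 1}]/(\varepsilon_{\bar 0}^2)\otimes S(\mathfrak g_-)^*$. Consider pairs of parity-preserving linear maps $$G_-:\mathfrak g\to S(\mathfrak g_-)^*\hat\otimes\mathfrak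 g_-,\qquad H:\mathfrak g\to S(\mathfrak g_-)^*\hat\otimes\mathfrak h$$ such that, in $A\hat\otimes U(\mathfrak g)$, $$e^{\varepsilon x}e^{XP}=e^{XP+\varepsilon G_-(x)}\,e^{\varepsilon H(x)}\qquad(\varepsilon=\varepsilon_{|x|})\tag{1}$$ for every homogeneous $x\in\mathfrak g$. The *action graph* has the elements of the basis $P\cup Q$ of $\mathfrak g$ as vertices; writing $[P_i,b_s]=\sum_t c_{is}^t\,b_t$ for $b_s,b_t\in P\cup Q$, it has one edge from $b_s$ to $b_t$ labelled $P_i$ for each $i$ with $c_{is}^t\neq0$. For a directed path $p$ let $\mu(p)\in S(\mathfrak g_-)^*$ be the product, in the order of the path, of the weights $-c_{is}^tX_i$ of its edges ($\mu=1$ for a path of length $0$), let $T(p)$ be its target vertex, and $\mu_V(p)=\mu(p)\otimes T(p)\in S(\mathfrak g_-)^*\hat\otimes\mathfrak g$. Let $k(p)$ be the number of edges of $p$ whose source vertex lies in $\mathfrak h$, and $$K(p)=c(k(p),\operatorname{length}(p)),\qquad c(k,n)=\sum_{k\le i\le n}\frac{b_{n-i}}{i!\,(n-i)!},$$ where $b_0=1,\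 b_1=-\tfrac12,\ b_2=\tfrac16,\dots$ are the Bernoulli numbers. Then maps $G_-$, $H$ satisfying (1) exist and, for every such pair and every $M\in P\cup Q$, the family $K(p)\mu_V(p)$, indexed by all paths $p$ starting at $M$, is summable in the space $S(\mathfrak g_-)^*\hat\otimes\mathfrak g$ of $\mathfrak g$-valued formal power series (topology of coefficientwise convergence, coefficients being discrete); with $\int_MK\mu_V$ denoting its sum, $$G_-(M)=\Pi_{\mathfrak g_-}\int_M K\mu_V,\qquad H(M)=\Pi_{\mathfrak h}\int_M K\mu_V .$$ In other words, $G_-(M)$ is the sum of $K(p)\mu_V(p)$ over all paths starting at $M$ and ending in $\mathfrak g_-$, and $H(M)$ is the sum over all paths starting at $M$ and ending in $\mathfrak h$. -/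

import Mathlib

open scoped Topology

noncomputable section

/-! ### Superspaces, superalgebras, Lie superalgebras -/

/-- A superstructure on a `K`-vector space, given by its parity operator. -/
class Superspace (K V : Type*) [Field K] [AddCommGroup V] [Module K V] where
  parity : V →ₗ[K] V
  parity_parity : ∀ x, parity (parity x) = x

/-- `x` is homogeneous of parity `i`: the parity operator multiplies it by `(-1)^i`. -/
def IsHomogeneous (K : Type*) {V : Type*} [Field K] [AddCommGroup V] [Module K V]
    [Superspace K V] (i : ZMod 2) (x : V) : Prop :=
  (Superspace.parity (K := K)) x = ((-1 : ℤˣ) ^ i) • x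

/-- An associative superalgebra with unit: the parity operator is an algebra automorphism. -/
class Superalgebra (K B : Type*) [Field K] [Ring B] [Algebra K B] extends Superspace K B where
  parity_one : parity 1 = 1
  parity_mul : ∀ x y, parity (x * y) = parity x * parity y

/-- The ground field, as a purely even superalgebra. -/
instance instSuperalgebraSelf (K : Type*) [Field K] : Superalgebra K K where
  parity := LinearMap.id
  parity_parity _ := rfl
  parity_one := rfl
  parity_mul _ _ := rfl

/-- A Lie superalgebra. The sign rule and the Jacobi identity are written on homogeneous
elements. -/
class LieSuperalgebra (K g : Type*) [Field K] [AddCommGroup g] [Module K g] extends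
    Superspace K g where
  bracket : g →ₗ[K] g →ₗ[K] g
  parity_bracket : ∀ x y, parity (bracket x y) = bracket (parity x) (parity y)
  skew : ∀ (i j : ZMod 2) (x y : g), IsHomogeneous K i x → IsHomogeneous K j y →
    bracket x y = -(((-1 : ℤˣ) ^ (i * j)) • bracket y x)
  jacobi : ∀ (i j k : ZMod 2) (x y z : g),
    IsHomogeneous K i x → IsHomogeneous K j y → IsHomogeneous K k z →
    ((-1 : ℤˣ) ^ (i * k)) • bracket x (bracket y z) +
      ((-1 : ℤˣ) ^ (j * i)) • bracket y (bracket z x) +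
      ((-1 : ℤˣ) ^ (k * j)) • bracket z (bracket x y) = 0

/-- A subspace is a Lie subsuperalgebra if it is stable under the parity operator (that is, a
subsuperspace) and closed under the bracket. -/
structure IsLieSubsuperalgebra (K : Type*) {g : Type*} [Field K] [AddCommGroup g] [Module K g]
    [LieSuperalgebra K g] (L : Submodule K g) : Prop where
  parity_mem : ∀ x ∈ L, (Superspace.parity (K := K)) x ∈ L
  bracket_mem : ∀ x ∈ L, ∀ y ∈ L, (LieSuperalgebra.bracket (K := K)) x y ∈ L

/-! ### The universal enveloping superalgebra -/

section Enveloping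

variable (K g : Type*) [Field K] [AddCommGroup g] [Module K g] [LieSuperalgebra K g]

/-- The relations `x y = (-1)^{|x||y|} y x + [x, y]` for homogeneous `x`, `y`. -/
inductive EnvelopingRel : TensorAlgebra K g → TensorAlgebra K g → Prop
  | mk (i j : ZMod 2) (x y : g) (hx : IsHomogeneous K i x) (hy : IsHomogeneous K j y) :
    EnvelopingRel (TensorAlgebra.ι K x * TensorAlgebra.ι K y)
      (((-1 : ℤˣ) ^ (i * j)) • (TensorAlgebra.ι K y * TensorAlgebra.ι K x) +
        TensorAlgebra.ι K (LieSuperalgebra.bracket (K := K) x y))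

/-- The universal enveloping superalgebra `U(g)`. -/
def SuperEnveloping : Type _ := RingQuot (EnvelopingRel K g)

instance : Ring (SuperEnveloping K g) := inferInstanceAs (Ring (RingQuot (EnvelopingRel K g)))

instance : Algebra K (SuperEnveloping K g) :=
  inferInstanceAs (Algebra K (RingQuot (EnvelopingRel K g)))

/-- The projection of the tensor algebra onto `U(g)`. -/
def SuperEnveloping.proj : TensorAlgebra K g →ₐ[K] SuperEnveloping K g :=
  RingQuot.mkAlgHom K (EnvelopingRel K g)

/-- The canonical map `g → U(g)`. -/
def SuperEnveloping.ι : g →ₗ[K] SuperEnveloping K g :=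
  (SuperEnveloping.proj K g).toLinearMap ∘ₗ TensorAlgebra.ι K

variable {K g} in
theorem IsHomogeneous.parity_apply {V : Type*} [AddCommGroup V] [Module K V] [Superspace K V]
    {i : ZMod 2} {x : V} (hx : IsHomogeneous K i x) :
    IsHomogeneous K i ((Superspace.parity (K := K)) x) := by
  unfold IsHomogeneous at *
  rw [Superspace.parity_parity]
  rw [hx, smul_smul, ← uzpow_add]
  have : i + i = 0 := (by decide : ∀ j : ZMod 2, j + j = 0) i
  simp [this]

theorem SuperEnveloping.ι_mul_ι (i j : ZMod 2) (x y : g)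
    (hx : IsHomogeneous K i x) (hy : IsHomogeneous K j y) :
    ι K g x * ι K g y =
      ((-1 : ℤˣ) ^ (i * j)) • (ι K g y * ι K g x) + ι K g (LieSuperalgebra.bracket (K := K) x y) := by
  have h := RingQuot.mkAlgHom_rel K (EnvelopingRel.mk i j x y hx hy)
  have h' : SuperEnveloping.proj K g _ = SuperEnveloping.proj K g _ := h
  simp only [map_mul, map_add, Units.smul_def, map_zsmul] at h' ⊢
  exact h'

/-- The parity automorphism of `U(g)`, extending the parity operator of `g`. -/
def SuperEnveloping.parityHom : SuperEnveloping K g →ₐ[K] SuperEnveloping K g :=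
  RingQuot.liftAlgHom K
    ⟨TensorAlgebra.lift K (SuperEnveloping.ι K g ∘ₗ (Superspace.parity (K := K))), by
      rintro _ _ ⟨i, j, x, y, hx, hy⟩
      simp only [map_mul, map_add, Units.smul_def, map_zsmul, TensorAlgebra.lift_ι_apply,
        LinearMap.comp_apply, LieSuperalgebra.parity_bracket]
      simpa only [Units.smul_def] using
        SuperEnveloping.ι_mul_ι K g i j _ _ hx.parity_apply hy.parity_apply⟩

theorem SuperEnveloping.parityHom_ι (x : g) :
    parityHom K g (ι K g x) = ι K g ((Superspace.parity (K := K)) x) := by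
  have : parityHom K g (proj K g (TensorAlgebra.ι K x)) = _ :=
    RingQuot.liftAlgHom_mkAlgHom_apply K _ _ _
  simpa [ι] using this

instance : Superalgebra K (SuperEnveloping K g) where
  parity := (SuperEnveloping.parityHom K g).toLinearMap
  parity_parity x := by
    have h : (SuperEnveloping.parityHom K g).comp (SuperEnveloping.parityHom K g) =
        AlgHom.id K _ := by
      refine RingQuot.ringQuot_ext' K _ _ (TensorAlgebra.hom_ext (LinearMap.ext fun y => ?_))
      change SuperEnveloping.parityHom K g (SuperEnveloping.parityHom K g
        (SuperEnveloping.ι K g y)) = SuperEnveloping.ι K g y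
      rw [SuperEnveloping.parityHom_ι, SuperEnveloping.parityHom_ι, Superspace.parity_parity]
    exact DFunLike.congr_fun h x
  parity_one := map_one (SuperEnveloping.parityHom K g)
  parity_mul := map_mul (SuperEnveloping.parityHom K g)

end Enveloping

/-! ### Formal power series in supercommuting variables -/

/-- A family of variables indexed by `σ`: their parities, and the set of those variables whose
square is zero. All odd variables are among the latter. -/
structure SuperVars (σ : Type*) where
  parity : σ → ZMod 2
  sqZero : Set σ
  odd_sqZero : ∀ s, parity s = 1 → s ∈ sqZero

/-- The exponents of the nonzero monomials in the given variables. -/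
def SuperMonomial {σ : Type*} (v : SuperVars σ) : Type _ :=
  {α : σ →₀ ℕ // ∀ s ∈ v.sqZero, α s ≤ 1}

/-- Formal power series with coefficients in `W` (written on the right) in the supercommuting
variables `v`: the completed tensor product of the superalgebra `K[[v]]` with the discrete
superspace `W`. The monomials are normally ordered, smaller variables standing on the left. -/
def SuperSeries (_K : Type*) {σ : Type*} (v : SuperVars σ) (W : Type*) : Type _ :=
  SuperMonomial v → W

namespace SuperVars

variable {σ : Type*} (v : SuperVars σ)

/-- The parity `|X^α|` of a monomial. -/
def degParity (α : σ →₀ ℕ) : ZMod 2 := α.sum fun s n => (n : ZMod 2) * v.parity s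

/-- The parity of the number of transpositions of odd variables needed to bring
`X^α X^β` to normal order. -/
def crossing [LinearOrder σ] (α β : σ →₀ ℕ) : ZMod 2 :=
  α.sum fun s m => β.sum fun t n =>
    if t < s then ((m : ZMod 2) * v.parity s) * ((n : ZMod 2) * v.parity t) else 0

theorem degParity_add (α β : σ →₀ ℕ) :
    v.degParity (α + β) = v.degParity α + v.degParity β :=
  Finsupp.sum_add_index' (by simp) (by intros; push_cast; ring)

theorem crossing_add_left [LinearOrder σ] (α β γ : σ →₀ ℕ) :
    v.crossing (α + β) γ = v.crossing α γ + v.crossing β γ := by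
  refine Finsupp.sum_add_index' (fun s => ?_) (fun s m n => ?_)
  · simp
  · rw [← Finsupp.sum_add]
    refine Finsupp.sum_congr fun t _ => ?_
    split_ifs
    · push_cast; ring
    · simp

theorem crossing_add_right [LinearOrder σ] (α β γ : σ →₀ ℕ) :
    v.crossing α (β + γ) = v.crossing α β + v.crossing α γ := by
  unfold crossing
  rw [← Finsupp.sum_add]
  refine Finsupp.sum_congr fun s _ => ?_
  refine Finsupp.sum_add_index' (fun s => ?_) (fun t m n => ?_)
  · simp
  · split_ifs
    · push_cast; ring
    · simp

theorem degParity_zero : v.degParity 0 = 0 := Finsupp.sum_zero_index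

theorem crossing_zero_left [LinearOrder σ] (α : σ →₀ ℕ) : v.crossing 0 α = 0 :=
  Finsupp.sum_zero_index

theorem crossing_zero_right [LinearOrder σ] (α : σ →₀ ℕ) : v.crossing α 0 = 0 := by
  simp [crossing]

end SuperVars

namespace SuperSeries

variable {K : Type*} {σ : Type*} {v : SuperVars σ} {W : Type*}

instance [AddCommGroup W] : AddCommGroup (SuperSeries K v W) :=
  inferInstanceAs (AddCommGroup (SuperMonomial v → W))

instance [Field K] [AddCommGroup W] [Module K W] : Module K (SuperSeries K v W) :=
  inferInstanceAs (Module K (SuperMonomial v → W))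

/-- The topology of coefficientwise convergence, the coefficient space being discrete. -/
instance : TopologicalSpace (SuperSeries K v W) :=
  @Pi.topologicalSpace (SuperMonomial v) (fun _ => W) (fun _ => ⊥)

instance : T2Space (SuperSeries K v W) := by
  let _ : TopologicalSpace W := ⊥
  have _ : DiscreteTopology W := ⟨rfl⟩
  exact inferInstanceAs (T2Space (SuperMonomial v → W))

open Classical in
/-- The coefficient at a given exponent; it is zero if the exponent is not the exponent of a
nonzero monomial. -/
def coeff [Zero W] (f : SuperSeries K v W) (α : σ →₀ ℕ) : W :=
  if h : ∀ s ∈ v.sqZero, α s ≤ 1 then f ⟨α, h⟩ else 0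

theorem coeff_val [Zero W] (f : SuperSeries K v W) (α : SuperMonomial v) :
    f.coeff α.1 = f α := by
  unfold coeff
  rw [dif_pos α.2]; rfl

theorem coeff_of_not [Zero W] (f : SuperSeries K v W) {α : σ →₀ ℕ}
    (h : ¬ ∀ s ∈ v.sqZero, α s ≤ 1) : f.coeff α = 0 := dif_neg h

theorem ext_coeff [Zero W] {f f' : SuperSeries K v W} (h : ∀ α, f.coeff α = f'.coeff α) :
    f = f' := by
  funext α
  rw [← coeff_val f, ← coeff_val f', h]

theorem left_adm {α β γ : σ →₀ ℕ} (hs : α + β = γ) (h : ∀ s ∈ v.sqZero, γ s ≤ 1) :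
    ∀ s ∈ v.sqZero, α s ≤ 1 := by
  intro s hsv
  have := h s hsv
  rw [← hs, Finsupp.add_apply] at this
  omega

theorem right_adm {α β γ : σ →₀ ℕ} (hs : α + β = γ) (h : ∀ s ∈ v.sqZero, γ s ≤ 1) :
    ∀ s ∈ v.sqZero, β s ≤ 1 := left_adm ((add_comm _ _).trans hs) h

section Add

variable [AddCommGroup W]

theorem coeff_add (f f' : SuperSeries K v W) (α : σ →₀ ℕ) :
    (f + f').coeff α = f.coeff α + f'.coeff α := by
  unfold coeff
  split_ifs
  · rfl
  · simp

theorem coeff_zero (α : σ →₀ ℕ) : (0 : SuperSeries K v W).coeff α = 0 := by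
  unfold coeff
  split_ifs <;> rfl

/-- A family of series is summable if every coefficient vanishes for almost all members. -/
theorem summable_of_finite {ι : Type*} (f : ι → SuperSeries K v W)
    (h : ∀ α : SuperMonomial v, {n | f n α ≠ 0}.Finite) : Summable f := by
  let _ : TopologicalSpace W := ⊥
  have key : ∀ α : SuperMonomial v, Summable fun n => f n α := fun α =>
    summable_of_ne_finset_zero (s := (h α).toFinset) fun n hn => by
      by_contra hne
      exact hn ((h α).mem_toFinset.2 hne)
  exact Pi.summable.2 key

end Add

open Classical in
/-- The series `X^α ⊗ w`; it is zero if `X^α = 0`. -/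
def monomial [Zero W] (α : σ →₀ ℕ) (w : W) : SuperSeries K v W :=
  fun β => if β.1 = α then w else 0

section Mul

variable [Field K] {B : Type*} [Ring B] [Algebra K B] [Superalgebra K B]

/-- The parity operator iterated `i` times, `i` being an element of `ℤ/2`. -/
def twist (K : Type*) {B : Type*} [Field K] [AddCommGroup B] [Module K B] [Superspace K B]
    (i : ZMod 2) : B →ₗ[K] B :=
  if i = 0 then LinearMap.id else (Superspace.parity (K := K))

theorem twist_zero (b : B) : twist K 0 b = b := by simp [twist]

theorem twist_one (i : ZMod 2) : twist K i (1 : B) = 1 := by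
  unfold twist; split_ifs
  · rfl
  · exact Superalgebra.parity_one

theorem twist_mul (i : ZMod 2) (a b : B) : twist K i (a * b) = twist K i a * twist K i b := by
  unfold twist; split_ifs
  · rfl
  · exact Superalgebra.parity_mul _ _

theorem twist_twist (i j : ZMod 2) (b : B) : twist K i (twist K j b) = twist K (i + j) b := by
  have key : ∀ i : ZMod 2, i = 0 ∨ i = 1 := by decide
  have h2 : (1 : ZMod 2) + 1 = 0 := by decide
  rcases key i with rfl | rfl <;> rcases key j with rfl | rfl <;>
    simp [twist, h2, Superspace.parity_parity]

variable [LinearOrder σ]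

/-- The product in the completed tensor product of superalgebras:
`(X^α ⊗ a) (X^β ⊗ b) = (-1)^{|a||β|} X^α X^β ⊗ a b`. -/
instance : Mul (SuperSeries K v B) where
  mul f f' := fun γ => ∑ p ∈ Finset.HasAntidiagonal.antidiagonal γ.1,
    ((-1 : ℤˣ) ^ v.crossing p.1 p.2) •
      (twist K (v.degParity p.2) (f.coeff p.1) * f'.coeff p.2)

instance : One (SuperSeries K v B) where
  one := monomial 0 1

open Classical in
theorem coeff_mul (f f' : SuperSeries K v B) (γ : σ →₀ ℕ) :
    (f * f').coeff γ = if ∀ s ∈ v.sqZero, γ s ≤ 1 then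
      ∑ p ∈ Finset.HasAntidiagonal.antidiagonal γ, ((-1 : ℤˣ) ^ v.crossing p.1 p.2) •
        (twist K (v.degParity p.2) (f.coeff p.1) * f'.coeff p.2) else 0 := by
  split_ifs with h
  · exact (coeff_val (f * f') ⟨γ, h⟩)
  · exact coeff_of_not _ h

theorem coeff_one (γ : σ →₀ ℕ) :
    (1 : SuperSeries K v B).coeff γ = if γ = 0 then 1 else 0 := by
  classical
  by_cases h : ∀ s ∈ v.sqZero, γ s ≤ 1
  · have h1 := coeff_val (1 : SuperSeries K v B) ⟨γ, h⟩
    refine h1.trans ?_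
    by_cases h0 : γ = 0
    · exact (if_pos h0).trans (if_pos h0).symm
    · exact (if_neg h0).trans (if_neg h0).symm
  · rw [coeff_of_not _ h, if_neg]
    rintro rfl
    exact h (by simp)

theorem mul_assoc' (f₁ f₂ f₃ : SuperSeries K v B) : f₁ * f₂ * f₃ = f₁ * (f₂ * f₃) := by
  classical
  refine ext_coeff fun γ => ?_
  rw [coeff_mul, coeff_mul]
  split_ifs with h
  swap
  · rfl
  have hl : ∀ p ∈ Finset.HasAntidiagonal.antidiagonal γ,
      ((-1 : ℤˣ) ^ v.crossing p.1 p.2) •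
        (twist K (v.degParity p.2) ((f₁ * f₂).coeff p.1) * f₃.coeff p.2) =
      ∑ q ∈ Finset.HasAntidiagonal.antidiagonal p.1,
        ((-1 : ℤˣ) ^ (v.crossing q.1 q.2 + v.crossing q.1 p.2 + v.crossing q.2 p.2)) •
        (twist K (v.degParity q.2 + v.degParity p.2) (f₁.coeff q.1) *
          twist K (v.degParity p.2) (f₂.coeff q.2) * f₃.coeff p.2) := by
    intro p hp
    rw [Finset.HasAntidiagonal.mem_antidiagonal] at hp
    rw [coeff_mul, if_pos (left_adm hp h), map_sum, Finset.sum_mul, Finset.smul_sum]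
    refine Finset.sum_congr rfl fun q hq => ?_
    rw [Finset.HasAntidiagonal.mem_antidiagonal] at hq
    rw [← hq, v.crossing_add_left]
    simp only [Units.smul_def, map_zsmul, twist_mul, twist_twist, smul_mul_assoc, uzpow_add,
      mul_smul]
    rw [add_comm (v.degParity p.2)]
    simp only [← mul_smul]
    congr 1
    ring
  have hr : ∀ p ∈ Finset.HasAntidiagonal.antidiagonal γ,
      ((-1 : ℤˣ) ^ v.crossing p.1 p.2) •
        (twist K (v.degParity p.2) (f₁.coeff p.1) * (f₂ * f₃).coeff p.2) =
      ∑ q ∈ Finset.HasAntidiagonal.antidiagonal p.2,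
        ((-1 : ℤˣ) ^ (v.crossing p.1 q.1 + v.crossing p.1 q.2 + v.crossing q.1 q.2)) •
        (twist K (v.degParity q.1 + v.degParity q.2) (f₁.coeff p.1) *
          twist K (v.degParity q.2) (f₂.coeff q.1) * f₃.coeff q.2) := by
    intro p hp
    rw [Finset.HasAntidiagonal.mem_antidiagonal] at hp
    rw [coeff_mul, if_pos (right_adm hp h), Finset.mul_sum, Finset.smul_sum]
    refine Finset.sum_congr rfl fun q hq => ?_
    rw [Finset.HasAntidiagonal.mem_antidiagonal] at hq
    rw [← hq, v.crossing_add_right, v.degParity_add]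
    simp only [Units.smul_def, mul_smul_comm, uzpow_add, mul_smul, mul_assoc]
  rw [Finset.sum_congr rfl hl, Finset.sum_congr rfl hr, Finset.sum_sigma', Finset.sum_sigma']
  refine Finset.sum_nbij' (fun ⟨⟨_i, j⟩, ⟨k, l⟩⟩ ↦ ⟨(k, l + j), (l, j)⟩)
    (fun ⟨⟨i, _j⟩, ⟨k, l⟩⟩ ↦ ⟨(i + k, l), (i, k)⟩) ?_ ?_ ?_ ?_ ?_
  · rintro ⟨⟨i, j⟩, ⟨k, l⟩⟩ hm
    simp only [Finset.mem_sigma, Finset.HasAntidiagonal.mem_antidiagonal] at hm ⊢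
    exact ⟨by rw [← hm.1, ← hm.2, add_assoc], trivial⟩
  · rintro ⟨⟨i, j⟩, ⟨k, l⟩⟩ hm
    simp only [Finset.mem_sigma, Finset.HasAntidiagonal.mem_antidiagonal] at hm ⊢
    exact ⟨by rw [← hm.1, ← hm.2, add_assoc], trivial⟩
  · rintro ⟨⟨i, j⟩, ⟨k, l⟩⟩ hm
    simp only [Finset.mem_sigma, Finset.HasAntidiagonal.mem_antidiagonal] at hm
    obtain ⟨_, rfl⟩ := hm
    rfl
  · rintro ⟨⟨i, j⟩, ⟨k, l⟩⟩ hm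
    simp only [Finset.mem_sigma, Finset.HasAntidiagonal.mem_antidiagonal] at hm
    obtain ⟨_, rfl⟩ := hm
    rfl
  · rintro ⟨⟨i, j⟩, ⟨k, l⟩⟩ _
    rfl

theorem one_mul' (f : SuperSeries K v B) : 1 * f = f := by
  classical
  refine ext_coeff fun γ => ?_
  rw [coeff_mul]
  split_ifs with h
  · rw [Finset.sum_eq_single (0, γ)]
    · simp [coeff_one, v.crossing_zero_left, twist_one]
    · rintro ⟨a, b⟩ hab hne
      rw [Finset.HasAntidiagonal.mem_antidiagonal] at hab
      have ha : a ≠ 0 := by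
        rintro rfl
        exact hne (by simpa using hab)
      simp [coeff_one, ha]
    · intro hn
      exact absurd (by simp [Finset.HasAntidiagonal.mem_antidiagonal]) hn
  · exact (coeff_of_not f h).symm

theorem mul_one' (f : SuperSeries K v B) : f * 1 = f := by
  classical
  refine ext_coeff fun γ => ?_
  rw [coeff_mul]
  split_ifs with h
  · rw [Finset.sum_eq_single (γ, 0)]
    · simp [coeff_one, v.crossing_zero_right, v.degParity_zero, twist_zero]
    · rintro ⟨a, b⟩ hab hne
      rw [Finset.HasAntidiagonal.mem_antidiagonal] at hab
      have hb : b ≠ 0 := by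
        rintro rfl
        exact hne (by simpa using hab)
      simp [coeff_one, hb]
    · intro hn
      exact absurd (by simp [Finset.HasAntidiagonal.mem_antidiagonal]) hn
  · exact (coeff_of_not f h).symm

instance : Ring (SuperSeries K v B) where
  __ := (inferInstance : AddCommGroup (SuperSeries K v B))
  mul_assoc := mul_assoc'
  one_mul := one_mul'
  mul_one := mul_one'
  zero_mul f := by
    classical
    refine ext_coeff fun γ => ?_
    rw [coeff_mul]
    simp [coeff_zero]
  mul_zero f := by
    classical
    refine ext_coeff fun γ => ?_
    rw [coeff_mul]
    simp [coeff_zero]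
  left_distrib f₁ f₂ f₃ := by
    classical
    refine ext_coeff fun γ => ?_
    rw [coeff_add, coeff_mul, coeff_mul, coeff_mul]
    split_ifs
    · simp only [coeff_add, mul_add, smul_add, Finset.sum_add_distrib]
    · simp
  right_distrib f₁ f₂ f₃ := by
    classical
    refine ext_coeff fun γ => ?_
    rw [coeff_add, coeff_mul, coeff_mul, coeff_mul]
    split_ifs
    · simp only [coeff_add, map_add, add_mul, smul_add, Finset.sum_add_distrib]
    · simp

/-- The powers of a series without constant term have no terms of low degree. -/
theorem coeff_pow_eq_zero {x : SuperSeries K v B} (hx : x.coeff 0 = 0) (n : ℕ) (γ : σ →₀ ℕ)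
    (hγ : γ.degree < n) : (x ^ n).coeff γ = 0 := by
  classical
  induction n generalizing γ with
  | zero => omega
  | succ n ih =>
    rw [pow_succ, coeff_mul]
    split_ifs
    · refine Finset.sum_eq_zero fun p hp => ?_
      rw [Finset.HasAntidiagonal.mem_antidiagonal] at hp
      by_cases h2 : p.2 = 0
      · rw [h2, hx]; simp
      · have h3 : 0 < p.2.degree := by
          rw [Nat.pos_iff_ne_zero]
          exact fun h => h2 ((Finsupp.degree_eq_zero_iff _).1 h)
        have h4 : p.1.degree + p.2.degree = γ.degree := by rw [← hp, map_add]
        rw [ih p.1 (by omega)]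
        simp
    · rfl

/-- The exponential series of a series without constant term converges. -/
theorem summable_exp {x : SuperSeries K v B} (hx : x.coeff 0 = 0) :
    Summable fun n : ℕ => ((n.factorial : K)⁻¹) • x ^ n := by
  refine summable_of_finite _ fun α => (Set.finite_Iic α.1.degree).subset fun n hn => ?_
  by_contra hlt
  refine hn ?_
  have h0 := (coeff_val (x ^ n) α).symm.trans (coeff_pow_eq_zero hx n α.1 (by simpa using hlt))
  exact (congrArg (((n.factorial : K)⁻¹) • ·) h0).trans (smul_zero _)

/-- The exponential series. It converges for every series without constant term. -/
def exp (x : SuperSeries K v B) : SuperSeries K v B :=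
  ∑' n : ℕ, ((n.factorial : K)⁻¹) • x ^ n

end Mul

/-- Apply a linear map to all coefficients: the map `1 ⊗ φ`. -/
def mapCoeff {W' : Type*} [Field K] [AddCommGroup W] [Module K W] [AddCommGroup W']
    [Module K W'] (φ : W →ₗ[K] W') : SuperSeries K v W →ₗ[K] SuperSeries K v W' where
  toFun f := fun α => φ (f α)
  map_add' f f' := funext fun α => map_add φ (f α) (f' α)
  map_smul' c f := funext fun α => map_smul φ c (f α)

/-- The tensor product `f ⊗ w` of a scalar series and a vector. -/
def tensor [Field K] [AddCommGroup W] [Module K W] (f : SuperSeries K v K) (w : W) :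
    SuperSeries K v W :=
  fun α => (f α : K) • w

/-- The variable `X_s`, as a scalar series. -/
def X [Field K] (s : σ) : SuperSeries K v K := monomial (Finsupp.single s 1) 1

end SuperSeries

/-! ### The variables `X_i` and the parameters `ε₀`, `ε₁` -/

section Variables

variable {I : Type*}

/-- The variables `X_i` with the given parities. Series in them with coefficients in `W` form
the space `S(E)^* ⊗̂ W`, where `E` has a homogeneous basis with these parities. -/
def xVars (par : I → ZMod 2) : SuperVars I where
  parity := par
  sqZero := {i | par i = 1}
  odd_sqZero _ h := h

/-- The variables of the superalgebra `K[ε₀, ε₁] / (ε₀²) ⊗ K[[X]]`: an even variable `ε₀` and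
an odd variable `ε₁`, both of square zero, in addition to the `X_i`. -/
def epsVars (par : I → ZMod 2) : SuperVars (Fin 2 ⊕ₗ I) where
  parity s := Sum.elim (fun e : Fin 2 => ((e : ℕ) : ZMod 2)) par (ofLex s)
  sqZero := {s | Sum.elim (fun _ => True) (fun i => par i = 1) (ofLex s)}
  odd_sqZero s h := by
    rcases s with e | i
    · trivial
    · exact h

namespace SuperSeries

variable {K : Type*} [Field K] {par : I → ZMod 2} {W : Type*} [AddCommGroup W] [Module K W]

/-- A series in the variables `X`, considered as a series in the variables `ε`, `X`. -/
def extend (f : SuperSeries K (xVars par) W) : SuperSeries K (epsVars par) W :=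
  fun α => if ∀ e : Fin 2, α.1 (toLex (Sum.inl e)) = 0 then
    f ⟨α.1.comapDomain (fun i => toLex (Sum.inr i))
        (fun _ _ _ _ h => Sum.inr_injective (toLex.injective h)),
      fun i hi => α.2 (toLex (Sum.inr i)) hi⟩
    else 0

variable {g : Type*} [AddCommGroup g] [Module K g] [LieSuperalgebra K g] [LinearOrder I]

/-- For a `g`-valued series `f` in the variables `X`, its image in `A ⊗̂ U(g)`,
where `A` is the superalgebra of series in the variables `ε`, `X`. -/
def toEnveloping (f : SuperSeries K (xVars par) g) :
    SuperSeries K (epsVars par) (SuperEnveloping K g) :=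
  extend (mapCoeff (SuperEnveloping.ι K g) f)

/-- The parameter `ε_i` of parity `i`, as an element of `A ⊗̂ U(g)`. -/
def eps (i : ZMod 2) : SuperSeries K (epsVars par) (SuperEnveloping K g) :=
  monomial (Finsupp.single (toLex (Sum.inl (⟨i.val, ZMod.val_lt i⟩ : Fin 2))) 1) 1

end SuperSeries

end Variables

/-! ### The factorization condition -/

section Factorization

open SuperSeries

variable {K g I : Type*} [Field K] [AddCommGroup g] [Module K g] [LieSuperalgebra K g]
  [LinearOrder I] {gm h : Submodule K g}

/-- The canonical element `XP = ∑ᵢ X_i ⊗ P_i`. -/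
def canonicalElement (P : Module.Basis I K gm) (par : I → ZMod 2) :
    SuperSeries K (xVars par) g :=
  ∑' i, tensor (X i) (P i : g)

theorem summable_canonicalElement (P : Module.Basis I K gm) (par : I → ZMod 2) :
    Summable fun i => (tensor (X i) (P i : g) : SuperSeries K (xVars par) g) := by
  refine summable_of_finite _ fun α => Set.Subsingleton.finite fun i hi j hj => ?_
  have key : ∀ i, (tensor (X i) (P i : g) : SuperSeries K (xVars par) g) α ≠ 0 →
      α.1 = Finsupp.single i 1 := fun i hi => by
    by_contra hne
    refine hi ((congrArg (· • (P i : g)) (?_ : (X i : SuperSeries K (xVars par) K) α = 0)).trans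
      (zero_smul K _))
    exact if_neg hne
  exact Finsupp.single_left_injective one_ne_zero ((key i hi).symm.trans (key j hj))

/-- `F : g → S(gm)^* ⊗̂ L` is a morphism of superspaces, i.e. preserves parity. -/
def IsEvenMap {L : Submodule K g} {par : I → ZMod 2}
    (F : g →ₗ[K] SuperSeries K (xVars par) L) : Prop :=
  ∀ (i : ZMod 2) (x : g), IsHomogeneous K i x → ∀ α : SuperMonomial (xVars par),
    IsHomogeneous K (i + (xVars par).degParity α.1) ((F x α : L) : g)

/-- The morphisms of superspaces `G : g → S(gm)^* ⊗̂ gm` and `H : g → S(gm)^* ⊗̂ h` satisfy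
`e^{ε x} e^{XP} = e^{XP + ε G(x)} e^{ε H(x)}` for every homogeneous `x`, with `ε = ε_{|x|}`. -/
structure IsFactorization (P : Module.Basis I K gm) (par : I → ZMod 2)
    (G : g →ₗ[K] SuperSeries K (xVars par) gm) (H : g →ₗ[K] SuperSeries K (xVars par) h) :
    Prop where
  even_left : IsEvenMap G
  even_right : IsEvenMap H
  factor : ∀ (i : ZMod 2) (x : g), IsHomogeneous K i x →
    exp (eps (K := K) (g := g) (par := par) i * toEnveloping (monomial 0 x)) *
        exp (toEnveloping (canonicalElement P par)) =
      exp (toEnveloping (canonicalElement P par) +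
          eps (K := K) (g := g) (par := par) i * toEnveloping (mapCoeff gm.subtype (G x))) *
        exp (eps (K := K) (g := g) (par := par) i * toEnveloping (mapCoeff h.subtype (H x)))

end Factorization

/-! ### The action graph and path integrals -/

section Graph

open SuperSeries

variable {K E H I J : Type*} [Field K] [AddCommGroup E] [Module K E] [AddCommGroup H]
  [Module K H]

/-- The structure constants `c_{is}^t` of an action: `P_i · b_s = ∑_t c_{is}^t b_t`. -/
def structConst (act : E →ₗ[K] H →ₗ[K] H) (P : Module.Basis I K E) (b : Module.Basis J K H)
    (i : I) (s t : J) : K :=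
  b.repr (act (P i) (b s)) t

/-- The vertices of the action graph: the elements of the basis `b`. -/
def ActionGraph (_act : E →ₗ[K] H →ₗ[K] H) (_P : Module.Basis I K E)
    (_b : Module.Basis J K H) : Type _ := J

variable {act : E →ₗ[K] H →ₗ[K] H} {P : Module.Basis I K E} {b : Module.Basis J K H}

/-- There is one edge from `b_s` to `b_t` labelled by `P_i` for each `i` with `c_{is}^t ≠ 0`. -/
instance : Quiver (ActionGraph act P b) where
  Hom s t := {i : I // structConst act P b i s t ≠ 0}

variable [LinearOrder I]

/-- The weight `-c_{is}^t X_i` of an edge. -/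
def edgeWeight (par : I → ZMod 2) {s t : ActionGraph act P b} (e : s ⟶ t) :
    SuperSeries K (xVars par) K :=
  (-structConst act P b e.1 s t) • X e.1

/-- The multiplicative measure of a path: the product, in the order of the path, of the weights
of its edges. -/
def pathWeight (par : I → ZMod 2) {s : ActionGraph act P b} :
    ∀ {t : ActionGraph act P b}, Quiver.Path s t → SuperSeries K (xVars par) K
  | _, .nil => 1
  | _, .cons p e => pathWeight par p * edgeWeight par e

/-- The measure `μ_V(p) = μ(p) ⊗ T(p)`, where `T(p)` is the target vertex of `p`. -/
def pathMeasure (par : I → ZMod 2) {s t : ActionGraph act P b} (p : Quiver.Path s t) :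
    SuperSeries K (xVars par) H :=
  tensor (pathWeight par p) (b t)

open Classical in
/-- The number of edges of a path whose source vertex belongs to a given set. -/
def edgesFrom {V : Type*} [Quiver V] (S : Set V) {s : V} :
    ∀ {t : V}, Quiver.Path s t → ℕ
  | _, .nil => 0
  | _, .cons (b := u) p _ => edgesFrom S p + if u ∈ S then 1 else 0

/-- `c(k, n) = ∑_{k ≤ i ≤ n} b_{n-i} / (i! (n-i)!)`, with `b_j` the Bernoulli numbers
(`b_1 = -1/2`). -/
def bernoulliCoeff (k n : ℕ) : ℚ :=
  ∑ i ∈ Finset.Icc k n, bernoulli (n - i) / ((i.factorial : ℚ) * ((n - i).factorial : ℚ))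

/-- The coefficient `K(p) = c(k(p), length p)`, where `k(p)` is the number of edges of `p`
issuing from `S`. -/
def pathCoeff (K : Type*) [Field K] {V : Type*} [Quiver V] (S : Set V) {s t : V}
    (p : Quiver.Path s t) : K :=
  (bernoulliCoeff (edgesFrom S p) p.length : K)

/-- The path integral `∫_s c μ_V = ∑_p c(p) μ_V(p)` over all paths `p` starting at `s`. -/
def pathIntegral (par : I → ZMod 2) (s : ActionGraph act P b)
    (c : ∀ t : ActionGraph act P b, Quiver.Path s t → K) : SuperSeries K (xVars par) H :=
  ∑' p : Σ t : ActionGraph act P b, Quiver.Path s t, c p.1 p.2 • pathMeasure par p.2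

end Graph

/-! ### The action of `gm` on `g` -/

section Adjoint

variable {K g I J : Type*} [Field K] [AddCommGroup g] [Module K g] [LieSuperalgebra K g]
  {gm h : Submodule K g}

/-- The action of `gm` on `g` by the bracket. -/
def adAction (gm : Submodule K g) : gm →ₗ[K] g →ₗ[K] g :=
  ((LieSuperalgebra.bracket (K := K))).comp gm.subtype

/-- The basis `P ∪ Q` of `g = gm ⊕ h`. -/
def unionBasis (hc : IsCompl gm h) (P : Module.Basis I K gm) (Q : Module.Basis J K h) :
    Module.Basis (I ⊕ J) K g :=
  (P.prod Q).map (Submodule.prodEquivOfIsCompl gm h hc)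

/-- The action graph of `gm` on `g`. -/
abbrev AdGraph (hc : IsCompl gm h) (P : Module.Basis I K gm) (Q : Module.Basis J K h) : Type _ :=
  ActionGraph (adAction gm) P (unionBasis hc P Q)

/-- The vertices of the action graph that belong to `gm`. -/
def verticesMinus (hc : IsCompl gm h) (P : Module.Basis I K gm) (Q : Module.Basis J K h) :
    Set (AdGraph hc P Q) :=
  {t | unionBasis hc P Q t ∈ gm}

/-- The vertices of the action graph that belong to `h`. -/
def verticesH (hc : IsCompl gm h) (P : Module.Basis I K gm) (Q : Module.Basis J K h) :
    Set (AdGraph hc P Q) :=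
  {t | unionBasis hc P Q t ∈ h}

end Adjoint

end

/-! Write a = XP, y = G(x), z = H(x). Because ε has square zero and a commutes with ε, condition (1)
is equivalent to its part of first order, x e^a = (D exp)_a(y) + e^a z, for series with values in
U(g) (`exp_eps_mul_exp_eq_iff`). Let T be right minus left multiplication by a. The two
multiplications commute, so e^{-a} x e^a = e^T x and e^{-a} (D exp)_a(y) = ((e^T - 1)/T) y
(`expDeriv_eq_powerSum`, `mul_exp_eq_iff`). On values in g the operator T is -ad XP, and g embeds in
U(g) (`SuperEnveloping.ι_injective`). Hence (1) is the linear equation e^T x = ((e^T - 1)/T) G(x) +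
H(x) for g-valued series (`exp_factorization_iff`). Every power series in T makes sense, because T
raises the degree in X.

The subspace g_- is a subalgebra, so T preserves g_--valued series, and the two projections separate
the equation: H(x) = Π_h e^T x and G(x) = (T/(e^T - 1)) Π_{g_-} e^T x (`expAd_eq_iff`). This gives
existence and uniqueness, and the Bernoulli numbers enter as the coefficients of t/(e^t - 1).

Applying T to the measure of a path prolongs the path by one edge in all possible ways, so T^n M is
the sum of μ_V over the paths of length n from M (`hasSum_length_eq`). No edge leads from g_- to h,
so a path runs through h for a while and then stays in g_-. If it ends in h and has length n, then k
= n and its coefficient in e^T is 1/n! = c(n, n). For G, the series T^m Π_{g_-} T^i M is the sum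
over the paths of length m + i that are in g_- after i steps, that is, that end in g_- and have k(p)
≤ i (`hasSum_pow_projection_pow`). The weights b_m/(m! i!), added over m + i = n and i ≥ k, make up
c(k, n).

The embedding of g in U(g) is obtained without a basis of U(g). It is enough to have a linear map
from the tensor algebra to g that is the identity in degree one and respects the defining relations.
It is built degree by degree: the extension by one degree asks for f' with prescribed differences f'
- s_i f', where the s_i are the signed adjacent transpositions. Supersymmetry of the bracket, the
Jacobi identity and the relations in the degree below say that these differences form a cocycle of a
symmetric group, and such cocycles are coboundaries in characteristic zero (`exists_coboundary`,
`IsExchange.exists_succ`). -/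

/-! ### A vanishing theorem for cocycles of the symmetric group -/

/-- Cocycles of a finite symmetric group, given on the adjacent transpositions `s i`, are
coboundaries in characteristic zero. -/
theorem exists_coboundary (K : Type*) {V : Type*} [Field K] [CharZero K] [AddCommGroup V]
    [Module K V] (s : ℕ → V →ₗ[K] V) (N : ℕ) (B : ℕ → V)
    (hs : ∀ i < N, ∀ x, s i (s i x) = x)
    (hcomm : ∀ i j, i + 2 ≤ j → j < N → ∀ x, s i (s j x) = s j (s i x))
    (hbraid : ∀ i, i + 1 < N → ∀ x, s i (s (i + 1) (s i x)) = s (i + 1) (s i (s (i + 1) x)))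
    (hB : ∀ i < N, B i + s i (B i) = 0)
    (hBcomm : ∀ i j, i + 2 ≤ j → j < N → B i + s i (B j) = B j + s j (B i))
    (hBbraid : ∀ i, i + 1 < N → B i + s i (B (i + 1)) + s i (s (i + 1) (B i)) =
      B (i + 1) + s (i + 1) (B i) + s (i + 1) (s i (B (i + 1)))) :
    ∃ f, ∀ i < N, f - s i f = B i := by
  induction N with
  | zero => exact ⟨0, fun i hi => absurd hi (by omega)⟩
  | succ N ih =>
    obtain ⟨f₀, hf₀⟩ := ih (fun i hi => hs i (by omega)) (fun i j h h' => hcomm i j h (by omega))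
      (fun i h => hbraid i (by omega)) (fun i h => hB i (by omega))
      (fun i j h h' => hBcomm i j h (by omega)) (fun i h => hBbraid i (by omega))
    -- After subtraction of the coboundary of `f₀` the cocycle vanishes on all generators but the
    -- last, where its value is `b`. The three kinds of relations that involve `s N` then give
    -- `hsb`, `hfix` and `hbr`.
    obtain ⟨b, hb⟩ : ∃ b, b = B N - (f₀ - s N f₀) := ⟨_, rfl⟩
    have hsb : s N b = -b := by
      have h1 := hB N (by omega)
      have h2 := hs N (by omega) f₀
      rw [add_comm, ← eq_neg_iff_add_eq_zero] at h1
      rw [hb, map_sub, map_sub, h1, h2]; abel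
    have hfix : ∀ i, i + 2 ≤ N → s i b = b := by
      intro i hi
      have h1 := hBcomm i N hi (by omega)
      have h2 := hf₀ i (by omega)
      have h3 := hcomm i N hi (by omega) f₀
      rw [← h2, map_sub, ← h3] at h1
      rw [hb, map_sub, map_sub, ← sub_eq_zero]
      rw [← sub_eq_zero] at h1
      rw [← h1]; abel
    have hbr : ∀ M, M + 1 = N → s N (s M b) = s M b - b := by
      rintro M rfl
      have h1 := hBbraid M (by omega)
      have h2 := hf₀ M (by omega)
      have h3 := hbraid M (by omega) f₀
      rw [← h2] at h1
      have h6 : B (M + 1) = b + (f₀ - s (M + 1) f₀) := by rw [hb]; abel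
      rw [h6] at h1
      simp only [map_add, map_sub, h3] at h1
      rw [← sub_eq_zero] at h1 ⊢
      rw [← neg_eq_zero, ← h1]; abel
    -- `d m` is s_{N-m} ⋯ s_{N-1} b, the value of the reduced cocycle on s_{N-m} ⋯ s_N. These N + 1
    -- products represent the nontrivial cosets of the subgroup generated by the first N
    -- transpositions; on the trivial coset the value is 0.
    let d : ℕ → V := fun m => Nat.rec b (fun m x => s (N - 1 - m) x) m
    have d0 : d 0 = b := rfl
    have dsucc : ∀ m, d (m + 1) = s (N - 1 - m) (d m) := fun m => rfl
    have hlow : ∀ m i, i + m + 2 ≤ N → s i (d m) = d m := by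
      intro m
      induction m with
      | zero => intro i hi; exact hfix i (by omega)
      | succ m ihm =>
        intro i hi
        rw [dsucc, hcomm i (N - 1 - m) (by omega) (by omega), ihm i (by omega)]
    have hup : ∀ m i, i < N → N - i < m → m ≤ N → s i (d m) = d m := by
      intro m
      induction m with
      | zero => intro i _ hi; omega
      | succ m ihm =>
        intro i hiN hi hm
        rcases Nat.lt_or_ge (N - i) m with h | h
        · rw [dsucc, ← hcomm (N - 1 - m) i (by omega) (by omega), ihm i hiN h (by omega)]
        -- The boundary case: here `d (m + 2)` is s_{i-1} s_i (d m), and the braid relation turns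
        -- s_i s_{i-1} s_i into s_{i-1} s_i s_{i-1}, whose innermost factor fixes `d m`.
        · obtain ⟨m, rfl⟩ : ∃ k, m = k + 1 := ⟨m - 1, by omega⟩
          have e1 : N - 1 - m = i := by omega
          have e2 : i = (N - 1 - (m + 1)) + 1 := by omega
          rw [dsucc, dsucc, e1]
          generalize N - 1 - (m + 1) = i' at e2
          subst e2
          rw [← hbraid i' (by omega), hlow m i' (by omega)]
    have hswap : ∀ i < N, ∀ m, m ≤ N →
        s i (d m) = d (Equiv.swap (N - 1 - i) (N - i) m) := by
      intro i hi m hm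
      rcases lt_trichotomy m (N - 1 - i) with h | h | h
      · rw [Equiv.swap_apply_of_ne_of_ne (by omega) (by omega), hlow m i (by omega)]
      · rw [h, Equiv.swap_apply_left, show N - i = (N - 1 - i) + 1 by omega, dsucc]
        congr 2; omega
      · rcases Nat.lt_or_ge (N - i) m with h' | h'
        · rw [Equiv.swap_apply_of_ne_of_ne (by omega) (by omega), hup m i hi h' hm]
        · have : m = N - i := by omega
          rw [this, Equiv.swap_apply_right, show N - i = (N - 1 - i) + 1 by omega, dsucc,
            show N - 1 - (N - 1 - i) = i by omega, hs i (by omega)]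
    have htop : ∀ m, m < N → s N (d (m + 1)) = d (m + 1) - b := by
      intro m
      induction m with
      | zero => intro hm; rw [dsucc, d0]; exact hbr _ (by omega)
      | succ m ihm =>
        intro hm
        rw [dsucc (m + 1), ← hcomm _ N (by omega) (by omega), ihm (by omega), map_sub,
          hfix _ (by omega)]
    have hN : ((N : K) + 2) ≠ 0 := by exact_mod_cast (by omega : N + 2 ≠ 0)
    -- The mean of the cocycle over the N + 2 cosets. The first N transpositions permute the `d m`,
    -- while `s N` lowers the sum by N + 2 times `b`: by 2b at `d 0` and by b at each of the other N
    -- terms.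
    let h : V := ((N : K) + 2)⁻¹ • ∑ m ∈ Finset.range (N + 1), d m
    refine ⟨f₀ + h, fun i hi => ?_⟩
    rcases Nat.lt_succ_iff_lt_or_eq.1 hi with hi | rfl
    · have : s i h = h := by
        simp only [h, map_smul, map_sum]
        congr 1
        rw [Finset.sum_congr rfl fun m hm => hswap i hi m (by simp at hm; omega)]
        refine Finset.sum_equiv (Equiv.swap (N - 1 - i) (N - i)) (fun m => ?_) fun _ _ => rfl
        simp only [Finset.mem_range, Equiv.swap_apply_def]
        split_ifs <;> omega
      rw [map_add, this, ← hf₀ i hi]; abel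
    · have : s i h = h - b := by
        simp only [h, map_smul, map_sum]
        rw [Finset.sum_range_succ', d0, hsb,
          Finset.sum_congr rfl fun m hm => htop m (by simpa using hm), Finset.sum_sub_distrib,
          Finset.sum_const, Finset.card_range, Finset.sum_range_succ' d, d0]
        rw [← Nat.cast_smul_eq_nsmul K]
        refine smul_right_injective V hN ?_
        simp only [smul_sub, smul_inv_smul₀ hN]
        module
      rw [map_add, this, ← sub_eq_zero, hb]; abel

universe u

/-! ### Signs -/

section Signs

/-- The sign `(-1)^i`, as a scalar. -/
def scalarSign (K : Type*) [Field K] (i : ZMod 2) : K := (((-1 : ℤˣ) ^ i : ℤˣ) : ℤ)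

variable {K : Type*} [Field K]

theorem units_smul_eq_scalarSign {V : Type*} [AddCommGroup V] [Module K V] (i : ZMod 2) (x : V) :
    ((-1 : ℤˣ) ^ i) • x = scalarSign K i • x := by
  rw [scalarSign, Int.cast_smul_eq_zsmul, Units.smul_def]

theorem scalarSign_add (i j : ZMod 2) :
    scalarSign K (i + j) = scalarSign K i * scalarSign K j := by
  simp [scalarSign, uzpow_add]

@[simp] theorem scalarSign_zero : scalarSign K 0 = 1 := by simp [scalarSign]

@[simp] theorem scalarSign_one : scalarSign K 1 = -1 := by simp [scalarSign]

theorem scalarSign_mul_self (i : ZMod 2) : scalarSign K i * scalarSign K i = 1 := by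
  rw [← scalarSign_add, (by decide : ∀ j : ZMod 2, j + j = 0) i, scalarSign_zero]

theorem isHomogeneous_iff {V : Type*} [AddCommGroup V] [Module K V] [Superspace K V]
    {i : ZMod 2} {x : V} :
    IsHomogeneous K i x ↔ (Superspace.parity (K := K)) x = scalarSign K i • x := by
  rw [IsHomogeneous, units_smul_eq_scalarSign (K := K)]

end Signs

/-! ### Lie superalgebras -/

section LieSuper

variable {K g : Type*} [Field K] [AddCommGroup g] [Module K g] [LieSuperalgebra K g]

theorem IsHomogeneous.bracket {i j : ZMod 2} {x y : g} (hx : IsHomogeneous K i x)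
    (hy : IsHomogeneous K j y) :
    IsHomogeneous K (i + j) (LieSuperalgebra.bracket (K := K) x y) := by
  rw [isHomogeneous_iff] at *
  rw [LieSuperalgebra.parity_bracket, hx, hy, map_smul, map_smul, LinearMap.smul_apply, smul_smul,
    scalarSign_add, mul_comm]

theorem bracket_skew {i j : ZMod 2} {x y : g} (hx : IsHomogeneous K i x)
    (hy : IsHomogeneous K j y) : LieSuperalgebra.bracket (K := K) x y =
      -(scalarSign K (i * j) • LieSuperalgebra.bracket (K := K) y x) := by
  rw [LieSuperalgebra.skew i j x y hx hy, units_smul_eq_scalarSign (K := K)]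

/-- The Jacobi identity multiplied by -(-1)^{|x||z|}, in the shape in which it verifies the braid
relation for the cocycle of brackets. -/
theorem bracket_leibniz {i j k : ZMod 2} {x y z : g} (hx : IsHomogeneous K i x)
    (hy : IsHomogeneous K j y) (hz : IsHomogeneous K k z) :
    LieSuperalgebra.bracket (K := K) (LieSuperalgebra.bracket (K := K) x y) z +
      scalarSign K (i * j) •
        LieSuperalgebra.bracket (K := K) y (LieSuperalgebra.bracket (K := K) x z) -
      LieSuperalgebra.bracket (K := K) x (LieSuperalgebra.bracket (K := K) y z) = 0 := by
  have h := LieSuperalgebra.jacobi i j k x y z hx hy hz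
  simp only [units_smul_eq_scalarSign (K := K)] at h
  rw [bracket_skew hz hx, map_neg, map_smul] at h
  rw [bracket_skew (hx.bracket hy) hz]
  have h1 := scalarSign_mul_self (K := K) (i * k)
  have h2 := congrArg (fun t => -(scalarSign K (i * k) • t)) h
  simp only [smul_zero, neg_zero] at h2
  rw [← h2, add_mul, scalarSign_add, mul_comm k i, mul_comm j i, mul_comm k j]
  generalize scalarSign K (i * k) = p at *
  generalize scalarSign K (i * j) = q at *
  have h3 : p * (q * p) = q := by rw [mul_left_comm, h1, mul_one]
  simp only [smul_neg, smul_add, smul_smul, neg_add, h1, h3, one_smul]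
  module

end LieSuper

/-! ### The canonical map into the enveloping superalgebra is injective -/

section Injective

open TensorAlgebra LieSuperalgebra

/-- The component of parity `i` of an element. -/
def homogPart (K : Type*) {V : Type*} [Field K] [AddCommGroup V] [Module K V] [Superspace K V]
    (i : ZMod 2) : V →ₗ[K] V :=
  (2 : K)⁻¹ • (LinearMap.id + scalarSign K i • (Superspace.parity (K := K)))

theorem homogPart_isHomogeneous {K V : Type*} [Field K] [AddCommGroup V] [Module K V]
    [Superspace K V] (i : ZMod 2) (x : V) : IsHomogeneous K i (homogPart K i x) := by
  rw [isHomogeneous_iff]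
  simp only [homogPart, LinearMap.smul_apply, LinearMap.add_apply, LinearMap.id_apply, map_smul,
    map_add, Superspace.parity_parity]
  rw [smul_comm (scalarSign K i)]
  congr 1
  rw [smul_add, smul_smul, scalarSign_mul_self, one_smul, add_comm]

theorem homogPart_add {K V : Type*} [Field K] [CharZero K] [AddCommGroup V] [Module K V]
    [Superspace K V] (x : V) : homogPart K 0 x + homogPart K 1 x = x := by
  simp only [homogPart, LinearMap.smul_apply, LinearMap.add_apply, LinearMap.id_apply,
    scalarSign_zero, scalarSign_one]
  module

theorem homogPart_of_isHomogeneous {K V : Type*} [Field K] [CharZero K] [AddCommGroup V]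
    [Module K V] [Superspace K V] {i : ZMod 2} (j : ZMod 2) {x : V} (hx : IsHomogeneous K i x) :
    homogPart K j x = if j = i then x else 0 := by
  rw [isHomogeneous_iff] at hx
  simp only [homogPart, LinearMap.smul_apply, LinearMap.add_apply, LinearMap.id_apply, hx]
  have h : ∀ i : ZMod 2, i = 0 ∨ i = 1 := by decide
  rcases h i with rfl | rfl <;> rcases h j with rfl | rfl <;>
    simp only [scalarSign_zero, scalarSign_one, if_true, zero_ne_one, one_ne_zero, if_false] <;>
    module

/-- Every superspace has a basis of homogeneous elements. -/
theorem exists_homogeneous_basis (K : Type*) (V : Type u) [Field K] [CharZero K] [AddCommGroup V]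
    [Module K V] [Superspace K V] :
    ∃ (J : Type u) (π : J → ZMod 2) (b : Module.Basis J K V),
      ∀ j, IsHomogeneous K (π j) (b j) := by
  -- The eigenspaces of the parity operator for the eigenvalues 1 and -1. They are complementary
  -- because 2 is invertible.
  let L : ZMod 2 → Submodule K V := fun i =>
    LinearMap.ker ((Superspace.parity (K := K)) - scalarSign K i • LinearMap.id)
  have hL : ∀ i x, x ∈ L i ↔ IsHomogeneous K i x := fun i x => by
    rw [isHomogeneous_iff, LinearMap.mem_ker, LinearMap.sub_apply, sub_eq_zero]; rfl
  have hc : IsCompl (L 0) (L 1) := by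
    constructor
    · rw [Submodule.disjoint_def]
      intro x h0 h1
      rw [hL] at h0 h1
      have h := homogPart_of_isHomogeneous 0 h1
      rwa [homogPart_of_isHomogeneous 0 h0, if_pos rfl, if_neg zero_ne_one] at h
    · rw [codisjoint_iff, eq_top_iff]
      intro x _
      rw [← homogPart_add (K := K) x]
      exact Submodule.add_mem_sup ((hL _ _).2 (homogPart_isHomogeneous 0 x))
        ((hL _ _).2 (homogPart_isHomogeneous 1 x))
  let b₀ := Module.Basis.ofVectorSpace K (L 0)
  let b₁ := Module.Basis.ofVectorSpace K (L 1)
  refine ⟨_, Sum.elim (fun _ => 0) (fun _ => 1),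
    (b₀.prod b₁).map (Submodule.prodEquivOfIsCompl _ _ hc), ?_⟩
  rintro (j | j)
  · simpa using (hL 0 _).1 (b₀ j).2
  · simpa using (hL 1 _).1 (b₁ j).2

end Injective

/-! ### Functionals on the tensor algebra -/

section Words

open TensorAlgebra LieSuperalgebra

variable {K : Type*} {g J : Type u} [Field K] [AddCommGroup g] [Module K g]
  (b : Module.Basis J K g)

/-- The product of basis vectors in the tensor algebra. -/
noncomputable def tensorWord (w : List J) : TensorAlgebra K g := (w.map fun j => ι K (b j)).prod

@[simp] theorem tensorWord_nil : tensorWord b [] = 1 := rfl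

@[simp] theorem tensorWord_cons (j : J) (w : List J) :
    tensorWord b (j :: w) = ι K (b j) * tensorWord b w := by simp [tensorWord]

@[simp] theorem tensorWord_append (w w' : List J) :
    tensorWord b (w ++ w') = tensorWord b w * tensorWord b w' := by simp [tensorWord]

/-- Identifies the basis of the tensor algebra with products of basis vectors, so that a linear map
may be prescribed on words. -/
theorem basis_tensorAlgebra_apply (w : FreeMonoid J) :
    b.tensorAlgebra w = tensorWord b (FreeMonoid.toList w) := by
  have : (equivFreeAlgebra b).symm (FreeAlgebra.equivMonoidAlgebraFreeMonoid.symm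
      (MonoidAlgebra.of K _ w)) = tensorWord b (FreeMonoid.toList w) := by
    induction w using FreeMonoid.recOn with
    | one => rw [map_one, map_one, map_one]; rfl
    | of_mul j w ih =>
      rw [map_mul, map_mul, map_mul, ih, FreeMonoid.toList_of_mul, tensorWord_cons]
      congr 1
      simp [FreeAlgebra.equivMonoidAlgebraFreeMonoid]
  exact this

/-- The linear map on the tensor algebra with given values on words in the basis. -/
noncomputable def wordFunctional (F : List J → g) : TensorAlgebra K g →ₗ[K] g :=
  b.tensorAlgebra.constr K fun w => F (FreeMonoid.toList w)

@[simp] theorem wordFunctional_tensorWord (F : List J → g) (w : List J) :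
    wordFunctional b F (tensorWord b w) = F w := by
  have := b.tensorAlgebra.constr_basis K (fun w => F (FreeMonoid.toList w)) (FreeMonoid.ofList w)
  rwa [basis_tensorAlgebra_apply] at this

/-- The tensors of degree `n`. -/
noncomputable def tensorDegree (n : ℕ) : Submodule K (TensorAlgebra K g) :=
  Submodule.span K (tensorWord b '' {w | w.length = n})

theorem tensorWord_mem_tensorDegree (w : List J) {n : ℕ} (h : w.length = n) :
    tensorWord b w ∈ tensorDegree b n := Submodule.subset_span ⟨w, h, rfl⟩

theorem ι_mem_tensorDegree (x : g) : ι K x ∈ tensorDegree b 1 := by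
  have h : ⊤ ≤ (tensorDegree b 1).comap (ι K) := by
    rw [← b.span_eq, Submodule.span_le]
    rintro _ ⟨j, rfl⟩
    exact Submodule.subset_span ⟨[j], rfl, by simp⟩
  exact h (Submodule.mem_top (x := x))

theorem mul_mem_tensorDegree {m n : ℕ} {A C : TensorAlgebra K g} (hA : A ∈ tensorDegree b m)
    (hC : C ∈ tensorDegree b n) : A * C ∈ tensorDegree b (m + n) := by
  have h := Submodule.mul_mem_mul hA hC
  rw [tensorDegree, tensorDegree, Submodule.span_mul_span] at h
  refine Submodule.span_mono ?_ h
  rintro _ ⟨_, ⟨w, hw, rfl⟩, _, ⟨w', hw', rfl⟩, rfl⟩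
  exact ⟨w ++ w', by simp_all, tensorWord_append b w w'⟩

theorem span_tensorWord : Submodule.span K (Set.range (tensorWord b)) = ⊤ := by
  rw [← b.tensorAlgebra.span_eq]
  congr 1
  ext x
  constructor
  · rintro ⟨w, rfl⟩; exact ⟨FreeMonoid.ofList w, basis_tensorAlgebra_apply b _⟩
  · rintro ⟨w, rfl⟩; exact ⟨FreeMonoid.toList w, (basis_tensorAlgebra_apply b _).symm⟩

theorem wordFunctional_congr {F F' : List J → g} {n : ℕ} (h : ∀ w, w.length = n → F w = F' w)
    {A : TensorAlgebra K g} (hA : A ∈ tensorDegree b n) :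
    wordFunctional b F A = wordFunctional b F' A := by
  have : tensorDegree b n ≤ LinearMap.eqLocus (wordFunctional b F) (wordFunctional b F') := by
    refine Submodule.span_le.2 ?_
    rintro _ ⟨w, hw, rfl⟩
    simpa using h w hw
  exact this hA

end Words

/-! ### Supercommutators in the tensor algebra -/

section Relator

open TensorAlgebra LieSuperalgebra

variable (K : Type*) (g : Type u) [Field K] [AddCommGroup g] [Module K g]
  [Superspace K g]

/-- The supercommutator `x y - (-1)^{|x||y|} y x` in the tensor algebra. -/
noncomputable def tensorCommutator : g →ₗ[K] g →ₗ[K] TensorAlgebra K g :=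
  -- The sign must be bilinear in x and y without reference to homogeneity: (-1)^{|x||y|} y x is
  -- written y₀ x + y₁ σ(x), with σ the parity operator and y₀, y₁ the components of y.
  let m := LinearMap.mul K (TensorAlgebra K g)
  m.compl₁₂ (ι K) (ι K) - (m.compl₁₂ (ι K ∘ₗ homogPart K 0) (ι K)).flip -
    (m.compl₁₂ (ι K ∘ₗ homogPart K 1) (ι K ∘ₗ Superspace.parity)).flip

variable {K g} in
theorem tensorCommutator_apply [CharZero K] {i j : ZMod 2} {x y : g} (hx : IsHomogeneous K i x)
    (hy : IsHomogeneous K j y) : tensorCommutator K g x y =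
      ι K x * ι K y - scalarSign K (i * j) • (ι K y * ι K x) := by
  have hx' := isHomogeneous_iff.1 hx
  simp only [tensorCommutator, LinearMap.sub_apply, LinearMap.compl₁₂_apply, LinearMap.flip_apply,
    LinearMap.comp_apply, homogPart_of_isHomogeneous _ hy, hx', LinearMap.mul_apply']
  have h : ∀ i : ZMod 2, i = 0 ∨ i = 1 := by decide
  rcases h j with rfl | rfl <;> simp

end Relator

/-! ### Extension of functionals to words with one more letter -/

section Exchange

open TensorAlgebra LieSuperalgebra

variable {K : Type*} {g J : Type u} [Field K] [AddCommGroup g] [Module K g]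
  [LieSuperalgebra K g] (b : Module.Basis J K g) (π : J → ZMod 2)

/-- The functional `f'` on words of length `n` extends `f` on words of length `n - 1` compatibly
with the relations of the enveloping superalgebra. -/
def IsExchange (n : ℕ) (f' f : List J → g) : Prop :=
  ∀ (u v : List J) (i j : J), u.length + v.length + 2 = n →
    f' (u ++ i :: j :: v) - scalarSign K (π i * π j) • f' (u ++ j :: i :: v) =
      wordFunctional b f (tensorWord b u * (ι K (bracket (K := K) (b i) (b j)) * tensorWord b v))

variable {b π}

/-- Both sides are linear in each of A, C, x and y, so words and basis vectors suffice. The general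
form is needed because the bracket of two basis vectors is not a basis vector. -/
theorem IsExchange.apply [CharZero K] (hb : ∀ j, IsHomogeneous K (π j) (b j)) {n : ℕ}
    {f' f : List J → g} (h : IsExchange b π n f' f) {k l : ℕ} (hkl : k + l + 2 = n)
    {A C : TensorAlgebra K g} (hA : A ∈ tensorDegree b k) (hC : C ∈ tensorDegree b l) (x y : g) :
    wordFunctional b f' (A * (tensorCommutator K g x y * C)) =
      wordFunctional b f (A * (ι K (bracket (K := K) x y) * C)) := by
  induction hA using Submodule.span_induction with
  | zero => simp
  | add A A' _ _ h h' => simp only [add_mul, map_add, h, h']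
  | smul c A _ h => simp only [smul_mul_assoc, map_smul, h]
  | mem A hA =>
  obtain ⟨u, hu, rfl⟩ := hA
  induction hC using Submodule.span_induction with
  | zero => simp
  | add A A' _ _ h h' => simp only [mul_add, map_add, h, h']
  | smul c A _ h => simp only [mul_smul_comm, map_smul, h]
  | mem C hC =>
  obtain ⟨v, hv, rfl⟩ := hC
  let M : TensorAlgebra K g →ₗ[K] TensorAlgebra K g :=
    LinearMap.mulLeft K (tensorWord b u) ∘ₗ LinearMap.mulRight K (tensorWord b v)
  have key : (tensorCommutator K g).compr₂ (wordFunctional b f' ∘ₗ M) =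
      ((bracket (K := K)).compr₂ (ι K)).compr₂ (wordFunctional b f ∘ₗ M) := by
    refine b.ext fun i => b.ext fun j => ?_
    have h1 := h u v i j (by simp_all)
    simp only [LinearMap.compr₂_apply, LinearMap.comp_apply, M, LinearMap.mulLeft_apply,
      LinearMap.mulRight_apply, tensorCommutator_apply (hb i) (hb j)]
    rw [← h1, sub_mul, mul_sub, map_sub, smul_mul_assoc, mul_smul_comm, map_smul, mul_assoc,
      mul_assoc, ← tensorWord_cons, ← tensorWord_cons, ← tensorWord_cons, ← tensorWord_cons,
      ← tensorWord_append, ← tensorWord_append, wordFunctional_tensorWord,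
      wordFunctional_tensorWord]
  exact LinearMap.congr_fun₂ key x y

variable (K) in
/-- The operator on functions of words that interchanges the letters `i` and `i + 1` in words of
length `n`, with the appropriate sign. -/
noncomputable def swapLetters (π : J → ZMod 2) (n i : ℕ) :
    (List J → g) →ₗ[K] (List J → g) where
  toFun F w := match w.drop i with
    | x :: y :: v => if w.length = n then
        scalarSign K (π x * π y) • F (w.take i ++ y :: x :: v) else F w
    | _ => F w
  map_add' F F' := by
    funext w
    simp only [Pi.add_apply]
    split
    · split_ifs <;> simp
    · rfl
  map_smul' c F := by
    funext w
    simp only [Pi.smul_apply, RingHom.id_apply]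
    split
    · split_ifs
      · rw [smul_comm]
      · rfl
    · rfl

omit [LieSuperalgebra K g] in
theorem swapLetters_apply (n : ℕ) (F : List J → g) (u v : List J) (x y : J)
    (hn : u.length + v.length + 2 = n) :
    swapLetters K π n u.length F (u ++ x :: y :: v) =
      scalarSign K (π x * π y) • F (u ++ y :: x :: v) := by
  have : (u ++ x :: y :: v).length = n := by simp; omega
  simp [swapLetters, hn, ← add_assoc]

-- The operator is the identity away from length `n`, so the relations of the symmetric group need
-- be checked only on words of length `n`.
omit [LieSuperalgebra K g] in
theorem swapLetters_apply' (n i : ℕ) (F : List J → g) (w : List J) (hn : w.length ≠ n) :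
    swapLetters K π n i F w = F w := by
  simp only [swapLetters, LinearMap.coe_mk, AddHom.coe_mk, if_neg hn]
  split <;> rfl

/-- The cocycle of the symmetric group that measures the failure of supersymmetry. -/
noncomputable def bracketLetters (b : Module.Basis J K g) (f : List J → g) (n i : ℕ) :
    List J → g := fun w => match w.drop i with
    | x :: y :: v => if w.length = n then wordFunctional b f
        (tensorWord b (w.take i) * (ι K (bracket (K := K) (b x) (b y)) * tensorWord b v)) else 0
    | _ => 0

theorem bracketLetters_apply (f : List J → g) (n : ℕ) (u v : List J) (x y : J)
    (hn : u.length + v.length + 2 = n) :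
    bracketLetters b f n u.length (u ++ x :: y :: v) = wordFunctional b f
        (tensorWord b u * (ι K (bracket (K := K) (b x) (b y)) * tensorWord b v)) := by
  simp [bracketLetters, hn, ← add_assoc]

theorem bracketLetters_apply' (f : List J → g) (n i : ℕ) (w : List J) (hn : w.length ≠ n) :
    bracketLetters b f n i w = 0 := by
  simp only [bracketLetters, if_neg hn]
  split <;> rfl

omit [LieSuperalgebra K g] in
theorem swapLetters_succ_apply (n : ℕ) (F : List J → g) (u v : List J) (x y z : J)
    (hn : u.length + v.length + 3 = n) :
    swapLetters K π n (u.length + 1) F (u ++ x :: y :: z :: v) =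
      scalarSign K (π y * π z) • F (u ++ x :: z :: y :: v) := by
  have h := swapLetters_apply (K := K) (π := π) n F (u ++ [x]) v y z (by simp; omega)
  simpa using h

theorem bracketLetters_succ_apply (f : List J → g) (n : ℕ) (u v : List J) (x y z : J)
    (hn : u.length + v.length + 3 = n) :
    bracketLetters b f n (u.length + 1) (u ++ x :: y :: z :: v) = wordFunctional b f
        (tensorWord b u * (ι K (b x) *
          (ι K (bracket (K := K) (b y) (b z)) * tensorWord b v))) := by
  have h := bracketLetters_apply (b := b) f n (u ++ [x]) v y z (by simp; omega)
  simpa [mul_assoc] using h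

theorem List.exists_eq_append_of_add_two_le {w : List J} {i : ℕ} (h : i + 2 ≤ w.length) :
    ∃ u x y v, w = u ++ x :: y :: v ∧ u.length = i := by
  obtain ⟨a, c, rfl, ha⟩ : ∃ a c, w = a ++ c ∧ a.length = i :=
    ⟨w.take i, w.drop i, (w.take_append_drop i).symm, by simp; omega⟩
  match c, h with
  | x :: y :: v, _ => exact ⟨a, x, y, v, rfl, ha⟩
  | [x], h => simp at h; omega
  | [], h => simp at h; omega

theorem List.exists_eq_append_of_add_three_le {w : List J} {i : ℕ} (h : i + 3 ≤ w.length) :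
    ∃ u x y z v, w = u ++ x :: y :: z :: v ∧ u.length = i := by
  obtain ⟨u, x, y, c, rfl, hu⟩ := List.exists_eq_append_of_add_two_le
    (show i + 2 ≤ w.length by omega)
  match c, h with
  | z :: v, _ => exact ⟨u, x, y, z, v, rfl, hu⟩
  | [], h => simp at h; omega

/-- A functional on words of length `n` extends to words of length `n + 1` compatibly with the
relations of the enveloping superalgebra. -/
theorem IsExchange.exists_succ [CharZero K] (hb : ∀ j, IsHomogeneous K (π j) (b j)) {n : ℕ}
    {f f₀ : List J → g} (h : IsExchange b π n f f₀) : ∃ f', IsExchange b π (n + 1) f' f := by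
  suffices ∃ f', ∀ i < n, f' - swapLetters K π (n + 1) i f' = bracketLetters b f (n + 1) i by
    obtain ⟨f', hf'⟩ := this
    refine ⟨f', fun u v i j huv => ?_⟩
    have h1 := congrFun (hf' u.length (by omega)) (u ++ i :: j :: v)
    rwa [Pi.sub_apply, swapLetters_apply _ _ _ _ _ _ huv,
      bracketLetters_apply _ _ _ _ _ _ huv] at h1
  -- The exchange condition at position i prescribes f' - s_i f'. The first three goals are the
  -- relations between the signed transpositions, the last three the cocycle conditions.
  refine exists_coboundary K (swapLetters K π (n + 1)) n
    (bracketLetters b f (n + 1)) ?_ ?_ ?_ ?_ ?_ ?_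
  · intro i hi F
    funext w
    by_cases hw : w.length = n + 1
    · obtain ⟨u, x, y, v, rfl, rfl⟩ := List.exists_eq_append_of_add_two_le
        (show i + 2 ≤ w.length by omega)
      simp at hw
      rw [swapLetters_apply _ _ _ _ _ _ (by omega), swapLetters_apply _ _ _ _ _ _ (by omega),
        smul_smul, mul_comm (π y), scalarSign_mul_self, one_smul]
    · rw [swapLetters_apply' _ _ _ _ hw, swapLetters_apply' _ _ _ _ hw]
  · intro i j hij hj F
    funext w
    by_cases hw : w.length = n + 1
    · obtain ⟨a, z, t, v, rfl, rfl⟩ := List.exists_eq_append_of_add_two_le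
        (show j + 2 ≤ w.length by omega)
      obtain ⟨u, x, y, c, rfl, rfl⟩ := List.exists_eq_append_of_add_two_le hij
      simp at hw
      have e1 : ∀ (x y z t : J), (u ++ x :: y :: c) ++ z :: t :: v =
        u ++ x :: y :: (c ++ z :: t :: v) := by simp
      have e2 : (u ++ x :: y :: c).length = (u ++ y :: x :: c).length := by simp
      rw [e1, swapLetters_apply _ _ _ _ _ _ (by simp; omega), ← e1, ← e1, e2,
        swapLetters_apply _ _ _ _ _ _ (by simp; omega), ← e2,
        swapLetters_apply _ _ _ _ _ _ (by simp; omega), e1, e1,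
        swapLetters_apply _ _ _ _ _ _ (by simp; omega), smul_comm]
    · simp only [swapLetters_apply' _ _ _ _ hw]
  · intro i hi F
    funext w
    by_cases hw : w.length = n + 1
    · obtain ⟨u, x, y, z, v, rfl, rfl⟩ := List.exists_eq_append_of_add_three_le
        (show i + 3 ≤ w.length by omega)
      simp at hw
      rw [swapLetters_apply _ _ _ _ _ _ (by simp; omega),
        swapLetters_succ_apply _ _ _ _ _ _ _ (by omega),
        swapLetters_apply _ _ _ _ _ _ (by simp; omega),
        swapLetters_succ_apply _ _ _ _ _ _ _ (by omega),
        swapLetters_apply _ _ _ _ _ _ (by simp; omega),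
        swapLetters_succ_apply _ _ _ _ _ _ _ (by omega)]
      module
    · simp only [swapLetters_apply' _ _ _ _ hw]
  -- The condition from s_i² = 1 is the supersymmetry of the bracket.
  · intro i hi
    funext w
    rw [Pi.add_apply]
    by_cases hw : w.length = n + 1
    · obtain ⟨u, x, y, v, rfl, rfl⟩ := List.exists_eq_append_of_add_two_le
        (show i + 2 ≤ w.length by omega)
      simp at hw
      rw [swapLetters_apply _ _ _ _ _ _ (by omega), bracketLetters_apply _ _ _ _ _ _ (by omega),
        bracketLetters_apply _ _ _ _ _ _ (by omega), bracket_skew (hb x) (hb y)]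
      simp
    · rw [swapLetters_apply' _ _ _ _ hw, bracketLetters_apply' _ _ _ _ hw]
      simp
  -- For distant transpositions, exchanging x, y in a word that contains [z, t] and exchanging z, t
  -- in a word that contains [x, y] leave the same value of `f₀`, on the word with both brackets.
  · intro i j hij hj
    funext w
    rw [Pi.add_apply, Pi.add_apply]
    by_cases hw : w.length = n + 1
    · obtain ⟨a, z, t, v, rfl, rfl⟩ := List.exists_eq_append_of_add_two_le
        (show j + 2 ≤ w.length by omega)
      obtain ⟨u, x, y, c, rfl, rfl⟩ := List.exists_eq_append_of_add_two_le hij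
      simp at hw
      have e1 : ∀ (x y z t : J), (u ++ x :: y :: c) ++ z :: t :: v =
        u ++ x :: y :: (c ++ z :: t :: v) := by simp
      have e2 : (u ++ x :: y :: c).length = (u ++ y :: x :: c).length := by simp
      rw [swapLetters_apply _ _ _ _ _ _ (by simp; omega),
        bracketLetters_apply _ _ _ _ _ _ (by simp; omega), e1, e1,
        swapLetters_apply _ _ _ _ _ _ (by simp; omega),
        bracketLetters_apply _ _ _ _ _ _ (by simp; omega),
        bracketLetters_apply _ _ _ _ _ _ (by simp; omega), ← e1 y x z t, e2,
        bracketLetters_apply _ _ _ _ _ _ (by simp; omega)]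
      have hu := tensorWord_mem_tensorDegree b u rfl
      have hv := tensorWord_mem_tensorDegree b v rfl
      have hc := tensorWord_mem_tensorDegree b c rfl
      have h1 := h.apply hb (by omega) hu (mul_mem_tensorDegree b hc (mul_mem_tensorDegree b
        (ι_mem_tensorDegree b (bracket (K := K) (b z) (b t))) hv)) (b x) (b y)
      have h2 := h.apply hb (by omega) (mul_mem_tensorDegree b (mul_mem_tensorDegree b hu
        (ι_mem_tensorDegree b (bracket (K := K) (b x) (b y)))) hc) hv (b z) (b t)
      rw [tensorCommutator_apply (hb _) (hb _)] at h1 h2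
      simp only [tensorWord_append, tensorWord_cons, mul_assoc, sub_mul, mul_sub, map_sub,
        smul_mul_assoc, mul_smul_comm, map_smul] at h1 h2 ⊢
      rw [← h2, sub_eq_iff_eq_add] at h1
      rw [h1]
      abel
    · simp only [swapLetters_apply' _ _ _ _ hw, bracketLetters_apply' _ _ _ _ hw]
  -- For the braid relation, `h` turns the difference of the two sides into a sum of three double
  -- brackets of x, y, z, which vanishes by the Jacobi identity.
  · intro i hi
    funext w
    simp only [Pi.add_apply]
    by_cases hw : w.length = n + 1
    · obtain ⟨u, x, y, z, v, rfl, rfl⟩ := List.exists_eq_append_of_add_three_le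
        (show i + 3 ≤ w.length by omega)
      simp at hw
      rw [swapLetters_apply _ _ _ _ _ _ (by simp; omega),
        swapLetters_apply _ _ _ _ _ _ (by simp; omega),
        swapLetters_succ_apply _ _ _ _ _ _ _ (by omega),
        swapLetters_succ_apply _ _ _ _ _ _ _ (by omega),
        swapLetters_succ_apply _ _ _ _ _ _ _ (by omega),
        swapLetters_apply _ _ _ _ _ _ (by simp; omega),
        bracketLetters_apply _ _ _ _ _ _ (by simp; omega),
        bracketLetters_apply _ _ _ _ _ _ (by simp; omega),
        bracketLetters_apply _ _ _ _ _ _ (by simp; omega),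
        bracketLetters_succ_apply _ _ _ _ _ _ _ (by omega),
        bracketLetters_succ_apply _ _ _ _ _ _ _ (by omega),
        bracketLetters_succ_apply _ _ _ _ _ _ _ (by omega)]
      have hu := tensorWord_mem_tensorDegree b u rfl
      have hv := tensorWord_mem_tensorDegree b v rfl
      have h1 := h.apply hb (by omega) hu hv (bracket (K := K) (b x) (b y)) (b z)
      have h2 := h.apply hb (by omega) hu hv (b y) (bracket (K := K) (b x) (b z))
      have h3 := h.apply hb (by omega) hu hv (b x) (bracket (K := K) (b y) (b z))
      rw [tensorCommutator_apply ((hb _).bracket (hb _)) (hb _)] at h1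
      rw [tensorCommutator_apply (hb _) ((hb _).bracket (hb _))] at h2 h3
      have h4 := congrArg (fun q => wordFunctional b f₀
        (tensorWord b u * (ι K q * tensorWord b v))) (bracket_leibniz (hb x) (hb y) (hb z))
      have hxy := scalarSign_mul_self (K := K) (π x * π y)
      simp only [tensorWord_cons, mul_assoc, sub_mul, mul_sub, map_sub, map_add, add_mul, mul_add,
        smul_mul_assoc, mul_smul_comm, map_smul, scalarSign_add, map_zero, zero_mul,
        mul_zero] at h1 h2 h3 h4 ⊢
      rw [← h1, ← h2, ← h3] at h4
      rw [mul_comm (π y) (π x)] at h4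
      generalize scalarSign K (π x * π y) = p at *
      generalize scalarSign K (π x * π z) = q at *
      generalize scalarSign K (π y * π z) = r at *
      rw [← sub_eq_zero, ← h4]
      have h5 : p * (p * r) = r := by rw [← mul_assoc, hxy, one_mul]
      simp only [smul_sub, smul_smul, h5]
      module
    · simp only [swapLetters_apply' _ _ _ _ hw, bracketLetters_apply' _ _ _ _ hw]

end Exchange

/-! ### Embedding of a Lie superalgebra in its enveloping superalgebra -/

section Injective

open TensorAlgebra LieSuperalgebra

variable {K : Type*} {g : Type u} [Field K] [CharZero K] [AddCommGroup g] [Module K g]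
  [LieSuperalgebra K g]

theorem exists_isExchange_seq {J : Type u} {b : Module.Basis J K g} {π : J → ZMod 2}
    (hb : ∀ j, IsHomogeneous K (π j) (b j)) :
    ∃ f : ℕ → List J → g, (∀ j, f 1 [j] = b j) ∧ ∀ n, IsExchange b π (n + 1) (f (n + 1)) (f n) := by
  let S : ℕ → Type _ := fun n => {p : (List J → g) × (List J → g) // IsExchange b π (n + 1) p.1 p.2}
  let f₁ : List J → g := fun w => (w.map b).sum
  -- The condition in degree one is vacuous, since exchanging letters takes at least two of them; so
  -- the functional of degree zero may be 0.
  let s₀ : S 0 := ⟨(f₁, 0), fun u v i j h => absurd h (by omega)⟩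
  -- Each stage carries the functionals of two successive degrees with their compatibility, as the
  -- choice of the next functional depends on it. Stage n holds degrees n + 1 and n.
  let seq : ∀ n, S n := fun n => Nat.rec s₀
    (fun n s => ⟨(Classical.choose (s.2.exists_succ hb), s.1.1),
      Classical.choose_spec (s.2.exists_succ hb)⟩) n
  refine ⟨fun n => Nat.rec 0 (fun n _ => (seq n).1.1) n, fun j => ?_, fun n => ?_⟩
  · change f₁ [j] = b j
    simp [f₁]
  · cases n with
    | zero => exact (seq 0).2
    | succ n => exact (seq (n + 1)).2

variable (K g) in
/-- There is a functional on the tensor algebra that is the identity in degree one and vanishes on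
the relations of the enveloping superalgebra. -/
theorem exists_functional : ∃ Λ : TensorAlgebra K g →ₗ[K] g, (∀ x, Λ (ι K x) = x) ∧
    ∀ A C x y, Λ (A * (tensorCommutator K g x y * C)) =
      Λ (A * (ι K (bracket (K := K) x y) * C)) := by
  obtain ⟨J, π, b, hb⟩ := exists_homogeneous_basis K g
  obtain ⟨f, hf₁, hf⟩ := exists_isExchange_seq hb
  have key : ∀ n, ∀ A ∈ tensorDegree b n,
      wordFunctional b (fun w => f w.length w) A = wordFunctional b (f n) A :=
    fun n A hA => wordFunctional_congr b (fun w hw => by rw [hw]) hA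
  refine ⟨wordFunctional b fun w => f w.length w, fun x => ?_, fun A C x y => ?_⟩
  · have : wordFunctional b (f 1) ∘ₗ ι K = LinearMap.id := b.ext fun j => by
      have h := wordFunctional_tensorWord b (f 1) [j]
      rw [hf₁] at h
      simpa using h
    rw [key 1 _ (ι_mem_tensorDegree b x)]
    exact LinearMap.congr_fun this x
  · have hA : A ∈ Submodule.span K (Set.range (tensorWord b)) := by
      rw [span_tensorWord]; trivial
    have hC : C ∈ Submodule.span K (Set.range (tensorWord b)) := by
      rw [span_tensorWord]; trivial
    induction hA using Submodule.span_induction with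
    | zero => simp
    | add A A' _ _ h h' => simp only [add_mul, map_add, h, h']
    | smul c A _ h => simp only [smul_mul_assoc, map_smul, h]
    | mem A hA =>
    obtain ⟨u, rfl⟩ := hA
    induction hC using Submodule.span_induction with
    | zero => simp
    | add A A' _ _ h h' => simp only [mul_add, map_add, h, h']
    | smul c A _ h => simp only [mul_smul_comm, map_smul, h]
    | mem C hC =>
    obtain ⟨v, rfl⟩ := hC
    have hu := tensorWord_mem_tensorDegree b u rfl
    have hv := tensorWord_mem_tensorDegree b v rfl
    have h1 := (hf (u.length + v.length + 1)).apply hb (by omega) hu hv x y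
    rw [key (u.length + (1 + v.length)) _ (mul_mem_tensorDegree b hu
      (mul_mem_tensorDegree b (ι_mem_tensorDegree b _) hv)), key (u.length + ((1 + 1) + v.length))]
    · convert h1 using 3 <;> congr 1 <;> omega
    · refine mul_mem_tensorDegree b hu (mul_mem_tensorDegree b ?_ hv)
      simp only [tensorCommutator, LinearMap.sub_apply, LinearMap.compl₁₂_apply,
        LinearMap.flip_apply, LinearMap.comp_apply, LinearMap.mul_apply']
      have h := fun x y => mul_mem_tensorDegree b (ι_mem_tensorDegree b x) (ι_mem_tensorDegree b y)
      exact Submodule.sub_mem _ (Submodule.sub_mem _ (h _ _) (h _ _)) (h _ _)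

variable (K g) in
/-- A Lie superalgebra embeds into its enveloping superalgebra. -/
theorem SuperEnveloping.ι_injective : Function.Injective (SuperEnveloping.ι K g) := by
  obtain ⟨Λ, hΛ, hrel⟩ := exists_functional K g
  -- The largest two-sided ideal in the kernel of Λ. It contains the relations of U(g), so an x in g
  -- that vanishes in U(g) lies in it, and x = Λ(x) = 0.
  let N : Ideal (TensorAlgebra K g) :=
    { carrier := {t | ∀ A C, Λ (A * (t * C)) = 0}
      add_mem' := fun h h' A C => by rw [add_mul, mul_add, map_add, h, h', add_zero]
      zero_mem' := fun A C => by simp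
      smul_mem' := fun c t h A C => by
        rw [smul_eq_mul, mul_assoc, ← mul_assoc A]; exact h _ _ }
  have hN : N.IsTwoSided := ⟨fun {t} c h A C => by rw [mul_assoc]; exact h _ _⟩
  have hr : ∀ ⦃s t⦄, EnvelopingRel K g s t →
      Ideal.Quotient.mk N s = Ideal.Quotient.mk N t := by
    rintro _ _ ⟨i, j, x, y, hx, hy⟩
    rw [Ideal.Quotient.eq]
    intro A C
    have h := hrel A C x y
    rw [tensorCommutator_apply hx hy] at h
    rw [units_smul_eq_scalarSign (K := K), ← sub_sub, sub_mul, mul_sub, map_sub, h, sub_self]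
  rw [injective_iff_map_eq_zero]
  intro x hx
  have h0 : RingQuot.mkRingHom (EnvelopingRel K g) (TensorAlgebra.ι K x) = 0 := by
    rw [← RingQuot.mkAlgHom_coe K]; exact hx
  have h1 := RingQuot.lift_mkRingHom_apply (Ideal.Quotient.mk N) hr (TensorAlgebra.ι K x)
  rw [h0, map_zero, eq_comm, Ideal.Quotient.eq_zero_iff_mem] at h1
  have h2 := h1 1 1
  rwa [one_mul, mul_one, hΛ] at h2

end Injective

/-! ### Topology of the space of series -/

namespace SuperSeries

section Topology

variable {K : Type*} {σ : Type*} {v : SuperVars σ} {W : Type*}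

instance [AddCommGroup W] : IsTopologicalAddGroup (SuperSeries K v W) := by
  let _ : TopologicalSpace W := ⊥
  have _ : DiscreteTopology W := ⟨rfl⟩
  exact inferInstanceAs (IsTopologicalAddGroup (SuperMonomial v → W))

instance : RegularSpace (SuperSeries K v W) := by
  let _ : TopologicalSpace W := ⊥
  have _ : DiscreteTopology W := ⟨rfl⟩
  exact inferInstanceAs (RegularSpace (SuperMonomial v → W))

theorem ext_apply {f f' : SuperSeries K v W} (h : ∀ α, f α = f' α) : f = f' := funext h

/-- A map is continuous if every coefficient of a value depends on finitely many coefficients of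
the argument. -/
theorem continuous_of_finite {σ' : Type*} {v' : SuperVars σ'} {W' : Type*}
    (F : SuperSeries K v W → SuperSeries K v' W')
    (h : ∀ γ, ∃ s : Set (SuperMonomial v), s.Finite ∧
      ∀ f f', (∀ α ∈ s, f α = f' α) → F f γ = F f' γ) : Continuous F := by
  let _ : TopologicalSpace W := ⊥
  have _ : DiscreteTopology W := ⟨rfl⟩
  let _ : TopologicalSpace W' := ⊥
  have _ : DiscreteTopology W' := ⟨rfl⟩
  refine continuous_pi fun γ => ?_
  obtain ⟨s, hs, hF⟩ := h γ
  refine IsLocallyConstant.continuous ((IsLocallyConstant.iff_exists_open _).2 fun f => ?_)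
  refine ⟨s.pi fun α => {f α}, isOpen_set_pi hs fun _ _ => isOpen_discrete _, fun _ _ => rfl,
    fun f' hf' => hF _ _ fun α hα => hf' α hα⟩

variable [AddCommGroup W]

theorem hasSum_of_finite {ι : Type*} {f : ι → SuperSeries K v W} {a : SuperSeries K v W}
    (h : ∀ α, ∃ s : Finset ι, (∀ n ∉ s, f n α = 0) ∧ ∑ n ∈ s, f n α = a α) : HasSum f a := by
  let _ : TopologicalSpace W := ⊥
  refine Pi.hasSum.2 fun α => ?_
  obtain ⟨s, hs, h⟩ := h α
  rw [← h]
  exact hasSum_sum_of_ne_finset_zero hs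

/-- The sum of a summable family is computed coefficientwise by finite sums. -/
theorem _root_.HasSum.exists_finset {ι : Type*} {f : ι → SuperSeries K v W}
    {a : SuperSeries K v W} (h : HasSum f a) (α : SuperMonomial v) :
    ∃ s : Finset ι, ∀ t, s ⊆ t → ∑ n ∈ t, f n α = a α := by
  let _ : TopologicalSpace W := ⊥
  have _ : DiscreteTopology W := ⟨rfl⟩
  have h1 : HasSum (fun n => f n α) (a α) := Pi.hasSum.1 h α
  rw [HasSum, SummationFilter.unconditional_filter, nhds_discrete, Filter.tendsto_pure] at h1
  exact Filter.eventually_atTop.1 h1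

theorem coeff_neg (f : SuperSeries K v W) (α : σ →₀ ℕ) : (-f).coeff α = -f.coeff α := by
  rw [eq_neg_iff_add_eq_zero, ← coeff_add, neg_add_cancel, coeff_zero]

theorem coeff_sub (f f' : SuperSeries K v W) (α : σ →₀ ℕ) :
    (f - f').coeff α = f.coeff α - f'.coeff α := by
  rw [sub_eq_add_neg, coeff_add, coeff_neg, sub_eq_add_neg]

theorem coeff_sum {ι : Type*} (s : Finset ι) (f : ι → SuperSeries K v W) (α : σ →₀ ℕ) :
    (∑ n ∈ s, f n).coeff α = ∑ n ∈ s, (f n).coeff α := by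
  classical
  induction s using Finset.induction_on with
  | empty => simp [coeff_zero]
  | insert a s ha ih => rw [Finset.sum_insert ha, Finset.sum_insert ha, coeff_add, ih]

theorem coeff_monomial {α : σ →₀ ℕ} (hα : ∀ s ∈ v.sqZero, α s ≤ 1) (w : W) (β : σ →₀ ℕ)
    [Decidable (β = α)] :
    (monomial α w : SuperSeries K v W).coeff β = if β = α then w else 0 := by
  classical
  unfold coeff monomial
  by_cases h : β = α
  · subst h; rw [dif_pos hα, if_pos rfl, if_pos rfl]
  · rw [if_neg h]; split_ifs <;> rfl

variable [Field K] [Module K W]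

theorem coeff_smul (c : K) (f : SuperSeries K v W) (α : σ →₀ ℕ) :
    (c • f).coeff α = c • f.coeff α := by
  unfold coeff
  split_ifs
  · rfl
  · simp

theorem coeff_mapCoeff {W' : Type*} [AddCommGroup W'] [Module K W'] (φ : W →ₗ[K] W')
    (f : SuperSeries K v W) (α : σ →₀ ℕ) : (mapCoeff φ f).coeff α = φ (f.coeff α) := by
  unfold coeff
  split_ifs
  · rfl
  · simp

theorem continuous_mapCoeff {W' : Type*} [AddCommGroup W'] [Module K W'] (φ : W →ₗ[K] W') :
    Continuous (mapCoeff φ : SuperSeries K v W → SuperSeries K v W') :=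
  continuous_of_finite _ fun γ => ⟨{γ}, Set.finite_singleton γ, fun _ _ h =>
    congrArg φ (h γ rfl)⟩

theorem mapCoeff_injective {W' : Type*} [AddCommGroup W'] [Module K W'] {φ : W →ₗ[K] W'}
    (h : Function.Injective φ) :
    Function.Injective (mapCoeff φ : SuperSeries K v W → SuperSeries K v W') :=
  fun _ _ hf => ext_apply fun α => h (congrFun hf α)

end Topology

/-! ### Series of increasing order -/

section Order

variable {K : Type*} {σ : Type*} {v : SuperVars σ} {W : Type*} [AddCommGroup W]

/-- All terms of `f` have degree at least `n`. -/
def IsOrderGE (f : SuperSeries K v W) (n : ℕ) : Prop :=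
  ∀ γ : σ →₀ ℕ, γ.degree < n → f.coeff γ = 0

theorem IsOrderGE.add {f f' : SuperSeries K v W} {n : ℕ} (h : f.IsOrderGE n)
    (h' : f'.IsOrderGE n) : (f + f').IsOrderGE n := fun γ hγ => by
  rw [coeff_add, h γ hγ, h' γ hγ, add_zero]

theorem IsOrderGE.sum {ι : Type*} {s : Finset ι} {f : ι → SuperSeries K v W} {n : ℕ}
    (h : ∀ i ∈ s, (f i).IsOrderGE n) : (∑ i ∈ s, f i).IsOrderGE n := fun γ hγ => by
  rw [coeff_sum]; exact Finset.sum_eq_zero fun i hi => h i hi γ hγ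

theorem isOrderGE_zero (f : SuperSeries K v W) : f.IsOrderGE 0 := fun _ h => absurd h (by omega)

theorem IsOrderGE.smul [Field K] [Module K W] {f : SuperSeries K v W} {n : ℕ} (c : K)
    (h : f.IsOrderGE n) : (c • f).IsOrderGE n := fun γ hγ => by
  rw [coeff_smul, h γ hγ, smul_zero]

/-- The sum of a sequence of series of increasing order. -/
noncomputable def orderSum (u : ℕ → SuperSeries K v W) : SuperSeries K v W :=
  fun γ => ∑ n ∈ Finset.range (γ.1.degree + 1), u n γ

theorem coeff_orderSum (u : ℕ → SuperSeries K v W) (γ : σ →₀ ℕ) :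
    (orderSum u).coeff γ = ∑ n ∈ Finset.range (γ.degree + 1), (u n).coeff γ := by
  by_cases h : ∀ s ∈ v.sqZero, γ s ≤ 1
  · refine (coeff_val (orderSum u) ⟨γ, h⟩).trans (Finset.sum_congr rfl fun n _ => ?_)
    exact (coeff_val (u n) ⟨γ, h⟩).symm
  · simp only [coeff_of_not _ h, Finset.sum_const_zero]

theorem coeff_orderSum_of_lt {u : ℕ → SuperSeries K v W} (hu : ∀ n, (u n).IsOrderGE n)
    (γ : σ →₀ ℕ) {N : ℕ} (hN : γ.degree < N) :
    (orderSum u).coeff γ = ∑ n ∈ Finset.range N, (u n).coeff γ := by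
  rw [coeff_orderSum]
  refine Finset.sum_subset (Finset.range_subset_range.2 hN) fun n _ hn => ?_
  exact hu n γ (by simpa using hn)

theorem hasSum_orderSum {u : ℕ → SuperSeries K v W} (hu : ∀ n, (u n).IsOrderGE n) :
    HasSum u (orderSum u) :=
  hasSum_of_finite fun α => ⟨Finset.range (α.1.degree + 1), fun n hn =>
    (coeff_val (u n) α).symm.trans (hu n _ (by simpa using hn)), rfl⟩

/-- A sequence of order at least `n`, up to the `N`-th partial sum. -/
theorem orderSum_sub_isOrderGE {u : ℕ → SuperSeries K v W} (hu : ∀ n, (u n).IsOrderGE n) (N : ℕ) :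
    (orderSum u - ∑ n ∈ Finset.range N, u n).IsOrderGE N := fun γ hγ => by
  rw [coeff_sub, coeff_sum, coeff_orderSum_of_lt hu γ hγ, sub_self]

variable [Field K] [Module K W]

/-- The operator `T` increases the order of series. -/
def RaisesOrder (T : SuperSeries K v W →ₗ[K] SuperSeries K v W) : Prop :=
  ∀ f n, f.IsOrderGE n → (T f).IsOrderGE (n + 1)

theorem RaisesOrder.pow {T : SuperSeries K v W →ₗ[K] SuperSeries K v W} (hT : RaisesOrder T)
    {f : SuperSeries K v W} {n : ℕ} (hf : f.IsOrderGE n) (m : ℕ) :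
    ((T ^ m) f).IsOrderGE (n + m) := by
  induction m with
  | zero => exact hf
  | succ m ih => rw [pow_succ']; exact hT _ _ ih

/-- The operator `∑ₙ c n Tⁿ`, for an operator `T` that increases the order. -/
noncomputable def powerSum (c : ℕ → K) (T : SuperSeries K v W →ₗ[K] SuperSeries K v W) :
    SuperSeries K v W →ₗ[K] SuperSeries K v W where
  toFun f := orderSum fun n => c n • (T ^ n) f
  map_add' f f' := ext_coeff fun γ => by
    simp only [coeff_orderSum, coeff_add, map_add, smul_add, Finset.sum_add_distrib]
  map_smul' k f := ext_coeff fun γ => by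
    simp only [coeff_orderSum, coeff_smul, map_smul, Finset.smul_sum, RingHom.id_apply]
    exact Finset.sum_congr rfl fun n _ => smul_comm _ _ _

theorem powerSum_apply (c : ℕ → K) (T : SuperSeries K v W →ₗ[K] SuperSeries K v W)
    (f : SuperSeries K v W) : powerSum c T f = orderSum fun n => c n • (T ^ n) f := rfl

theorem RaisesOrder.isOrderGE {T : SuperSeries K v W →ₗ[K] SuperSeries K v W} (hT : RaisesOrder T)
    (c : ℕ → K) (f : SuperSeries K v W) (n : ℕ) : (c n • (T ^ n) f).IsOrderGE n := by
  have := hT.pow (isOrderGE_zero f) n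
  rw [zero_add] at this
  exact this.smul _

/-- The square and the triangle below its antidiagonal differ by vanishing terms only. This regroups
double series by total order. -/
theorem sum_range_sum_range_eq_sum_antidiagonal {M : Type*} [AddCommMonoid M] (F : ℕ → ℕ → M)
    (N : ℕ) (hF : ∀ i j, N ≤ i + j → F i j = 0) :
    ∑ i ∈ Finset.range N, ∑ j ∈ Finset.range N, F i j =
      ∑ n ∈ Finset.range N, ∑ p ∈ Finset.HasAntidiagonal.antidiagonal n, F p.1 p.2 := by
  rw [← Finset.sum_product', Finset.sum_sigma',
    ← Finset.sum_filter_of_ne (p := fun x : ℕ × ℕ => x.1 + x.2 < N)]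
  · refine Finset.sum_nbij' (fun p => ⟨p.1 + p.2, p⟩) (fun q => q.2) ?_ ?_ ?_ ?_ ?_
    · intro p hp; simp at hp ⊢; omega
    · rintro ⟨n, p⟩ hp; simp at hp ⊢; omega
    · intro p _; rfl
    · rintro ⟨n, p⟩ hp; simp at hp; obtain ⟨_, rfl⟩ := hp; rfl
    · intro p _; rfl
  · intro p _ hp
    by_contra h
    exact hp (hF _ _ (by omega))

/-- The composition of a power of an operator with a sum, up to a given order. -/
theorem coeff_powerSum_orderSum {T : SuperSeries K v W →ₗ[K] SuperSeries K v W}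
    (hT : RaisesOrder T) (c : ℕ → K) {u : ℕ → SuperSeries K v W} (hu : ∀ n, (u n).IsOrderGE n)
    (γ : σ →₀ ℕ) : (powerSum c T (orderSum u)).coeff γ =
      ∑ i ∈ Finset.range (γ.degree + 1), ∑ j ∈ Finset.range (γ.degree + 1),
        c i • ((T ^ i) (u j)).coeff γ := by
  rw [powerSum_apply, coeff_orderSum]
  refine Finset.sum_congr rfl fun i _ => ?_
  rw [coeff_smul, ← Finset.smul_sum, ← coeff_sum, ← map_sum]
  congr 1
  -- The tail of the sum has order greater than the degree of γ, and powers of T do not lower the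
  -- order.
  rw [← sub_eq_zero, ← coeff_sub, ← map_sub]
  exact hT.pow (orderSum_sub_isOrderGE hu (γ.degree + 1)) i γ (by omega)

theorem powerSum_orderSum {T : SuperSeries K v W →ₗ[K] SuperSeries K v W}
    (hT : RaisesOrder T) (c : ℕ → K) {u : ℕ → SuperSeries K v W} (hu : ∀ n, (u n).IsOrderGE n) :
    powerSum c T (orderSum u) =
      orderSum fun n => ∑ p ∈ Finset.HasAntidiagonal.antidiagonal n, c p.1 • (T ^ p.1) (u p.2) := by
  refine ext_coeff fun γ => ?_
  rw [coeff_powerSum_orderSum hT c hu, sum_range_sum_range_eq_sum_antidiagonal, coeff_orderSum]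
  · simp only [coeff_sum, coeff_smul]
  · intro i j hij
    rw [hT.pow (hu j) i γ (by omega), smul_zero]

theorem powerSum_powerSum {T T' : SuperSeries K v W →ₗ[K] SuperSeries K v W}
    (hT : RaisesOrder T) (hT' : RaisesOrder T') (c c' : ℕ → K) (f : SuperSeries K v W) :
    powerSum c T (powerSum c' T' f) = orderSum fun n => ∑ p ∈ Finset.HasAntidiagonal.antidiagonal n,
      (c p.1 * c' p.2) • (T ^ p.1) ((T' ^ p.2) f) := by
  rw [powerSum_apply c', powerSum_orderSum hT c (hT'.isOrderGE c' f)]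
  congr 1; funext n
  refine Finset.sum_congr rfl fun p _ => ?_
  rw [map_smul, smul_smul]

/-- Power series in an operator multiply like power series. -/
theorem powerSum_powerSum_self {T : SuperSeries K v W →ₗ[K] SuperSeries K v W}
    (hT : RaisesOrder T) {c c' d : ℕ → K}
    (h : ∀ n, ∑ p ∈ Finset.HasAntidiagonal.antidiagonal n, c p.1 * c' p.2 = d n) (f : SuperSeries K v W) :
    powerSum c T (powerSum c' T f) = powerSum d T f := by
  rw [powerSum_powerSum hT hT, powerSum_apply]
  congr 1; funext n
  rw [← h, Finset.sum_smul]
  refine Finset.sum_congr rfl fun p hp => ?_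
  rw [← Finset.HasAntidiagonal.mem_antidiagonal.1 hp, pow_add]; rfl

theorem powerSum_one (T : SuperSeries K v W →ₗ[K] SuperSeries K v W) (f : SuperSeries K v W) :
    powerSum (fun n => if n = 0 then 1 else 0) T f = f := by
  refine ext_coeff fun γ => ?_
  rw [powerSum_apply, coeff_orderSum, Finset.sum_eq_single 0]
  · simp
  · intro n _ hn; simp [hn, coeff_zero]
  · simp

end Order

end SuperSeries

namespace SuperSeries

/-! ### Continuity of the product; exponentials -/

theorem coeff_congr {K σ W : Type*} [Zero W] {v : SuperVars σ} {f f' : SuperSeries K v W} {s : Set (σ →₀ ℕ)}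
    (h : ∀ α ∈ {α : SuperMonomial v | α.1 ∈ s}, f α = f' α) {α : σ →₀ ℕ} (hα : α ∈ s) :
    f.coeff α = f'.coeff α := by
  by_cases hv : ∀ s ∈ v.sqZero, α s ≤ 1
  · exact (coeff_val f ⟨α, hv⟩).trans ((h ⟨α, hv⟩ hα).trans (coeff_val f' ⟨α, hv⟩).symm)
  · rw [coeff_of_not _ hv, coeff_of_not _ hv]

section Ring

variable {K : Type*} {σ : Type*} {v : SuperVars σ} [Field K] {B : Type*} [Ring B]
  [Algebra K B] [Superalgebra K B] [LinearOrder σ]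

instance : IsScalarTower K (SuperSeries K v B) (SuperSeries K v B) :=
  ⟨fun c f f' => ext_coeff fun γ => by
    classical
    simp only [smul_eq_mul, coeff_smul, coeff_mul, map_smul, smul_mul_assoc, smul_ite, smul_zero,
      Finset.smul_sum, smul_comm c]⟩

instance : SMulCommClass K (SuperSeries K v B) (SuperSeries K v B) :=
  ⟨fun c f f' => ext_coeff fun γ => by
    classical
    simp only [smul_eq_mul, coeff_smul, coeff_mul, mul_smul_comm, smul_ite, smul_zero,
      Finset.smul_sum, smul_comm c]⟩

theorem continuous_mul_left (f : SuperSeries K v B) : Continuous fun f' => f * f' := by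
  classical
  refine continuous_of_finite _ fun γ => ⟨{α | α.1 ∈ ((Finset.HasAntidiagonal.antidiagonal
    γ.1).image Prod.snd : Set (σ →₀ ℕ))}, Set.Finite.preimage Subtype.val_injective.injOn
    (Finset.finite_toSet _), fun f₁ f₂ h => ?_⟩
  refine Finset.sum_congr rfl fun p hp => ?_
  rw [coeff_congr h (by simpa using ⟨p.1, Finset.HasAntidiagonal.mem_antidiagonal.1 hp⟩)]

theorem continuous_mul_right (f : SuperSeries K v B) : Continuous fun f' => f' * f := by
  classical
  refine continuous_of_finite _ fun γ => ⟨{α | α.1 ∈ ((Finset.HasAntidiagonal.antidiagonal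
    γ.1).image Prod.fst : Set (σ →₀ ℕ))}, Set.Finite.preimage Subtype.val_injective.injOn
    (Finset.finite_toSet _), fun f₁ f₂ h => ?_⟩
  refine Finset.sum_congr rfl fun p hp => ?_
  rw [coeff_congr h (by simpa using ⟨p.2, Finset.HasAntidiagonal.mem_antidiagonal.1 hp⟩)]

theorem _root_.HasSum.series_mul_left {ι : Type*} {u : ι → SuperSeries K v B} {a} (h : HasSum u a)
    (f : SuperSeries K v B) : HasSum (fun n => f * u n) (f * a) :=
  h.map (AddMonoidHom.mulLeft f) (continuous_mul_left f)

theorem _root_.HasSum.series_mul_right {ι : Type*} {u : ι → SuperSeries K v B} {a}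
    (h : HasSum u a) (f : SuperSeries K v B) : HasSum (fun n => u n * f) (a * f) :=
  h.map (AddMonoidHom.mulRight f) (continuous_mul_right f)

theorem hasSum_exp {x : SuperSeries K v B} (hx : x.coeff 0 = 0) :
    HasSum (fun n : ℕ => ((n.factorial : K)⁻¹) • x ^ n) (exp x) := (summable_exp hx).hasSum

end Ring

/-! ### Operators that multiply by the variables -/

section Shift

variable {K I : Type*} [Field K] [LinearOrder I] {par : I → ZMod 2}
  {W W' : Type*} [AddCommGroup W] [Module K W] [AddCommGroup W'] [Module K W']

/-- The operator `∑ᵢ (· X_i) ⊗ D i`. -/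
noncomputable def weightedShift (par : I → ZMod 2) (D : I → W →ₗ[K] W') :
    SuperSeries K (xVars par) W →ₗ[K] SuperSeries K (xVars par) W' where
  -- The sign brings X^{γ - e_i} X_i to normal order. Multiplying by the variable on the right
  -- agrees with the order of the factors in the weight of a path.
  toFun f := fun γ => ∑ i ∈ γ.1.support,
    scalarSign K ((xVars par).crossing (γ.1 - Finsupp.single i 1) (Finsupp.single i 1)) •
      D i (f.coeff (γ.1 - Finsupp.single i 1))
  map_add' f f' := ext_apply fun γ => by
    refine Eq.trans ?_ (Finset.sum_add_distrib)
    refine Finset.sum_congr rfl fun i _ => ?_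
    rw [coeff_add, map_add, smul_add]
  map_smul' c f := ext_apply fun γ => by
    change ∑ i ∈ γ.1.support, (_ : W') = c • ∑ i ∈ γ.1.support, (_ : W')
    rw [Finset.smul_sum]
    refine Finset.sum_congr rfl fun i _ => ?_
    rw [coeff_smul, map_smul, smul_comm]

theorem coeff_weightedShift (D : I → W →ₗ[K] W') (f : SuperSeries K (xVars par) W)
    {γ : I →₀ ℕ} (hγ : ∀ s ∈ (xVars par).sqZero, γ s ≤ 1) :
    (weightedShift par D f).coeff γ = ∑ i ∈ γ.support,
      scalarSign K ((xVars par).crossing (γ - Finsupp.single i 1) (Finsupp.single i 1)) •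
        D i (f.coeff (γ - Finsupp.single i 1)) :=
  coeff_val (weightedShift par D f) ⟨γ, hγ⟩

omit [LinearOrder I] in
theorem sub_single_add_single {γ : I →₀ ℕ} {i : I} (hi : i ∈ γ.support) :
    γ - Finsupp.single i 1 + Finsupp.single i 1 = γ :=
  tsub_add_cancel_of_le (Finsupp.single_le_iff.2
    (Nat.one_le_iff_ne_zero.2 (Finsupp.mem_support_iff.1 hi)))

omit [LinearOrder I] in
theorem degree_sub_single {γ : I →₀ ℕ} {i : I} (hi : i ∈ γ.support) :
    (γ - Finsupp.single i 1).degree + 1 = γ.degree := by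
  conv_rhs => rw [← sub_single_add_single hi, map_add, Finsupp.degree_single]

theorem weightedShift_raisesOrder (D : I → W →ₗ[K] W) : RaisesOrder (weightedShift par D) := by
  intro f n hf γ hγ
  by_cases h : ∀ s ∈ (xVars par).sqZero, γ s ≤ 1
  · rw [coeff_weightedShift D f h]
    refine Finset.sum_eq_zero fun i hi => ?_
    have := degree_sub_single hi
    rw [hf _ (by omega), map_zero, smul_zero]
  · exact coeff_of_not _ h

theorem weightedShift_add (D D' : I → W →ₗ[K] W') :
    weightedShift par (fun i => D i + D' i) = weightedShift par D + weightedShift par D' := by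
  refine LinearMap.ext fun f => ext_apply fun γ => ?_
  refine Eq.trans ?_ (Finset.sum_add_distrib)
  refine Finset.sum_congr rfl fun i _ => ?_
  rw [LinearMap.add_apply, smul_add]

theorem continuous_weightedShift (D : I → W →ₗ[K] W') : Continuous (weightedShift par D) := by
  classical
  refine continuous_of_finite _ fun γ => ?_
  let s : Finset (I →₀ ℕ) := γ.1.support.image fun i => γ.1 - Finsupp.single i 1
  refine ⟨{α | α.1 ∈ (s : Set (I →₀ ℕ))}, Set.Finite.preimage Subtype.val_injective.injOn
    (Finset.finite_toSet _), fun f₁ f₂ h => ?_⟩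
  refine Finset.sum_congr rfl fun i hi => ?_
  have : f₁.coeff (γ.1 - Finsupp.single i 1) = f₂.coeff (γ.1 - Finsupp.single i 1) :=
    coeff_congr h (Finset.mem_coe.2 (Finset.mem_image_of_mem _ hi))
  rw [this]

theorem mapCoeff_weightedShift {V V' : Type*} [AddCommGroup V] [Module K V] [AddCommGroup V']
    [Module K V'] (φ : W →ₗ[K] V) (φ' : W' →ₗ[K] V') (D : I → W →ₗ[K] W') (D' : I → V →ₗ[K] V')
    (h : ∀ i w, φ' (D i w) = D' i (φ w)) (f : SuperSeries K (xVars par) W) :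
    mapCoeff φ' (weightedShift par D f) = weightedShift par D' (mapCoeff φ f) := by
  refine ext_coeff fun γ => ?_
  by_cases hγ : ∀ s ∈ (xVars par).sqZero, γ s ≤ 1
  · rw [coeff_mapCoeff, coeff_weightedShift D f hγ, coeff_weightedShift D' _ hγ, map_sum]
    refine Finset.sum_congr rfl fun i _ => ?_
    rw [map_smul, h, coeff_mapCoeff]
  · rw [coeff_of_not _ hγ, coeff_of_not _ hγ]

theorem sum_antidiagonal_of_single {M : Type*} [AddCommMonoid M] (γ : I →₀ ℕ)
    (F : (I →₀ ℕ) × (I →₀ ℕ) → M) (hF : ∀ p, (∀ i, p.2 ≠ Finsupp.single i 1) → F p = 0) :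
    ∑ p ∈ Finset.HasAntidiagonal.antidiagonal γ, F p =
      ∑ i ∈ γ.support, F (γ - Finsupp.single i 1, Finsupp.single i 1) := by
  classical
  have hinj : Function.Injective fun i : I =>
      ((γ - Finsupp.single i 1, Finsupp.single i 1) : (I →₀ ℕ) × (I →₀ ℕ)) := fun i j h =>
    Finsupp.single_left_injective one_ne_zero (Prod.ext_iff.1 h).2
  rw [← Finset.sum_image (f := F) (g := fun i : I =>
    ((γ - Finsupp.single i 1, Finsupp.single i 1) : (I →₀ ℕ) × (I →₀ ℕ))) fun i _ j _ h => hinj h]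
  symm
  refine Finset.sum_subset (fun p hp => ?_) fun p hp hp' => hF p fun i hi => hp' ?_
  · obtain ⟨i, hi, rfl⟩ := Finset.mem_image.1 hp
    exact Finset.HasAntidiagonal.mem_antidiagonal.2 (sub_single_add_single hi)
  · rw [Finset.HasAntidiagonal.mem_antidiagonal] at hp
    refine Finset.mem_image.2 ⟨i, ?_, Prod.ext ?_ hi.symm⟩
    · rw [Finsupp.mem_support_iff, ← hp, hi]; simp
    · rw [← hp, hi]; simp

theorem sum_antidiagonal_of_single' {M : Type*} [AddCommMonoid M] (γ : I →₀ ℕ)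
    (F : (I →₀ ℕ) × (I →₀ ℕ) → M) (hF : ∀ p, (∀ i, p.1 ≠ Finsupp.single i 1) → F p = 0) :
    ∑ p ∈ Finset.HasAntidiagonal.antidiagonal γ, F p =
      ∑ i ∈ γ.support, F (Finsupp.single i 1, γ - Finsupp.single i 1) := by
  classical
  refine Eq.trans ?_ (sum_antidiagonal_of_single γ (fun p => F p.swap) fun p hp => hF _ hp)
  exact Finset.sum_nbij' Prod.swap Prod.swap (by simp [add_comm]) (by simp [add_comm]) (by simp)
    (by simp) (by simp)

/-- Carrying X_i from the left of X^β to its right costs (-1)^{|X_i||β|}. The hypothesis excludes an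
odd X_i that occurs in β: the product is then zero and the count of crossings is off by one. -/
theorem crossing_single_left (i : I) (β : I →₀ ℕ) (h : par i = 1 → β i = 0) :
    (xVars par).crossing (Finsupp.single i 1) β + (xVars par).degParity β * par i =
      (xVars par).crossing β (Finsupp.single i 1) := by
  have e2 : ∀ x : ZMod 2, x + x = 0 := by decide
  have h1 : (xVars par).crossing (Finsupp.single i 1) β = β.sum fun t n =>
      if t < i then par i * (n * par t) else 0 := by
    rw [SuperVars.crossing, Finsupp.sum_single_index]
    · simp [xVars]
    · simp
  have h2 : (xVars par).crossing β (Finsupp.single i 1) = β.sum fun t n =>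
      if i < t then par i * (n * par t) else 0 := by
    rw [SuperVars.crossing]
    refine Finsupp.sum_congr fun t _ => ?_
    rw [Finsupp.sum_single_index]
    · simp [xVars, mul_comm]
    · simp
  rw [h1, h2, SuperVars.degParity, Finsupp.sum, Finsupp.sum, Finsupp.sum, Finset.sum_mul,
    ← Finset.sum_add_distrib]
  refine Finset.sum_congr rfl fun t ht => ?_
  change _ + (β t : ZMod 2) * par t * par i = _
  rcases lt_trichotomy t i with hlt | rfl | hlt
  · rw [if_pos hlt, if_neg (not_lt_of_gt hlt), mul_comm (par i), e2]
  · rw [if_neg (lt_irrefl _), zero_add]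
    have h01 : ∀ x : ZMod 2, x = 0 ∨ x = 1 := by decide
    rcases h01 (par t) with h0 | h0
    · simp [h0]
    · simp [h h0]
  · rw [if_neg (not_lt_of_gt hlt), if_pos hlt, zero_add, mul_comm (par i)]

variable {B : Type*} [Ring B] [Algebra K B] [Superalgebra K B]

theorem twist_of_isHomogeneous {V : Type*} [AddCommGroup V] [Module K V] [Superspace K V]
    {i : ZMod 2} (j : ZMod 2) {x : V} (hx : IsHomogeneous K i x) :
    twist K j x = scalarSign K (j * i) • x := by
  have h : ∀ x : ZMod 2, x = 0 ∨ x = 1 := by decide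
  rcases h j with rfl | rfl
  · simp [twist]
  · simpa [twist] using isHomogeneous_iff.1 hx

/-- The series `a` is `∑ᵢ X_i ⊗ p i`. -/
structure IsLinearSeries (a : SuperSeries K (xVars par) W) (p : I → W) : Prop where
  coeff_single : ∀ i, a.coeff (Finsupp.single i 1) = p i
  coeff_eq_zero : ∀ γ, (∀ i, γ ≠ Finsupp.single i 1) → a.coeff γ = 0

/-- The twist is the sign for carrying X_i past the coefficient of `f`. -/
theorem IsLinearSeries.mul_right {a : SuperSeries K (xVars par) B} {p : I → B}
    (ha : IsLinearSeries a p) (f : SuperSeries K (xVars par) B) :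
    f * a = weightedShift par (fun i => LinearMap.mulRight K (p i) ∘ₗ twist K (par i)) f := by
  classical
  refine ext_coeff fun γ => ?_
  rw [coeff_mul]
  split_ifs with hγ
  · rw [coeff_weightedShift _ f hγ, sum_antidiagonal_of_single]
    · refine Finset.sum_congr rfl fun i _ => ?_
      rw [units_smul_eq_scalarSign (K := K), ha.coeff_single]
      have : (xVars par).degParity (Finsupp.single i 1) = par i := by
        simp [SuperVars.degParity, xVars]
      rw [this]; rfl
    · intro q hq
      rw [ha.coeff_eq_zero _ hq]; simp
  · exact (coeff_of_not _ hγ).symm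

/-- No sign remains: p_i and X_i have the same parity, so the sign for carrying p_i past X^β cancels
the one for carrying X_i to the right of X^β. -/
theorem IsLinearSeries.mul_left {a : SuperSeries K (xVars par) B} {p : I → B}
    (ha : IsLinearSeries a p) (hp : ∀ i, IsHomogeneous K (par i) (p i))
    (f : SuperSeries K (xVars par) B) :
    a * f = weightedShift par (fun i => LinearMap.mulLeft K (p i)) f := by
  classical
  refine ext_coeff fun γ => ?_
  rw [coeff_mul]
  split_ifs with hγ
  · rw [coeff_weightedShift _ f hγ, sum_antidiagonal_of_single']
    · refine Finset.sum_congr rfl fun i hi => ?_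
      rw [units_smul_eq_scalarSign (K := K), ha.coeff_single, twist_of_isHomogeneous _ (hp i),
        ← crossing_single_left, scalarSign_add, smul_mul_assoc, smul_smul]
      · rfl
      · intro h1
        have := hγ i h1
        simp; omega
    · intro q hq
      rw [ha.coeff_eq_zero _ hq]; simp
  · exact (coeff_of_not _ hγ).symm

theorem isLinearSeries_canonicalElement {g : Type*} [AddCommGroup g] [Module K g]
    [LieSuperalgebra K g] {gm : Submodule K g} (P : Module.Basis I K gm) :
    IsLinearSeries (canonicalElement P par) fun i => (P i : g) := by
  classical
  have hs := (summable_canonicalElement P par).hasSum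
  have key : ∀ (i : I) (α : SuperMonomial (xVars par)), α.1 ≠ Finsupp.single i 1 →
      (tensor (X i) (P i : g) : SuperSeries K (xVars par) g) α = 0 := fun i α h => by
    have hX : (X i : SuperSeries K (xVars par) K) α = 0 := if_neg h
    exact (congrArg (· • (P i : g)) hX).trans (zero_smul K _)
  have adm : ∀ i : I, ∀ s ∈ (xVars par).sqZero, (Finsupp.single i 1 : I →₀ ℕ) s ≤ 1 := by
    intro i s _
    rw [Finsupp.single_apply]; split_ifs <;> simp
  constructor
  · intro i
    obtain ⟨s, hs⟩ := hs.exists_finset ⟨Finsupp.single i 1, adm i⟩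
    refine (coeff_val (canonicalElement P par : SuperSeries K (xVars par) g) ⟨_, adm i⟩).trans ?_
    refine (hs (insert i s) (Finset.subset_insert _ _)).symm.trans ?_
    rw [Finset.sum_eq_single i]
    · have hX : (X i : SuperSeries K (xVars par) K) ⟨Finsupp.single i 1, adm i⟩ = 1 := if_pos rfl
      exact (congrArg (· • (P i : g)) hX).trans (one_smul K _)
    · intro j _ hj
      exact key j _ fun h => hj (Finsupp.single_left_injective one_ne_zero h).symm
    · exact fun h => absurd (Finset.mem_insert_self i s) h
  · intro γ hγ
    by_cases h : ∀ s ∈ (xVars par).sqZero, γ s ≤ 1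
    · obtain ⟨s, hs⟩ := hs.exists_finset ⟨γ, h⟩
      refine (coeff_val (canonicalElement P par : SuperSeries K (xVars par) g) ⟨γ, h⟩).trans ?_
      refine (hs s subset_rfl).symm.trans (Finset.sum_eq_zero fun i _ => ?_)
      exact key i _ (hγ i)
    · exact coeff_of_not _ h

end Shift

end SuperSeries

namespace SuperSeries

/-! ### Series in the variables `X` as series in the variables `ε`, `X` -/

section Extend

variable {K I : Type*} [Field K] {par : I → ZMod 2}

/-- The exponent of a monomial in the variables `X`, in the variables `ε`, `X`. -/
noncomputable def embedExponent (β : I →₀ ℕ) : (Fin 2 ⊕ₗ I) →₀ ℕ :=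
  β.mapDomain fun i => toLex (Sum.inr i)

theorem toLex_inr_injective : Function.Injective fun i : I => (toLex (Sum.inr i) : Fin 2 ⊕ₗ I) :=
  fun _ _ h => Sum.inr_injective (toLex.injective h)

@[simp] theorem embedExponent_inl (β : I →₀ ℕ) (e : Fin 2) :
    embedExponent β (toLex (Sum.inl e)) = 0 :=
  Finsupp.mapDomain_of_notMem_range _ _ fun ⟨_, h⟩ => Sum.inr_ne_inl (toLex.injective h)

@[simp] theorem embedExponent_inr (β : I →₀ ℕ) (i : I) :
    embedExponent β (toLex (Sum.inr i)) = β i :=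
  Finsupp.mapDomain_apply toLex_inr_injective _ _

theorem embedExponent_add (α β : I →₀ ℕ) :
    embedExponent (α + β) = embedExponent α + embedExponent β := Finsupp.mapDomain_add

theorem embedExponent_injective : Function.Injective (embedExponent (I := I)) :=
  Finsupp.mapDomain_injective toLex_inr_injective

theorem exists_eq_embedExponent {γ : (Fin 2 ⊕ₗ I) →₀ ℕ}
    (h : ∀ e : Fin 2, γ (toLex (Sum.inl e)) = 0) : ∃ β, γ = embedExponent β := by
  refine ⟨γ.comapDomain (fun i => toLex (Sum.inr i)) toLex_inr_injective.injOn, ?_⟩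
  ext s
  obtain ⟨s, rfl⟩ := toLex.surjective s
  rcases s with e | i
  · rw [h, embedExponent_inl]
  · rw [embedExponent_inr]; rfl

theorem embedExponent_admissible (β : I →₀ ℕ) :
    (∀ s ∈ (epsVars par).sqZero, embedExponent β s ≤ 1) ↔ ∀ s ∈ (xVars par).sqZero, β s ≤ 1 := by
  constructor
  · intro h i hi
    have := h (toLex (Sum.inr i)) hi
    rwa [embedExponent_inr] at this
  · intro h s hs
    obtain ⟨s, rfl⟩ := toLex.surjective s
    rcases s with e | i
    · simp
    · rw [embedExponent_inr]; exact h i hs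

theorem degParity_embedExponent (β : I →₀ ℕ) :
    (epsVars par).degParity (embedExponent β) = (xVars par).degParity β :=
  Finsupp.sum_mapDomain_index_inj toLex_inr_injective

theorem crossing_embedExponent [LinearOrder I] (α β : I →₀ ℕ) :
    (epsVars par).crossing (embedExponent α) (embedExponent β) = (xVars par).crossing α β := by
  refine (Finsupp.sum_mapDomain_index_inj toLex_inr_injective).trans ?_
  refine Finsupp.sum_congr fun s _ => ?_
  refine (Finsupp.sum_mapDomain_index_inj toLex_inr_injective).trans ?_
  refine Finsupp.sum_congr fun t _ => ?_
  simp only [Sum.Lex.inr_lt_inr_iff]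
  rfl

variable {W : Type*} [AddCommGroup W] [Module K W]

omit [Field K] [Module K W] in
theorem coeff_extend (f : SuperSeries K (xVars par) W) (β : I →₀ ℕ) :
    (extend f).coeff (embedExponent β) = f.coeff β := by
  by_cases h : ∀ s ∈ (xVars par).sqZero, β s ≤ 1
  · have h' := (embedExponent_admissible β).2 h
    refine (coeff_val (extend f) ⟨embedExponent β, h'⟩).trans
      ((if_pos fun e => embedExponent_inl β e).trans (Eq.trans ?_ (coeff_val f ⟨β, h⟩).symm))
    congr 1
    refine Subtype.ext (Finsupp.ext fun i => ?_)
    exact embedExponent_inr β i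
  · rw [coeff_of_not _ h, coeff_of_not _ fun h' => h ((embedExponent_admissible β).1 h')]

omit [Field K] [Module K W] in
theorem coeff_extend_eq_zero (f : SuperSeries K (xVars par) W) {γ : (Fin 2 ⊕ₗ I) →₀ ℕ}
    (hγ : ¬ ∀ e : Fin 2, γ (toLex (Sum.inl e)) = 0) : (extend f).coeff γ = 0 := by
  by_cases h : ∀ s ∈ (epsVars par).sqZero, γ s ≤ 1
  · exact (coeff_val (extend f) ⟨γ, h⟩).trans (if_neg hγ)
  · exact coeff_of_not _ h

omit [Field K] [Module K W] in
theorem extend_ext {f : SuperSeries K (xVars par) W} {F : SuperSeries K (epsVars par) W}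
    (h₁ : ∀ β, F.coeff (embedExponent β) = f.coeff β)
    (h₂ : ∀ γ : (Fin 2 ⊕ₗ I) →₀ ℕ, (¬ ∀ e : Fin 2, γ (toLex (Sum.inl e)) = 0) → F.coeff γ = 0) :
    F = extend f := by
  refine ext_coeff fun γ => ?_
  by_cases hγ : ∀ e : Fin 2, γ (toLex (Sum.inl e)) = 0
  · obtain ⟨β, rfl⟩ := exists_eq_embedExponent hγ
    rw [h₁, coeff_extend]
  · rw [h₂ γ hγ, coeff_extend_eq_zero f hγ]

variable (K par W) in
/-- The map `extend`, as a linear map. -/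
noncomputable def extendHom :
    SuperSeries K (xVars par) W →ₗ[K] SuperSeries K (epsVars par) W where
  toFun := extend
  map_add' f f' := Eq.symm <| extend_ext (fun β => by simp only [coeff_add, coeff_extend])
    fun γ hγ => by rw [coeff_add, coeff_extend_eq_zero _ hγ, coeff_extend_eq_zero _ hγ, add_zero]
  map_smul' c f := Eq.symm <| extend_ext
    (fun β => by simp only [coeff_smul, coeff_extend, RingHom.id_apply])
    fun γ hγ => by rw [coeff_smul, coeff_extend_eq_zero _ hγ, smul_zero]

omit [Field K] [Module K W] in
theorem continuous_extend :
    Continuous (extend : SuperSeries K (xVars par) W → SuperSeries K (epsVars par) W) := by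
  refine continuous_of_finite _ fun γ => ?_
  by_cases hγ : ∀ e : Fin 2, γ.1 (toLex (Sum.inl e)) = 0
  · let δ : SuperMonomial (xVars par) := ⟨γ.1.comapDomain (fun i => toLex (Sum.inr i))
      (fun _ _ _ _ h => Sum.inr_injective (toLex.injective h)),
      fun i hi => γ.2 (toLex (Sum.inr i)) hi⟩
    exact ⟨{δ}, Set.finite_singleton _, fun f f' h =>
      (if_pos hγ).trans ((h δ rfl).trans (if_pos hγ).symm)⟩
  · exact ⟨∅, Set.finite_empty, fun f f' _ => (if_neg hγ).trans (if_neg hγ).symm⟩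

theorem _root_.HasSum.series_extend {ι : Type*} {u : ι → SuperSeries K (xVars par) W} {a}
    (h : HasSum u a) : HasSum (fun n => extend (u n)) (extend a) :=
  h.map (extendHom K par W) continuous_extend

variable {B : Type*} [Ring B] [Algebra K B] [Superalgebra K B] [LinearOrder I]

theorem extend_one : extend (1 : SuperSeries K (xVars par) B) = 1 := by
  classical
  refine Eq.symm <| extend_ext (fun β => ?_) fun γ hγ => ?_
  · have : embedExponent β = 0 ↔ β = 0 :=
      (embedExponent_injective (I := I)).eq_iff' Finsupp.mapDomain_zero
    simp only [coeff_one, this]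
  · rw [coeff_one, if_neg]
    rintro rfl
    exact hγ fun _ => rfl

theorem extend_mul (f f' : SuperSeries K (xVars par) B) :
    extend (f * f') = extend f * extend f' := by
  classical
  refine Eq.symm <| extend_ext (fun γ => ?_) fun γ hγ => ?_
  · rw [coeff_mul, coeff_mul]
    refine if_congr (embedExponent_admissible γ) (Eq.symm ?_) rfl
    refine Finset.sum_nbij (fun p => (embedExponent p.1, embedExponent p.2)) ?_ ?_ ?_ ?_
    · intro p hp
      rw [Finset.HasAntidiagonal.mem_antidiagonal] at hp ⊢
      rw [← hp, embedExponent_add]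
    · intro p _ q _ h
      exact Prod.ext (embedExponent_injective (Prod.ext_iff.1 h).1)
        (embedExponent_injective (Prod.ext_iff.1 h).2)
    · rintro ⟨p, q⟩ hp
      have hp' : p + q = embedExponent γ := Finset.HasAntidiagonal.mem_antidiagonal.1 hp
      have h0 : ∀ e : Fin 2, p (toLex (Sum.inl e)) = 0 ∧ q (toLex (Sum.inl e)) = 0 := fun e => by
        have := DFunLike.congr_fun hp' (toLex (Sum.inl e))
        rw [embedExponent_inl, Finsupp.add_apply] at this
        omega
      obtain ⟨α, rfl⟩ := exists_eq_embedExponent fun e => (h0 e).1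
      obtain ⟨β, rfl⟩ := exists_eq_embedExponent fun e => (h0 e).2
      rw [← embedExponent_add] at hp'
      exact ⟨(α, β), Finset.HasAntidiagonal.mem_antidiagonal.2 (embedExponent_injective hp'), rfl⟩
    · intro p _
      rw [coeff_extend, coeff_extend, crossing_embedExponent, degParity_embedExponent]
  · rw [coeff_mul]
    split_ifs
    · refine Finset.sum_eq_zero fun p hp => ?_
      rw [Finset.HasAntidiagonal.mem_antidiagonal] at hp
      by_cases h1 : ∀ e : Fin 2, p.1 (toLex (Sum.inl e)) = 0
      · by_cases h2 : ∀ e : Fin 2, p.2 (toLex (Sum.inl e)) = 0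
        · exact absurd (fun e => by rw [← hp, Finsupp.add_apply, h1, h2]) hγ
        · rw [coeff_extend_eq_zero _ h2]; simp
      · rw [coeff_extend_eq_zero _ h1]; simp
    · rfl

theorem extend_pow (f : SuperSeries K (xVars par) B) (n : ℕ) :
    extend (f ^ n) = extend f ^ n := by
  induction n with
  | zero => rw [pow_zero, pow_zero, extend_one]
  | succ n ih => rw [pow_succ, pow_succ, extend_mul, ih]

/-! ### The parameters `ε` -/

/-- The exponent of the parameter `ε_i`. -/
noncomputable def epsExponent (I : Type*) (i : ZMod 2) : (Fin 2 ⊕ₗ I) →₀ ℕ :=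
  Finsupp.single (toLex (Sum.inl (⟨i.val, ZMod.val_lt i⟩ : Fin 2))) 1

variable {g : Type*} [AddCommGroup g] [Module K g] [LieSuperalgebra K g]

omit [LinearOrder I] in
theorem epsExponent_le_iff (i : ZMod 2) (γ : (Fin 2 ⊕ₗ I) →₀ ℕ) : epsExponent I i ≤ γ ↔
    1 ≤ γ (toLex (Sum.inl (⟨i.val, ZMod.val_lt i⟩ : Fin 2))) := Finsupp.single_le_iff

theorem coeff_eps (i : ZMod 2) (γ : (Fin 2 ⊕ₗ I) →₀ ℕ) [Decidable (γ = epsExponent I i)] :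
    (eps i : SuperSeries K (epsVars par) (SuperEnveloping K g)).coeff γ =
      if γ = epsExponent I i then 1 else 0 := by
  have adm : ∀ s ∈ (epsVars par).sqZero, epsExponent I i s ≤ 1 := fun s _ => by
    classical
    rw [epsExponent, Finsupp.single_apply]
    split_ifs <;> simp
  exact coeff_monomial (α := epsExponent I i) adm 1 γ

omit [LinearOrder I] in
theorem epsVars_parity_eps (i : ZMod 2) :
    (epsVars par).parity (toLex (Sum.inl (⟨i.val, ZMod.val_lt i⟩ : Fin 2))) = i :=
  ZMod.natCast_zmod_val i

omit [LinearOrder I] in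
theorem degParity_epsExponent (i : ZMod 2) : (epsVars par).degParity (epsExponent I i) = i := by
  rw [SuperVars.degParity, epsExponent, Finsupp.sum_single_index (by simp), epsVars_parity_eps]
  simp

/-- The parameters are the smallest variables, so nothing has to be crossed, except that ε₀ precedes
ε₁; but ε₀ is even. -/
theorem crossing_epsExponent (i : ZMod 2) (β : (Fin 2 ⊕ₗ I) →₀ ℕ) :
    (epsVars par).crossing (epsExponent I i) β = 0 := by
  rw [SuperVars.crossing, epsExponent, Finsupp.sum_single_index (by simp), Finsupp.sum]
  refine Finset.sum_eq_zero fun t _ => ?_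
  rw [epsVars_parity_eps]
  split_ifs with h
  · have h01 : ∀ x : ZMod 2, x = 0 ∨ x = 1 := by decide
    rcases h01 i with rfl | rfl
    · simp
    · obtain ⟨t, rfl⟩ := toLex.surjective t
      rcases t with e | t
      · rw [Sum.Lex.inl_lt_inl_iff] at h
        have : e = 0 := by
          have : e < 1 := h
          omega
        subst this
        have : (epsVars par).parity (toLex (Sum.inl 0)) = 0 := Nat.cast_zero
        rw [this]; simp
      · exact absurd h Sum.Lex.not_inr_lt_inl
  · rfl

theorem crossing_embedExponent_epsExponent (i : ZMod 2) (β : I →₀ ℕ) :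
    (epsVars par).crossing (embedExponent β) (epsExponent I i) =
      i * (xVars par).degParity β := by
  rw [← degParity_embedExponent, SuperVars.crossing, SuperVars.degParity, Finsupp.mul_sum]
  refine Finsupp.sum_congr fun s hs => ?_
  rw [epsExponent, Finsupp.sum_single_index (by simp), epsVars_parity_eps, if_pos]
  · push_cast; ring
  · obtain ⟨s, rfl⟩ := toLex.surjective s
    rcases s with e | s
    · exact absurd (embedExponent_inl β e) (Finsupp.mem_support_iff.1 hs)
    · exact Sum.Lex.inl_lt_inr _ _

open Classical in
theorem coeff_eps_mul (i : ZMod 2) (f : SuperSeries K (epsVars par) (SuperEnveloping K g))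
    (γ : (Fin 2 ⊕ₗ I) →₀ ℕ) :
    (eps i * f).coeff γ = if (∀ s ∈ (epsVars par).sqZero, γ s ≤ 1) ∧ epsExponent I i ≤ γ then
      f.coeff (γ - epsExponent I i) else 0 := by
  classical
  rw [coeff_mul, ite_and]
  refine if_congr Iff.rfl ?_ rfl
  split_ifs with h
  · rw [Finset.sum_eq_single (epsExponent I i, γ - epsExponent I i)]
    · rw [coeff_eps, if_pos rfl, twist_one, crossing_epsExponent]; simp
    · rintro ⟨p, q⟩ hp hne
      rw [Finset.HasAntidiagonal.mem_antidiagonal] at hp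
      have : p ≠ epsExponent I i := by
        rintro rfl
        refine hne (Prod.ext rfl ?_)
        rw [← hp]; simp
      rw [coeff_eps, if_neg this]; simp
    · intro hn
      exact absurd (Finset.HasAntidiagonal.mem_antidiagonal.2 (add_tsub_cancel_of_le h)) hn
  · refine Finset.sum_eq_zero fun p hp => ?_
    rw [Finset.HasAntidiagonal.mem_antidiagonal] at hp
    have : p.1 ≠ epsExponent I i := fun h' => h (by rw [← hp, h']; exact le_self_add)
    rw [coeff_eps, if_neg this]; simp

theorem eps_mul_mul_eps_mul (i : ZMod 2)
    (f f' : SuperSeries K (epsVars par) (SuperEnveloping K g)) :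
    eps i * f * (eps i * f') = 0 := by
  classical
  refine ext_coeff fun γ => ?_
  rw [coeff_mul, coeff_zero]
  split_ifs with h
  · refine Finset.sum_eq_zero fun p hp => ?_
    rw [Finset.HasAntidiagonal.mem_antidiagonal] at hp
    rw [coeff_eps_mul, coeff_eps_mul]
    by_cases h1 : epsExponent I i ≤ p.1
    · by_cases h2 : epsExponent I i ≤ p.2
      · rw [epsExponent_le_iff] at h1 h2
        have := h (toLex (Sum.inl (⟨i.val, ZMod.val_lt i⟩ : Fin 2))) trivial
        rw [← hp, Finsupp.add_apply] at this
        omega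
      · simp [h2]
    · simp [h1]
  · rfl

/-- Since ε stands on the left and does not occur in an extended series, multiplication by ε merely
shifts exponents. This allows ε to be cancelled in the first-order equation. -/
theorem eps_mul_extend_injective (i : ZMod 2) : Function.Injective fun
    f : SuperSeries K (xVars par) (SuperEnveloping K g) => eps i * extend f := by
  intro f f' h
  refine ext_coeff fun β => ?_
  by_cases hβ : ∀ s ∈ (xVars par).sqZero, β s ≤ 1
  · have key : ∀ f : SuperSeries K (xVars par) (SuperEnveloping K g),
        (eps i * extend f).coeff (epsExponent I i + embedExponent β) = f.coeff β := fun f => by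
      rw [coeff_eps_mul, if_pos, add_tsub_cancel_left, coeff_extend]
      refine ⟨fun s hs => ?_, le_self_add⟩
      obtain ⟨s, rfl⟩ := toLex.surjective s
      rw [Finsupp.add_apply, epsExponent]
      classical
      rcases s with e | j
      · rw [embedExponent_inl, Finsupp.single_apply]; split_ifs <;> simp
      · rw [embedExponent_inr, Finsupp.single_apply, if_neg, zero_add]
        · exact hβ j hs
        · exact fun h => Sum.inl_ne_inr (toLex.injective h)
    rw [← key f, ← key f']
    exact congrArg (fun F : SuperSeries K (epsVars par) (SuperEnveloping K g) =>
      F.coeff (epsExponent I i + embedExponent β)) h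
  · rw [coeff_of_not _ hβ, coeff_of_not _ hβ]

/-- An even series commutes with the parameters. -/
theorem extend_mul_eps (i : ZMod 2) {f : SuperSeries K (xVars par) (SuperEnveloping K g)}
    (hf : ∀ α, IsHomogeneous K ((xVars par).degParity α) (f.coeff α)) :
    extend f * eps i = eps i * extend f := by
  classical
  refine ext_coeff fun γ => ?_
  rw [coeff_mul, coeff_eps_mul, ite_and]
  refine if_congr Iff.rfl ?_ rfl
  split_ifs with h
  · rw [Finset.sum_eq_single (γ - epsExponent I i, epsExponent I i)]
    · rw [coeff_eps, if_pos rfl, mul_one, degParity_epsExponent,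
        units_smul_eq_scalarSign (K := K)]
      by_cases h0 : ∀ e : Fin 2, (γ - epsExponent I i : (Fin 2 ⊕ₗ I) →₀ ℕ) (toLex (Sum.inl e)) = 0
      · obtain ⟨β, hβ⟩ := exists_eq_embedExponent h0
        -- The sign for carrying ε past the coefficient and that for carrying it past X^β are equal,
        -- since the coefficient has parity |X^β|.
        rw [hβ, coeff_extend, twist_of_isHomogeneous _ (hf β), crossing_embedExponent_epsExponent,
          smul_smul, scalarSign_mul_self, one_smul]
      · rw [coeff_extend_eq_zero _ h0]; simp
    · rintro ⟨p, q⟩ hp hne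
      rw [Finset.HasAntidiagonal.mem_antidiagonal] at hp
      have : q ≠ epsExponent I i := by
        rintro rfl
        refine hne (Prod.ext ?_ rfl)
        rw [← hp]; simp
      rw [coeff_eps, if_neg this]; simp
    · intro hn
      exact absurd (Finset.HasAntidiagonal.mem_antidiagonal.2 (tsub_add_cancel_of_le h)) hn
  · refine Finset.sum_eq_zero fun p hp => ?_
    rw [Finset.HasAntidiagonal.mem_antidiagonal] at hp
    have : p.2 ≠ epsExponent I i := fun h' => h (by rw [← hp, h']; exact le_add_self)
    rw [coeff_eps, if_neg this]; simp

end Extend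

end SuperSeries

namespace SuperSeries

/-! ### Exponentials at first order in the parameters -/

section Ring

variable {K : Type*} {σ : Type*} {v : SuperVars σ} [Field K] {B : Type*} [Ring B]
  [Algebra K B] [Superalgebra K B] [LinearOrder σ]

/-- The derivative of the `n`-th power at `a` in direction `y`. -/
def powDeriv {R : Type*} [Ring R] (a y : R) : ℕ → R
  | 0 => 0
  | n + 1 => a ^ n * y + powDeriv a y n * a

theorem IsOrderGE.mul {f f' : SuperSeries K v B} {m n : ℕ} (h : f.IsOrderGE m)
    (h' : f'.IsOrderGE n) : (f * f').IsOrderGE (m + n) := by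
  classical
  intro γ hγ
  rw [coeff_mul]
  split_ifs
  · refine Finset.sum_eq_zero fun p hp => ?_
    rw [Finset.HasAntidiagonal.mem_antidiagonal] at hp
    have h4 : p.1.degree + p.2.degree = γ.degree := by rw [← hp, map_add]
    rcases Nat.lt_or_ge p.1.degree m with h1 | h1
    · rw [h _ h1]; simp
    · rw [h' p.2 (by omega)]; simp
  · rfl

theorem isOrderGE_pow {x : SuperSeries K v B} (hx : x.coeff 0 = 0) (n : ℕ) :
    (x ^ n).IsOrderGE n := fun γ hγ => coeff_pow_eq_zero hx n γ hγ

/-- Of the n + 1 factors in each term, the n factors `a` have no constant term, while `y` may have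
one; hence the order n and not n + 1. -/
theorem isOrderGE_powDeriv {a : SuperSeries K v B} (ha : a.coeff 0 = 0) (y : SuperSeries K v B)
    (n : ℕ) : (powDeriv a y (n + 1)).IsOrderGE n := by
  have ha1 := isOrderGE_pow ha 1
  rw [pow_one] at ha1
  induction n with
  | zero => exact isOrderGE_zero _
  | succ n ih =>
    rw [powDeriv]
    exact ((isOrderGE_pow ha (n + 1)).mul (isOrderGE_zero y)).add (ih.mul ha1)

/-- The derivative of the exponential at `a` in direction `y`. -/
noncomputable def expDeriv (a y : SuperSeries K v B) : SuperSeries K v B :=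
  orderSum fun n => (((n + 1).factorial : K)⁻¹) • powDeriv a y (n + 1)

theorem hasSum_expDeriv {a : SuperSeries K v B} (ha : a.coeff 0 = 0) (y : SuperSeries K v B) :
    HasSum (fun n : ℕ => ((n.factorial : K)⁻¹) • powDeriv a y n) (expDeriv a y) := by
  refine (hasSum_nat_add_iff' 1).1 ?_
  simp only [Finset.range_one, Finset.sum_singleton, powDeriv, smul_zero, sub_zero]
  exact hasSum_orderSum fun n => (isOrderGE_powDeriv ha y n).smul _

end Ring

section Eps

variable {K I : Type*} [Field K] {par : I → ZMod 2} [LinearOrder I]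
  {g : Type*} [AddCommGroup g] [Module K g] [LieSuperalgebra K g]

theorem exp_eps_mul (i : ZMod 2) (x : SuperSeries K (epsVars par) (SuperEnveloping K g)) :
    exp (eps i * x) = 1 + eps i * x := by
  have h0 : (eps i * x).coeff 0 = 0 := by
    classical
    rw [coeff_eps_mul, if_neg]
    rintro ⟨_, h⟩
    rw [epsExponent_le_iff] at h
    simp at h
  refine (hasSum_exp h0).unique ?_
  have h : HasSum (fun n : ℕ => ((n.factorial : K)⁻¹) • (eps i * x) ^ n)
      (∑ n ∈ Finset.range 2, ((n.factorial : K)⁻¹) • (eps i * x) ^ n) :=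
    hasSum_sum_of_ne_finset_zero fun n hn => by
      obtain ⟨m, rfl⟩ : ∃ m, n = m + 2 := ⟨n - 2, by simp at hn; omega⟩
      rw [pow_add, pow_two, eps_mul_mul_eps_mul, mul_zero, smul_zero]
  simpa [Finset.sum_range_succ] using h

/-- Since `a` commutes with ε, all ε can be moved to the left, and terms with two of them vanish. -/
theorem add_eps_mul_pow (i : ZMod 2) {a : SuperSeries K (xVars par) (SuperEnveloping K g)}
    (ha : extend a * eps i = eps i * extend a)
    (y : SuperSeries K (xVars par) (SuperEnveloping K g)) (n : ℕ) :
    (extend a + eps i * extend y) ^ n = extend (a ^ n) + eps i * extend (powDeriv a y n) := by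
  have hn : ∀ n, extend (a ^ n) * eps i = eps i * extend (a ^ n) := fun n => by
    rw [extend_pow]; exact Commute.pow_left ha n
  induction n with
  | zero =>
    have : extend (0 : SuperSeries K (xVars par) (SuperEnveloping K g)) = 0 :=
      (extendHom K par _).map_zero
    rw [pow_zero, pow_zero, extend_one, powDeriv, this, mul_zero, add_zero]
  | succ n ih =>
    have hadd : ∀ f f' : SuperSeries K (xVars par) (SuperEnveloping K g),
      extend (f + f') = extend f + extend f' := (extendHom K par _).map_add
    rw [pow_succ, ih, add_mul, mul_add, mul_add, eps_mul_mul_eps_mul, add_zero, ← extend_mul,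
      ← pow_succ, ← mul_assoc, hn, mul_assoc, mul_assoc, ← extend_mul, ← extend_mul, powDeriv,
      hadd, mul_add, add_assoc]

theorem exp_add_eps_mul (i : ZMod 2) {a : SuperSeries K (xVars par) (SuperEnveloping K g)}
    (ha : extend a * eps i = eps i * extend a) (ha0 : a.coeff 0 = 0)
    (y : SuperSeries K (xVars par) (SuperEnveloping K g)) :
    exp (extend a + eps i * extend y) = extend (exp a) + eps i * extend (expDeriv a y) := by
  have hsmul : ∀ (c : K) (f : SuperSeries K (xVars par) (SuperEnveloping K g)),
      extend (c • f) = c • extend f := (extendHom K par _).map_smul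
  have h0 : (extend a + eps i * extend y).coeff 0 = 0 := by
    classical
    have h1 : (extend a).coeff 0 = 0 := by
      rw [← ha0, ← coeff_extend a 0, embedExponent, Finsupp.mapDomain_zero]
    rw [coeff_add, h1, coeff_eps_mul, if_neg, add_zero]
    rintro ⟨_, h⟩
    rw [epsExponent_le_iff] at h
    simp at h
  refine (hasSum_exp h0).unique ?_
  have h1 := (hasSum_exp ha0).series_extend.add
    ((hasSum_expDeriv ha0 y).series_extend.series_mul_left (eps i))
  refine Eq.mp (congrArg (HasSum · _) (funext fun n => ?_)) h1
  rw [add_eps_mul_pow i ha, smul_add, hsmul, hsmul, mul_smul_comm]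

/-- The factorization condition is a condition at first order. -/
theorem exp_eps_mul_exp_eq_iff (i : ZMod 2)
    {a : SuperSeries K (xVars par) (SuperEnveloping K g)}
    (ha : ∀ α, IsHomogeneous K ((xVars par).degParity α) (a.coeff α)) (ha0 : a.coeff 0 = 0)
    (x y z : SuperSeries K (xVars par) (SuperEnveloping K g)) :
    exp (eps i * extend x) * exp (extend a) =
        exp (extend a + eps i * extend y) * exp (eps i * extend z) ↔
      x * exp a = expDeriv a y + exp a * z := by
  have hadd : ∀ f f' : SuperSeries K (xVars par) (SuperEnveloping K g),
      extend (f + f') = extend f + extend f' := (extendHom K par _).map_add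
  have hzero : extend (0 : SuperSeries K (xVars par) (SuperEnveloping K g)) = 0 :=
    (extendHom K par _).map_zero
  have hc := extend_mul_eps i ha
  -- This is the first-order expansion in the direction 0.
  have hexp : exp (extend a) = extend (exp a) := by
    have h := exp_add_eps_mul i hc ha0 0
    have h0 : expDeriv a 0 = 0 := by
      refine (hasSum_expDeriv ha0 0).unique ?_
      have : ∀ n, powDeriv a 0 n = 0 := fun n => by
        induction n with
        | zero => rfl
        | succ n ih => rw [powDeriv, ih]; simp
      simpa only [this, smul_zero] using hasSum_zero
    rwa [h0, hzero, mul_zero, add_zero, add_zero] at h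
  have hcexp : extend (exp a) * eps i = eps i * extend (exp a) := by
    have h1 := (hasSum_exp ha0).series_extend.series_mul_right (eps i)
    have h2 := (hasSum_exp ha0).series_extend.series_mul_left (eps i)
    refine h1.unique ?_
    refine Eq.mp (congrArg (HasSum · _) (funext fun n => ?_)) h2
    have hsmul : ∀ (c : K) (f : SuperSeries K (xVars par) (SuperEnveloping K g)),
      extend (c • f) = c • extend f := (extendHom K par _).map_smul
    rw [hsmul, extend_pow, smul_mul_assoc, mul_smul_comm, (Commute.pow_left hc n).eq]
  -- Both sides are expanded to first order; their terms free of ε agree, and the coefficients of ε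
  -- are compared.
  rw [exp_eps_mul, exp_eps_mul, exp_add_eps_mul i hc ha0, hexp, add_mul, one_mul, mul_add, mul_one,
    add_mul, eps_mul_mul_eps_mul, add_zero, add_assoc, add_right_inj, mul_assoc, ← extend_mul,
    ← mul_assoc (extend (exp a)), hcexp, mul_assoc, ← extend_mul, ← mul_add, ← hadd,
    (eps_mul_extend_injective i).eq_iff]

end Eps

end SuperSeries

namespace SuperSeries

/-! ### Exponentials of commuting operators -/

section Operators

variable {K : Type*} {σ : Type*} {v : SuperVars σ} {W : Type*} [AddCommGroup W] [Field K]
  [Module K W]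

/-- The coefficients of the exponential series. -/
noncomputable def expCoeff (K : Type*) [Field K] (n : ℕ) : K := (n.factorial : K)⁻¹

/-- The coefficients of the series `(e^t - 1) / t`. -/
noncomputable def expSubOneCoeff (K : Type*) [Field K] (n : ℕ) : K := ((n + 1).factorial : K)⁻¹

/-- The coefficients of the series `t / (e^t - 1)`. -/
noncomputable def bernoulliExpCoeff (K : Type*) [Field K] (n : ℕ) : K :=
  (bernoulli n : K) * (n.factorial : K)⁻¹

variable [CharZero K]

/-- The coefficient of t^{n+1} in (t/(e^t - 1)) (e^t - 1) = t. The shift by one is harmless because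
e^t - 1 has no constant term. -/
theorem sum_bernoulliExpCoeff_mul (n : ℕ) :
    ∑ p ∈ Finset.HasAntidiagonal.antidiagonal n, bernoulliExpCoeff K p.1 * expSubOneCoeff K p.2 =
      if n = 0 then 1 else 0 := by
  have h := congrArg (PowerSeries.coeff (n + 1)) (bernoulliPowerSeries_mul_exp_sub_one K)
  rw [PowerSeries.coeff_mul, Finset.Nat.sum_antidiagonal_succ', PowerSeries.coeff_X] at h
  simp only [Nat.add_eq_right] at h
  rw [← h]
  have h0 : PowerSeries.coeff 0 (PowerSeries.exp K - 1) = 0 := by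
    simp
  rw [h0, mul_zero, zero_add]
  refine Finset.sum_congr rfl fun p _ => ?_
  simp [bernoulliExpCoeff, expSubOneCoeff, bernoulliPowerSeries, PowerSeries.coeff_exp,
    PowerSeries.coeff_one, div_eq_mul_inv]

theorem sum_bernoulliExpCoeff_mul' (n : ℕ) :
    ∑ p ∈ Finset.HasAntidiagonal.antidiagonal n, expSubOneCoeff K p.1 * bernoulliExpCoeff K p.2 =
      if n = 0 then 1 else 0 := by
  rw [← sum_bernoulliExpCoeff_mul n, ← Finset.Nat.sum_antidiagonal_swap]
  exact Finset.sum_congr rfl fun p _ => mul_comm _ _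

theorem inv_factorial_mul_inv_factorial {p : ℕ × ℕ} {n : ℕ} (h : p.1 + p.2 = n) :
    (n.factorial : K)⁻¹ * (n.choose p.1 : K) = (p.1.factorial : K)⁻¹ * (p.2.factorial : K)⁻¹ := by
  subst h
  rw [Nat.cast_add_choose]
  have := fun n : ℕ => (Nat.cast_ne_zero (R := K)).2 n.factorial_ne_zero
  field_simp [this]

theorem powerSum_exp_add {L T : SuperSeries K v W →ₗ[K] SuperSeries K v W} (hL : RaisesOrder L)
    (hT : RaisesOrder T) (h : Commute L T) (f : SuperSeries K v W) :
    powerSum (expCoeff K) L (powerSum (expCoeff K) T f) = powerSum (expCoeff K) (L + T) f := by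
  rw [powerSum_powerSum hL hT, powerSum_apply]
  congr 1; funext n
  rw [h.add_pow', LinearMap.sum_apply, Finset.smul_sum]
  refine Finset.sum_congr rfl fun p hp => ?_
  rw [Finset.HasAntidiagonal.mem_antidiagonal] at hp
  rw [LinearMap.smul_apply, ← Nat.cast_smul_eq_nsmul K, smul_smul]
  congr 1
  exact (inv_factorial_mul_inv_factorial hp).symm

/-- The operator e^{-L} is a left inverse. -/
theorem powerSum_exp_injective {L : SuperSeries K v W →ₗ[K] SuperSeries K v W}
    (hL : RaisesOrder L) : Function.Injective (powerSum (expCoeff K) L) := by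
  have hneg : RaisesOrder (-L) := fun f n hf γ hγ => by
    rw [LinearMap.neg_apply, coeff_neg, hL f n hf γ hγ, neg_zero]
  refine Function.LeftInverse.injective (g := powerSum (expCoeff K) (-L)) fun f => ?_
  rw [powerSum_exp_add hneg hL (Commute.neg_left (Commute.refl L)), neg_add_cancel]
  refine Eq.trans ?_ (powerSum_one 0 f)
  rw [powerSum_apply, powerSum_apply]
  congr 1; funext n
  rcases n with _ | n
  · simp [expCoeff]
  · simp [pow_succ]

-- Used with g → U(g), to descend from U(g) to g, and with the inclusion of g_-, to restrict to g_-.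
omit [CharZero K] in
theorem powerSum_intertwine {W' : Type*} [AddCommGroup W'] [Module K W'] (φ : W →ₗ[K] W')
    {T : SuperSeries K v W →ₗ[K] SuperSeries K v W}
    {T' : SuperSeries K v W' →ₗ[K] SuperSeries K v W'}
    (h : ∀ f, mapCoeff φ (T f) = T' (mapCoeff φ f)) (c : ℕ → K) (f : SuperSeries K v W) :
    mapCoeff φ (powerSum c T f) = powerSum c T' (mapCoeff φ f) := by
  have hn : ∀ n, mapCoeff φ ((T ^ n) f) = (T' ^ n) (mapCoeff φ f) := fun n => by
    induction n with
    | zero => rfl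
    | succ n ih => rw [pow_succ', pow_succ', Module.End.mul_apply, Module.End.mul_apply, h, ih]
  refine ext_coeff fun γ => ?_
  simp only [powerSum_apply, coeff_mapCoeff, coeff_orderSum, map_sum, coeff_smul, map_smul, ← hn]

end Operators

section Ring

variable {K : Type*} {σ : Type*} {v : SuperVars σ} [Field K] [CharZero K] {B : Type*} [Ring B]
  [Algebra K B] [Superalgebra K B] [LinearOrder σ]

omit [CharZero K] in
theorem exp_mul_eq_powerSum {a : SuperSeries K v B} (ha : a.coeff 0 = 0) (f : SuperSeries K v B) :
    exp a * f = powerSum (expCoeff K) (LinearMap.mulLeft K a) f := by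
  have hL : RaisesOrder (LinearMap.mulLeft K a) := fun f n hf => by
    have := (isOrderGE_pow ha 1).mul hf
    rwa [pow_one, add_comm] at this
  refine ((hasSum_exp ha).series_mul_right f).unique ?_
  refine Eq.mp (congrArg (HasSum · _) (funext fun n => ?_)) (hasSum_orderSum (hL.isOrderGE _ f))
  rw [LinearMap.pow_mulLeft, LinearMap.mulLeft_apply, smul_mul_assoc, expCoeff]

omit [CharZero K] in
theorem mul_exp_eq_powerSum {a : SuperSeries K v B} (ha : a.coeff 0 = 0) (f : SuperSeries K v B) :
    f * exp a = powerSum (expCoeff K) (LinearMap.mulRight K a) f := by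
  have hL : RaisesOrder (LinearMap.mulRight K a) := fun f n hf => by
    have := hf.mul (isOrderGE_pow ha 1)
    rwa [pow_one] at this
  refine ((hasSum_exp ha).series_mul_left f).unique ?_
  refine Eq.mp (congrArg (HasSum · _) (funext fun n => ?_)) (hasSum_orderSum (hL.isOrderGE _ f))
  rw [LinearMap.pow_mulRight, LinearMap.mulRight_apply, mul_smul_comm, expCoeff]

/-- With L and R the left and right multiplications by a, the derivative is the sum of L^i R^j y
over i + j = n, that is, ((L + T)^{n+1} - L^{n+1})/T applied to y. The binomial theorem gives the
coefficients; the induction step is Pascal's rule. -/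
theorem powDeriv_eq_sum {a : SuperSeries K v B}
    {T : SuperSeries K v B →ₗ[K] SuperSeries K v B}
    (hT : LinearMap.mulRight K a = LinearMap.mulLeft K a + T) (y : SuperSeries K v B) (n : ℕ) :
    powDeriv a y (n + 1) = ∑ p ∈ Finset.HasAntidiagonal.antidiagonal n,
      ((n + 1).choose (p.2 + 1) : K) • ((LinearMap.mulLeft K a) ^ p.1) ((T ^ p.2) y) := by
  have hR : ∀ f, f * a = LinearMap.mulLeft K a f + T f := fun f => LinearMap.congr_fun hT f
  have hc : ∀ f, T (LinearMap.mulLeft K a f) = LinearMap.mulLeft K a (T f) := fun f => by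
    have h1 := hR (a * f)
    rw [mul_assoc, hR f] at h1
    simp only [LinearMap.mulLeft_apply, mul_add] at h1 ⊢
    exact (add_left_cancel h1).symm
  have hcp : ∀ m f, T (((LinearMap.mulLeft K a) ^ m) f) = ((LinearMap.mulLeft K a) ^ m) (T f) := by
    intro m f
    induction m with
    | zero => rfl
    | succ m ih => rw [pow_succ', Module.End.mul_apply, Module.End.mul_apply, hc, ih]
  induction n with
  | zero => simp [powDeriv]
  | succ n ih =>
    rw [powDeriv, hR, ih, map_sum, map_sum]
    simp only [map_smul, hcp]
    set L := LinearMap.mulLeft K a with hL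
    have e1 : a ^ (n + 1) * y = (L ^ (n + 1)) y := by
      rw [hL, LinearMap.pow_mulLeft, LinearMap.mulLeft_apply]
    rw [e1]
    have h2 : ∀ p : ℕ × ℕ, T ((T ^ p.2) y) = (T ^ (p.2 + 1)) y := fun p => by
      rw [pow_succ']; rfl
    have h3 : ∀ p : ℕ × ℕ, ∀ f, L ((L ^ p.1) f) = (L ^ (p.1 + 1)) f := fun p f => by
      rw [pow_succ']; rfl
    simp only [h2, h3]
    have h4 : ∀ p : ℕ × ℕ, ((n + 1 + 1).choose (p.2 + 1) : K) • (L ^ p.1) ((T ^ p.2) y) =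
        ((n + 1).choose p.2 : K) • (L ^ p.1) ((T ^ p.2) y) +
        ((n + 1).choose (p.2 + 1) : K) • (L ^ p.1) ((T ^ p.2) y) := fun p => by
      rw [← add_smul, Nat.choose_succ_succ (n + 1) p.2]; push_cast; rfl
    simp only [h4, Finset.sum_add_distrib]
    rw [Finset.Nat.sum_antidiagonal_succ', Finset.Nat.sum_antidiagonal_succ (f := fun p =>
      ((n + 1).choose (p.2 + 1) : K) • (L ^ p.1) ((T ^ p.2) y))]
    simp [add_comm, add_left_comm]

/-- Division by (n + 1)! splits the binomial coefficient into 1/p! and 1/(q + 1)!, the coefficients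
of e^L and of (e^T - 1)/T. -/
theorem expDeriv_eq_powerSum {a : SuperSeries K v B} (ha : a.coeff 0 = 0)
    {T : SuperSeries K v B →ₗ[K] SuperSeries K v B} (hTr : RaisesOrder T)
    (hT : LinearMap.mulRight K a = LinearMap.mulLeft K a + T) (y : SuperSeries K v B) :
    expDeriv a y = exp a * powerSum (expSubOneCoeff K) T y := by
  have hL : RaisesOrder (LinearMap.mulLeft K a) := fun f n hf => by
    have := (isOrderGE_pow ha 1).mul hf
    rwa [pow_one, add_comm] at this
  rw [exp_mul_eq_powerSum ha, powerSum_powerSum hL hTr, expDeriv]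
  congr 1; funext n
  rw [powDeriv_eq_sum hT, Finset.smul_sum]
  refine Finset.sum_congr rfl fun p hp => ?_
  rw [Finset.HasAntidiagonal.mem_antidiagonal] at hp
  rw [smul_smul, expCoeff, expSubOneCoeff, mul_comm (p.1.factorial : K)⁻¹]
  congr 1
  exact inv_factorial_mul_inv_factorial (p := (p.2 + 1, p.1)) (by simp; omega)

/-- As L and T commute, x e^a = e^{L+T} x = e^a (e^T x). Every term then has the left factor e^a,
which is cancelled. -/
theorem mul_exp_eq_iff {a : SuperSeries K v B} (ha : a.coeff 0 = 0)
    {T : SuperSeries K v B →ₗ[K] SuperSeries K v B} (hTr : RaisesOrder T)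
    (hT : LinearMap.mulRight K a = LinearMap.mulLeft K a + T) (x y z : SuperSeries K v B) :
    x * exp a = expDeriv a y + exp a * z ↔
      powerSum (expCoeff K) T x = powerSum (expSubOneCoeff K) T y + z := by
  have hL : RaisesOrder (LinearMap.mulLeft K a) := fun f n hf => by
    have := (isOrderGE_pow ha 1).mul hf
    rwa [pow_one, add_comm] at this
  have hcomm : Commute (LinearMap.mulLeft K a) T := by
    have h : T = LinearMap.mulRight K a - LinearMap.mulLeft K a := by rw [hT, add_sub_cancel_left]
    rw [h]
    exact (LinearMap.commute_mulLeft_right a a).sub_right (Commute.refl _)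
  rw [mul_exp_eq_powerSum ha, hT, ← powerSum_exp_add hL hTr hcomm, expDeriv_eq_powerSum ha hTr hT,
    exp_mul_eq_powerSum ha, exp_mul_eq_powerSum ha, ← map_add, (powerSum_exp_injective hL).eq_iff]

end Ring

end SuperSeries

/-! ### The factorization in closed form -/

section Solution

open SuperSeries LieSuperalgebra

variable {K g I : Type*} [Field K] [CharZero K] [AddCommGroup g] [Module K g]
  [LieSuperalgebra K g] [LinearOrder I] {gm h : Submodule K g}

omit [CharZero K] in
theorem SuperEnveloping.ι_isHomogeneous {i : ZMod 2} {x : g} (hx : IsHomogeneous K i x) :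
    IsHomogeneous K i (SuperEnveloping.ι K g x) := by
  rw [isHomogeneous_iff] at *
  have := SuperEnveloping.parityHom_ι K g x
  rw [hx, map_smul] at this
  exact this

theorem SuperEnveloping.twist_mul_sub_mul {i : ZMod 2} {x : g} (hx : IsHomogeneous K i x) (w : g) :
    twist K i (SuperEnveloping.ι K g w) * SuperEnveloping.ι K g x -
      SuperEnveloping.ι K g x * SuperEnveloping.ι K g w =
      SuperEnveloping.ι K g (-(bracket (K := K) x w)) := by
  have key : ∀ (j : ZMod 2) (w : g), IsHomogeneous K j w →
      twist K i (SuperEnveloping.ι K g w) * SuperEnveloping.ι K g x -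
      SuperEnveloping.ι K g x * SuperEnveloping.ι K g w =
      SuperEnveloping.ι K g (-(bracket (K := K) x w)) := fun j w hw => by
    rw [SuperEnveloping.ι_mul_ι K g i j x w hx hw, units_smul_eq_scalarSign (K := K),
      twist_of_isHomogeneous i (SuperEnveloping.ι_isHomogeneous hw), smul_mul_assoc, map_neg]
    abel
  have h0 := key 0 _ (homogPart_isHomogeneous 0 w)
  have h1 := key 1 _ (homogPart_isHomogeneous 1 w)
  rw [← homogPart_add (K := K) w]
  simp only [map_add, add_mul, mul_add, neg_add]
  rw [← h0, ← h1]
  abel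

/-- The operator `-ad XP` on series with values in `g`. -/
noncomputable def adShift (P : Module.Basis I K gm) (par : I → ZMod 2) :
    SuperSeries K (xVars par) g →ₗ[K] SuperSeries K (xVars par) g :=
  weightedShift par fun i => -(bracket (K := K) (P i : g))

/-- The operator `-ad p` on `gm`. -/
noncomputable def negAdRestrict (hgm : IsLieSubsuperalgebra K gm) (p : gm) : gm →ₗ[K] gm :=
  LinearMap.restrict (-(bracket (K := K) (p : g)))
    fun x hx => gm.neg_mem (hgm.bracket_mem _ p.2 x hx)

/-- The operator `-ad XP` on series with values in `gm`. -/
noncomputable def adShiftSub (hgm : IsLieSubsuperalgebra K gm) (P : Module.Basis I K gm)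
    (par : I → ZMod 2) :
    SuperSeries K (xVars par) gm →ₗ[K] SuperSeries K (xVars par) gm :=
  weightedShift par fun i => negAdRestrict hgm (P i)

omit [CharZero K] in
theorem mapCoeff_adShiftSub (hgm : IsLieSubsuperalgebra K gm) (P : Module.Basis I K gm)
    (par : I → ZMod 2) (f : SuperSeries K (xVars par) gm) :
    mapCoeff gm.subtype (adShiftSub hgm P par f) = adShift P par (mapCoeff gm.subtype f) :=
  mapCoeff_weightedShift gm.subtype gm.subtype (fun i => negAdRestrict hgm (P i))
    (fun i => -(bracket (K := K) (P i : g))) (fun _ _ => rfl) f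

/-- The canonical element in the series with values in the enveloping superalgebra. -/
noncomputable def envelopingCanonical (P : Module.Basis I K gm) (par : I → ZMod 2) :
    SuperSeries K (xVars par) (SuperEnveloping K g) :=
  mapCoeff (SuperEnveloping.ι K g) (canonicalElement P par)

omit [CharZero K] in
theorem isLinearSeries_envelopingCanonical (P : Module.Basis I K gm) (par : I → ZMod 2) :
    IsLinearSeries (envelopingCanonical P par) fun i => SuperEnveloping.ι K g (P i : g) :=
  ⟨fun i => by
    rw [envelopingCanonical, coeff_mapCoeff, (isLinearSeries_canonicalElement P).coeff_single],
  fun γ hγ => by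
    rw [envelopingCanonical, coeff_mapCoeff, (isLinearSeries_canonicalElement P).coeff_eq_zero γ hγ,
      map_zero]⟩

omit [CharZero K] in
theorem envelopingCanonical_isHomogeneous (P : Module.Basis I K gm) {par : I → ZMod 2}
    (hpar : ∀ i, IsHomogeneous K (par i) (P i : g)) (α : I →₀ ℕ) :
    IsHomogeneous K ((xVars par).degParity α) ((envelopingCanonical P par).coeff α) := by
  by_cases hα : ∃ i, α = Finsupp.single i 1
  · obtain ⟨i, rfl⟩ := hα
    rw [(isLinearSeries_envelopingCanonical P par).coeff_single]
    have : (xVars par).degParity (Finsupp.single i 1) = par i := by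
      simp [SuperVars.degParity, xVars]
    rw [this]
    exact SuperEnveloping.ι_isHomogeneous (hpar i)
  · push Not at hα
    rw [(isLinearSeries_envelopingCanonical P par).coeff_eq_zero α hα, isHomogeneous_iff]
    simp

/-- This removes both ε and U(g). The difference of right and left multiplication by XP restricts to
-ad XP on g-valued series, and g → U(g) is injective. -/
theorem exp_factorization_iff (P : Module.Basis I K gm) {par : I → ZMod 2}
    (hpar : ∀ i, IsHomogeneous K (par i) (P i : g)) (i : ZMod 2)
    (x : g) (y z : SuperSeries K (xVars par) g) :
    exp (eps (K := K) (g := g) (par := par) i * toEnveloping (monomial 0 x)) *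
        exp (toEnveloping (canonicalElement P par)) =
      exp (toEnveloping (canonicalElement P par) +
          eps (K := K) (g := g) (par := par) i * toEnveloping y) *
        exp (eps (K := K) (g := g) (par := par) i * toEnveloping z) ↔
    powerSum (expCoeff K) (adShift P par) (monomial 0 x) =
      powerSum (expSubOneCoeff K) (adShift P par) y + z := by
  have hlin := isLinearSeries_envelopingCanonical P par
  have ha0 : (envelopingCanonical P par).coeff 0 = 0 := hlin.coeff_eq_zero 0 fun i h => by
    have := DFunLike.congr_fun h i
    simp at this
  let DU : I → SuperEnveloping K g →ₗ[K] SuperEnveloping K g := fun i =>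
    LinearMap.mulRight K (SuperEnveloping.ι K g (P i : g)) ∘ₗ twist K (par i) -
      LinearMap.mulLeft K (SuperEnveloping.ι K g (P i : g))
  have hT : LinearMap.mulRight K (envelopingCanonical P par) =
      LinearMap.mulLeft K (envelopingCanonical P par) + weightedShift par DU := by
    have h1 : LinearMap.mulRight K (envelopingCanonical P par) = _ :=
      LinearMap.ext hlin.mul_right
    have h2 : LinearMap.mulLeft K (envelopingCanonical P par) = _ :=
      LinearMap.ext (hlin.mul_left fun i => SuperEnveloping.ι_isHomogeneous (hpar i))
    rw [h1, h2, ← weightedShift_add]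
    congr 1; funext i
    exact (add_sub_cancel _ _).symm
  have hint : ∀ f, mapCoeff (SuperEnveloping.ι K g) (adShift P par f) =
      weightedShift par DU (mapCoeff (SuperEnveloping.ι K g) f) :=
    mapCoeff_weightedShift _ _ _ _
      fun i w => (SuperEnveloping.twist_mul_sub_mul (hpar i) w).symm
  refine (exp_eps_mul_exp_eq_iff i (envelopingCanonical_isHomogeneous P hpar) ha0 _ _ _).trans ?_
  rw [mul_exp_eq_iff ha0 (weightedShift_raisesOrder DU) hT, ← powerSum_intertwine _ hint,
    ← powerSum_intertwine _ hint, ← map_add,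
    (mapCoeff_injective (SuperEnveloping.ι_injective K g)).eq_iff]

variable (K) in
/-- The constant series with a given value. -/
noncomputable def constSeries {σ W : Type*} [AddCommGroup W] [Module K W] (v : SuperVars σ) :
    W →ₗ[K] SuperSeries K v W where
  toFun w := monomial 0 w
  map_add' w w' := ext_coeff fun α => by
    classical
    have h0 : ∀ s ∈ v.sqZero, (0 : σ →₀ ℕ) s ≤ 1 := fun _ _ => Nat.zero_le _
    rw [coeff_add, coeff_monomial h0, coeff_monomial h0, coeff_monomial h0]
    split_ifs <;> simp
  map_smul' c w := ext_coeff fun α => by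
    classical
    have h0 : ∀ s ∈ v.sqZero, (0 : σ →₀ ℕ) s ≤ 1 := fun _ _ => Nat.zero_le _
    rw [RingHom.id_apply, coeff_smul, coeff_monomial h0, coeff_monomial h0]
    split_ifs <;> simp

/-- The exponential of `-ad XP`, applied to constant series. -/
noncomputable def expAd (P : Module.Basis I K gm) (par : I → ZMod 2) :
    g →ₗ[K] SuperSeries K (xVars par) g :=
  powerSum (expCoeff K) (adShift P par) ∘ₗ constSeries K (xVars par)

/-- The map `G` of the factorization. -/
noncomputable def factorLeft (hgm : IsLieSubsuperalgebra K gm) (hc : IsCompl gm h)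
    (P : Module.Basis I K gm) (par : I → ZMod 2) : g →ₗ[K] SuperSeries K (xVars par) gm :=
  powerSum (bernoulliExpCoeff K) (adShiftSub hgm P par) ∘ₗ
    mapCoeff (Submodule.projectionOnto gm h hc) ∘ₗ expAd P par

/-- The map `H` of the factorization. -/
noncomputable def factorRight (hc : IsCompl gm h)
    (P : Module.Basis I K gm) (par : I → ZMod 2) : g →ₗ[K] SuperSeries K (xVars par) h :=
  mapCoeff (Submodule.projectionOnto h gm hc.symm) ∘ₗ expAd P par

/-- Since g_- is a subalgebra, ((e^T - 1)/T) y has values in g_-. The projection to h therefore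
isolates z, and on the projection to g_- the series T/(e^T - 1) undoes (e^T - 1)/T. -/
theorem expAd_eq_iff (hgm : IsLieSubsuperalgebra K gm) (hc : IsCompl gm h)
    (P : Module.Basis I K gm) {par : I → ZMod 2} (x : g)
    (y : SuperSeries K (xVars par) gm) (z : SuperSeries K (xVars par) h) :
    powerSum (expCoeff K) (adShift P par) (monomial 0 x) =
      powerSum (expSubOneCoeff K) (adShift P par) (mapCoeff gm.subtype y) +
        mapCoeff h.subtype z ↔
    y = factorLeft hgm hc P par x ∧ z = factorRight hc P par x := by
  have hr : RaisesOrder (adShiftSub hgm P par) := weightedShift_raisesOrder _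
  rw [← powerSum_intertwine _ (mapCoeff_adShiftSub hgm P par)]
  change expAd P par x = _ ↔ _
  have hgg : ∀ f : SuperSeries K (xVars par) gm,
      mapCoeff (Submodule.projectionOnto gm h hc) (mapCoeff gm.subtype f) = f := fun f =>
    ext_apply fun α => Submodule.projectionOnto_apply_left hc (f α)
  have hgh : ∀ f : SuperSeries K (xVars par) h,
      mapCoeff (Submodule.projectionOnto gm h hc) (mapCoeff h.subtype f) = 0 := fun f =>
    ext_apply fun α => Submodule.projectionOnto_apply_right hc (f α)
  have hhg : ∀ f : SuperSeries K (xVars par) gm,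
      mapCoeff (Submodule.projectionOnto h gm hc.symm) (mapCoeff gm.subtype f) = 0 := fun f =>
    ext_apply fun α => Submodule.projectionOnto_apply_right hc.symm (f α)
  have hhh : ∀ f : SuperSeries K (xVars par) h,
      mapCoeff (Submodule.projectionOnto h gm hc.symm) (mapCoeff h.subtype f) = f := fun f =>
    ext_apply fun α => Submodule.projectionOnto_apply_left hc.symm (f α)
  have hadd : ∀ f : SuperSeries K (xVars par) g,
      mapCoeff gm.subtype (mapCoeff (Submodule.projectionOnto gm h hc) f) +
        mapCoeff h.subtype (mapCoeff (Submodule.projectionOnto h gm hc.symm) f) = f := fun f =>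
    ext_apply fun α => Submodule.projection_add_projection_eq_self hc (f α)
  constructor
  · intro hE
    have h1 := congrArg (mapCoeff (Submodule.projectionOnto gm h hc)) hE
    have h2 := congrArg (mapCoeff (Submodule.projectionOnto h gm hc.symm)) hE
    rw [map_add, hgg, hgh, add_zero] at h1
    rw [map_add, hhg, hhh, zero_add] at h2
    refine ⟨?_, h2.symm⟩
    rw [factorLeft, LinearMap.comp_apply, LinearMap.comp_apply, h1,
      powerSum_powerSum_self hr sum_bernoulliExpCoeff_mul, powerSum_one]
  · rintro ⟨rfl, rfl⟩
    rw [factorLeft, LinearMap.comp_apply, LinearMap.comp_apply,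
      powerSum_powerSum_self hr sum_bernoulliExpCoeff_mul', powerSum_one]
    exact (hadd _).symm

/-! ### Existence and uniqueness of the factorization -/

/-- The series `f` is homogeneous of parity `i`. -/
def IsHomogeneousSeries {par : I → ZMod 2} (i : ZMod 2) (f : SuperSeries K (xVars par) g) : Prop :=
  ∀ α, IsHomogeneous K (i + (xVars par).degParity α) (f.coeff α)

omit [CharZero K] in
theorem IsHomogeneous.sum {V ι : Type*} [AddCommGroup V] [Module K V] [Superspace K V] {i : ZMod 2}
    {s : Finset ι} {f : ι → V} (hf : ∀ j ∈ s, IsHomogeneous K i (f j)) :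
    IsHomogeneous K i (∑ j ∈ s, f j) := by
  simp only [isHomogeneous_iff] at *
  rw [map_sum, Finset.smul_sum]
  exact Finset.sum_congr rfl hf

omit [CharZero K] in
theorem IsHomogeneous.smul {V : Type*} [AddCommGroup V] [Module K V] [Superspace K V] {i : ZMod 2}
    (c : K) {x : V} (hx : IsHomogeneous K i x) : IsHomogeneous K i (c • x) := by
  rw [isHomogeneous_iff] at *
  rw [map_smul, hx, smul_comm]

omit [CharZero K] in
theorem isHomogeneous_zero {V : Type*} [AddCommGroup V] [Module K V] [Superspace K V]
    (i : ZMod 2) : IsHomogeneous K i (0 : V) := by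
  rw [isHomogeneous_iff, map_zero, smul_zero]

omit [CharZero K] in
theorem IsHomogeneousSeries.adShift {P : Module.Basis I K gm} {par : I → ZMod 2}
    (hpar : ∀ i, IsHomogeneous K (par i) (P i : g)) {i : ZMod 2}
    {f : SuperSeries K (xVars par) g} (hf : IsHomogeneousSeries i f) :
    IsHomogeneousSeries i (adShift P par f) := by
  intro γ
  by_cases hγ : ∀ s ∈ (xVars par).sqZero, γ s ≤ 1
  · rw [_root_.adShift, coeff_weightedShift _ f hγ]
    refine IsHomogeneous.sum fun j hj => IsHomogeneous.smul _ ?_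
    have h1 := ((hpar j).bracket (hf (γ - Finsupp.single j 1))).smul (-1)
    have h2 : par j + (i + (xVars par).degParity (γ - Finsupp.single j 1)) =
        i + (xVars par).degParity γ := by
      conv_rhs => rw [← sub_single_add_single hj, SuperVars.degParity_add]
      have : (xVars par).degParity (Finsupp.single j 1) = par j := by
        simp [SuperVars.degParity, xVars]
      rw [this]; ring
    rw [h2, neg_one_smul] at h1
    exact h1
  · rw [coeff_of_not _ hγ]; exact isHomogeneous_zero _

omit [CharZero K] in
theorem IsHomogeneousSeries.powerSum {P : Module.Basis I K gm} {par : I → ZMod 2}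
    (hpar : ∀ i, IsHomogeneous K (par i) (P i : g)) (c : ℕ → K) {i : ZMod 2}
    {f : SuperSeries K (xVars par) g} (hf : IsHomogeneousSeries i f) :
    IsHomogeneousSeries i (SuperSeries.powerSum c (_root_.adShift P par) f) := by
  have hn : ∀ n, IsHomogeneousSeries i ((_root_.adShift P par ^ n) f) := fun n => by
    induction n with
    | zero => exact hf
    | succ n ih => rw [pow_succ', Module.End.mul_apply]; exact ih.adShift hpar
  intro γ
  rw [powerSum_apply, coeff_orderSum]
  refine IsHomogeneous.sum fun n _ => ?_
  rw [coeff_smul]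
  exact (hn n γ).smul _

-- Write x = y + z along the decomposition. The defect σ(y) - (-1)^i y, with σ the parity operator,
-- is the opposite of the defect of z, so it lies in both summands and vanishes.
omit [CharZero K] in
theorem IsHomogeneous.projection (hc : IsCompl gm h) (hgm : IsLieSubsuperalgebra K gm)
    (hh : IsLieSubsuperalgebra K h) {i : ZMod 2} {x : g} (hx : IsHomogeneous K i x) :
    IsHomogeneous K i (Submodule.projectionOnto gm h hc x : g) := by
  have hx' := Submodule.projection_add_projection_eq_self hc x
  set y := Submodule.projectionOnto gm h hc x with hy
  set z := Submodule.projectionOnto h gm hc.symm x with hz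
  have hx' : (y : g) + z = x := hx'
  rw [isHomogeneous_iff] at *
  rw [← hx', map_add, smul_add] at hx
  have h1 : (Superspace.parity (K := K)) (y : g) - scalarSign K i • (y : g) =
      scalarSign K i • (z : g) - (Superspace.parity (K := K)) (z : g) := by
    rw [sub_eq_sub_iff_add_eq_add, hx, add_comm]
  refine sub_eq_zero.1 (Submodule.disjoint_def.1 hc.disjoint _
    (gm.sub_mem (hgm.parity_mem _ y.2) (gm.smul_mem _ y.2)) ?_)
  rw [h1]
  exact h.sub_mem (h.smul_mem _ z.2) (hh.parity_mem _ z.2)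

omit [CharZero K] in
theorem isHomogeneousSeries_expAd {P : Module.Basis I K gm} {par : I → ZMod 2}
    (hpar : ∀ i, IsHomogeneous K (par i) (P i : g)) {i : ZMod 2} {x : g}
    (hx : IsHomogeneous K i x) : IsHomogeneousSeries i (expAd P par x) := by
  refine IsHomogeneousSeries.powerSum hpar _ fun α => ?_
  classical
  change IsHomogeneous K _ ((monomial 0 x : SuperSeries K (xVars par) g).coeff α)
  rw [coeff_monomial fun _ _ => Nat.zero_le _]
  split_ifs with h0
  · rw [h0, SuperVars.degParity_zero, add_zero]; exact hx
  · exact isHomogeneous_zero _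

theorem isFactorization_factor (hgm : IsLieSubsuperalgebra K gm) (hh : IsLieSubsuperalgebra K h)
    (hc : IsCompl gm h) (P : Module.Basis I K gm) {par : I → ZMod 2}
    (hpar : ∀ i, IsHomogeneous K (par i) (P i : g)) :
    IsFactorization P par (factorLeft hgm hc P par) (factorRight hc P par) where
  even_left i x hx α := by
    have h1 : IsHomogeneousSeries i (mapCoeff gm.subtype (factorLeft hgm hc P par x)) := by
      rw [factorLeft, LinearMap.comp_apply, LinearMap.comp_apply,
        powerSum_intertwine _ (mapCoeff_adShiftSub hgm P par)]
      refine IsHomogeneousSeries.powerSum hpar _ fun β => ?_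
      rw [coeff_mapCoeff, coeff_mapCoeff]
      exact (isHomogeneousSeries_expAd hpar hx β).projection hc hgm hh
    have h2 := h1 α.1
    rwa [coeff_mapCoeff, coeff_val] at h2
  even_right i x hx α := by
    have h2 := (isHomogeneousSeries_expAd hpar hx α.1).projection hc.symm hh hgm
    rw [coeff_val] at h2
    exact h2
  factor i x _ := (exp_factorization_iff P hpar i x _ _).2
    ((expAd_eq_iff hgm hc P x _ _).2 ⟨rfl, rfl⟩)

/-- Condition (1) determines the values at homogeneous elements only; even and odd components give
the rest. -/
theorem IsFactorization.eq_factor (hgm : IsLieSubsuperalgebra K gm)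
    (hc : IsCompl gm h) {P : Module.Basis I K gm} {par : I → ZMod 2}
    (hpar : ∀ i, IsHomogeneous K (par i) (P i : g))
    {G : g →ₗ[K] SuperSeries K (xVars par) gm} {H : g →ₗ[K] SuperSeries K (xVars par) h}
    (hGH : IsFactorization P par G H) :
    G = factorLeft hgm hc P par ∧ H = factorRight hc P par := by
  have key : ∀ i x, IsHomogeneous K i x →
      G x = factorLeft hgm hc P par x ∧ H x = factorRight hc P par x := fun i x hx =>
    (expAd_eq_iff hgm hc P x _ _).1 ((exp_factorization_iff P hpar i x _ _).1 (hGH.factor i x hx))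
  have h0 := fun x => key 0 _ (homogPart_isHomogeneous 0 x)
  have h1 := fun x => key 1 _ (homogPart_isHomogeneous 1 x)
  constructor <;> refine LinearMap.ext fun x => ?_ <;> rw [← homogPart_add (K := K) x]
  · rw [map_add, map_add, (h0 x).1, (h1 x).1]
  · rw [map_add, map_add, (h0 x).2, (h1 x).2]

end Solution

/-! ### Sums over paths in the action graph -/

namespace SuperSeries

section Scalar

variable {K I : Type*} [Field K] [LinearOrder I] {par : I → ZMod 2}
  {W : Type*} [AddCommGroup W] [Module K W]

instance {σ : Type*} {v : SuperVars σ} : ContinuousConstSMul K (SuperSeries K v W) :=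
  ⟨fun c => continuous_of_finite _ fun γ => ⟨{γ}, Set.finite_singleton γ, fun _ _ h =>
    congrArg (c • ·) (h γ rfl)⟩⟩

theorem coeff_tensor {σ : Type*} {v : SuperVars σ} (f : SuperSeries K v K) (w : W)
    (γ : σ →₀ ℕ) : (tensor f w).coeff γ = f.coeff γ • w := by
  unfold coeff
  split_ifs
  · rfl
  · simp

theorem twist_self (i : ZMod 2) (x : K) : twist K i x = x := by
  unfold twist
  split_ifs <;> rfl

omit [LinearOrder I] in
theorem isLinearSeries_X [DecidableEq I] (i : I) :
    IsLinearSeries (X i : SuperSeries K (xVars par) K) (Pi.single i 1) := by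
  have adm : ∀ s ∈ (xVars par).sqZero, (Finsupp.single i 1 : I →₀ ℕ) s ≤ 1 := fun s _ => by
    rw [Finsupp.single_apply]; split_ifs <;> simp
  constructor
  · intro j
    refine (coeff_monomial adm 1 _).trans ?_
    by_cases h : j = i
    · subst h; simp
    · rw [if_neg fun h' => h (Finsupp.single_left_injective one_ne_zero h'),
        Pi.single_eq_of_ne h]
  · intro γ hγ
    exact (coeff_monomial adm 1 γ).trans (if_neg (hγ i))

theorem coeff_mul_X (f : SuperSeries K (xVars par) K) (i : I) {γ : I →₀ ℕ}
    (hγ : ∀ s ∈ (xVars par).sqZero, γ s ≤ 1) : (f * X i).coeff γ = if i ∈ γ.support then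
      scalarSign K ((xVars par).crossing (γ - Finsupp.single i 1) (Finsupp.single i 1)) *
        f.coeff (γ - Finsupp.single i 1) else 0 := by
  classical
  rw [(isLinearSeries_X i).mul_right f, coeff_weightedShift _ _ hγ]
  split_ifs with h
  · rw [Finset.sum_eq_single_of_mem i h]
    · simp [twist_self]
    · intro j _ hj
      simp [hj]
  · refine Finset.sum_eq_zero fun j hj => ?_
    have : j ≠ i := fun h' => h (h' ▸ hj)
    simp [this]

theorem weightedShift_tensor (D : I → W →ₗ[K] W) (f : SuperSeries K (xVars par) K) (w : W)
    {γ : I →₀ ℕ} (hγ : ∀ s ∈ (xVars par).sqZero, γ s ≤ 1) :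
    (weightedShift par D (tensor f w)).coeff γ =
      ∑ i ∈ γ.support, (f * X i).coeff γ • D i w := by
  rw [coeff_weightedShift _ _ hγ]
  refine Finset.sum_congr rfl fun i hi => ?_
  rw [coeff_tensor, map_smul, smul_smul, coeff_mul_X f i hγ, if_pos hi]

end Scalar

end SuperSeries

section Paths

open SuperSeries

variable {K E H I J : Type*} [Field K] [AddCommGroup E] [Module K E] [AddCommGroup H]
  [Module K H] {act : E →ₗ[K] H →ₗ[K] H} {P : Module.Basis I K E} {b : Module.Basis J K H}
  [LinearOrder I] {par : I → ZMod 2}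

theorem coeff_pathMeasure {s t : ActionGraph act P b} (p : Quiver.Path s t) (γ : I →₀ ℕ) :
    (pathMeasure par p).coeff γ = (pathWeight par p).coeff γ • b t := coeff_tensor _ _ _

theorem coeff_pathMeasure_cons {s t u : ActionGraph act P b} (p : Quiver.Path s t) (e : t ⟶ u)
    (γ : I →₀ ℕ) : (pathMeasure par (p.cons e)).coeff γ =
      (-structConst act P b e.1 t u * (pathWeight par p * X e.1).coeff γ) • b u := by
  rw [coeff_pathMeasure, pathWeight, edgeWeight, mul_smul_comm, coeff_smul, smul_eq_mul]

/-- The operator that moves along the edges of the action graph. -/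
noncomputable def actionShift (act : E →ₗ[K] H →ₗ[K] H) (P : Module.Basis I K E)
    (par : I → ZMod 2) : SuperSeries K (xVars par) H →ₗ[K] SuperSeries K (xVars par) H :=
  weightedShift par fun i => -act (P i)

/-- One application of the operator takes one step in the graph: [P_i, b_t] is expanded in the
basis, and each nonzero structure constant is an edge. For a given exponent γ only labels in the
support of γ matter, and each has finitely many targets; so a vertex may have infinitely many
outgoing edges. -/
theorem hasSum_pathMeasure_cons {s t : ActionGraph act P b} (p : Quiver.Path s t) :
    HasSum (fun e : Σ u, t ⟶ u => pathMeasure par (p.cons e.2))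
      (actionShift act P par (pathMeasure par p)) := by
  classical
  refine hasSum_of_finite fun γ => ?_
  let U : Finset J := γ.1.support.biUnion fun i => (b.repr (act (P i) (b t))).support
  let F : Finset (J × I) := (U ×ˢ γ.1.support).filter fun q => structConst act P b q.2 t q.1 ≠ 0
  let φ : {q // q ∈ F} → Σ u : ActionGraph act P b, t ⟶ u := fun q =>
    ⟨q.1.1, ⟨q.1.2, (Finset.mem_filter.1 q.2).2⟩⟩
  have hval : ∀ {u : ActionGraph act P b} (e : t ⟶ u), pathMeasure par (p.cons e) γ =
      (-structConst act P b e.1 t u * (pathWeight par p * X e.1).coeff γ.1) • b u := fun e =>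
    (coeff_val _ γ).symm.trans (coeff_pathMeasure_cons p e γ.1)
  have hφ : Function.Injective φ := by
    rintro ⟨⟨u, i⟩, h⟩ ⟨⟨u', i'⟩, h'⟩ heq
    obtain ⟨rfl, h2⟩ := Sigma.mk.inj_iff.1 heq
    have := congrArg Subtype.val (eq_of_heq h2)
    simp only at this
    subst this
    rfl
  refine ⟨F.attach.map ⟨φ, hφ⟩, ?_, ?_⟩
  · rintro ⟨u, i, hi⟩ hn
    rw [hval]
    by_contra h0
    have h1 : (pathWeight par p * X i).coeff γ.1 ≠ 0 := fun h => h0 (by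
      rw [show (⟨i, hi⟩ : t ⟶ u).1 = i from rfl, h, mul_zero, zero_smul])
    have h2 : i ∈ γ.1.support := by
      by_contra h2
      rw [coeff_mul_X _ _ γ.2, if_neg h2] at h1
      exact h1 rfl
    have h3 : ((u, i) : J × I) ∈ F := Finset.mem_filter.2 ⟨Finset.mem_product.2
      ⟨Finset.mem_biUnion.2 ⟨i, h2, Finsupp.mem_support_iff.2 hi⟩, h2⟩, hi⟩
    exact hn (Finset.mem_map.2 ⟨⟨(u, i), h3⟩, Finset.mem_attach _ _, rfl⟩)
  · rw [Finset.sum_map]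
    have h1 : ∀ q : {q // q ∈ F}, pathMeasure par (p.cons (φ q).2) γ =
        (-structConst act P b q.1.2 t q.1.1 * (pathWeight par p * X q.1.2).coeff γ.1) • b q.1.1 :=
      fun q => hval _
    simp only [Function.Embedding.coeFn_mk]
    refine (Finset.sum_congr rfl fun q _ => h1 q).trans ((Finset.sum_attach F fun q : J × I =>
      (-structConst act P b q.2 t q.1 * (pathWeight par p * X q.2).coeff γ.1) • b q.1).trans ?_)
    rw [Finset.sum_filter_of_ne]
    · rw [← coeff_val (actionShift act P par (pathMeasure par p)) γ, actionShift, pathMeasure,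
        weightedShift_tensor _ _ _ γ.2, Finset.sum_product_right]
      refine Finset.sum_congr rfl fun i hi => ?_
      have hU : (b.repr (act (P i) (b t))).support ⊆ U :=
        Finset.subset_biUnion_of_mem (fun i => (b.repr (act (P i) (b t))).support) hi
      rw [LinearMap.neg_apply, smul_neg, ← smul_neg]
      conv_rhs => rw [← b.linearCombination_repr (act (P i) (b t)), Finsupp.linearCombination_apply,
        Finsupp.sum_of_support_subset _ hU _ (by simp), ← Finset.sum_neg_distrib, Finset.smul_sum]
      refine Finset.sum_congr rfl fun u _ => ?_
      change (-(b.repr (act (P i) (b t)) u) * _) • b u = _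
      rw [smul_neg, smul_smul, ← neg_smul, neg_mul, mul_comm]
    · intro q _ hq h0
      exact hq (by rw [h0]; simp)

/-- The paths of the action graph that start at a given vertex. -/
abbrev PathsFrom (s : ActionGraph act P b) : Type _ := Σ t : ActionGraph act P b, Quiver.Path s t

/-- Every edge contributes exactly one variable. -/
theorem length_eq_degree {s t : ActionGraph act P b} (p : Quiver.Path s t) (γ : I →₀ ℕ)
    (h : (pathWeight par p).coeff γ ≠ 0) : p.length = γ.degree := by
  classical
  induction p generalizing γ with
  | nil =>
    rw [pathWeight, coeff_one] at h
    have : γ = 0 := by by_contra h0; exact h (if_neg h0)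
    simp [this]
  | cons p e ih =>
    rw [pathWeight, edgeWeight, mul_smul_comm, coeff_smul] at h
    have h1 := right_ne_zero_of_smul h
    have hγ : ∀ s ∈ (xVars par).sqZero, γ s ≤ 1 := by
      by_contra hγ
      exact h1 (coeff_of_not _ hγ)
    rw [coeff_mul_X _ _ hγ] at h1
    have hi : e.1 ∈ γ.support := by by_contra hi; exact h1 (if_neg hi)
    rw [if_pos hi] at h1
    rw [Quiver.Path.length_cons, ih _ (right_ne_zero_of_mul h1), degree_sub_single hi]

/-- Induction on the degree of γ: the last edge has its label in the support of γ, the path before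
it contributes to a smaller exponent, and its label and source leave finitely many targets. -/
theorem finite_pathWeight_ne_zero (s : ActionGraph act P b) (γ : I →₀ ℕ) :
    {p : PathsFrom s | (pathWeight par p.2).coeff γ ≠ 0}.Finite := by
  classical
  obtain ⟨n, hn⟩ : ∃ n, γ.degree = n := ⟨_, rfl⟩
  induction n generalizing γ with
  | zero =>
    refine (Set.finite_singleton (⟨s, Quiver.Path.nil⟩ : PathsFrom s)).subset ?_
    rintro ⟨t, p⟩ hp
    have := length_eq_degree p γ hp
    rw [hn] at this
    cases p with
    | nil => rfl
    | cons p e => simp at this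
  | succ n ih =>
    have hfin : (⋃ i ∈ γ.support, ⋃ p ∈ {p : PathsFrom s |
        (pathWeight par p.2).coeff (γ - Finsupp.single i 1) ≠ 0},
        ⋃ u ∈ (b.repr (act (P i) (b p.1))).support,
          {q : PathsFrom s | ∃ h : structConst act P b i p.1 u ≠ 0,
            q = ⟨u, p.2.cons ⟨i, h⟩⟩}).Finite := by
      refine Set.Finite.biUnion (Finset.finite_toSet _) fun i hi => ?_
      refine Set.Finite.biUnion (ih _ ?_) fun p _ => ?_
      · have := degree_sub_single hi
        omega
      refine Set.Finite.biUnion (Finset.finite_toSet _) fun u _ => ?_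
      refine Set.Subsingleton.finite ?_
      rintro _ ⟨h, rfl⟩ _ ⟨h', rfl⟩
      rfl
    refine hfin.subset ?_
    rintro ⟨u, p⟩ hp
    cases p with
    | nil =>
      have := length_eq_degree _ γ hp
      simp [hn] at this
    | @cons t _ p e =>
      have h : (pathWeight par (p.cons e)).coeff γ ≠ 0 := hp
      rw [pathWeight, edgeWeight, mul_smul_comm, coeff_smul] at h
      have h1 := right_ne_zero_of_smul h
      have hγ : ∀ s ∈ (xVars par).sqZero, γ s ≤ 1 := by
        by_contra hγ
        exact h1 (coeff_of_not _ hγ)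
      rw [coeff_mul_X _ _ hγ] at h1
      have hi : e.1 ∈ γ.support := by by_contra hi; exact h1 (if_neg hi)
      rw [if_pos hi] at h1
      simp only [Set.mem_iUnion]
      exact ⟨e.1, hi, ⟨t, p⟩, right_ne_zero_of_mul h1, u, Finsupp.mem_support_iff.2 e.2, e.2, rfl⟩

theorem summable_pathMeasure (s : ActionGraph act P b) (c : PathsFrom s → K) :
    Summable fun p : PathsFrom s => c p • pathMeasure par p.2 := by
  refine summable_of_finite _ fun α => (finite_pathWeight_ne_zero (par := par) s α.1).subset ?_
  intro p hp h0
  refine hp ((coeff_val (c p • pathMeasure par p.2) α).symm.trans ?_)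
  rw [coeff_smul, coeff_pathMeasure, h0, zero_smul, smul_zero]

/-- Applying the shift operator to a sum over paths prolongs the paths by an edge. -/
theorem HasSum.actionShift {s : ActionGraph act P b} {c c' : PathsFrom s → K}
    {f : SuperSeries K (xVars par) H} (hf : HasSum (fun p => c p • pathMeasure par p.2) f)
    (hnil : c' ⟨s, Quiver.Path.nil⟩ = 0)
    (hcons : ∀ {t u} (p : Quiver.Path s t) (e : t ⟶ u), c' ⟨u, p.cons e⟩ = c ⟨t, p⟩) :
    HasSum (fun p => c' p • pathMeasure par p.2) (actionShift act P par f) := by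
  -- The prolonged family has some sum `S`. Grouping it by the path that remains when the last edge
  -- is removed yields the images of the terms of `f`, and by continuity their sum is the image of
  -- `f`.
  obtain ⟨S, hS⟩ := summable_pathMeasure (par := par) s c'
  let φ : (Σ p : PathsFrom s, Σ u, p.1 ⟶ u) → PathsFrom s := fun q => ⟨q.2.1, q.1.2.cons q.2.2⟩
  have hφ : Function.Injective φ := by
    rintro ⟨⟨t, p⟩, u, e⟩ ⟨⟨t', p'⟩, u', e'⟩ h
    cases h
    rfl
  have h1 : HasSum (fun q : Σ p : PathsFrom s, Σ u, p.1 ⟶ u =>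
      c q.1 • pathMeasure par (q.1.2.cons q.2.2)) S := by
    refine Eq.mp (congrArg (HasSum · _) (funext fun q => ?_)) ((hφ.hasSum_iff fun p hp => ?_).2 hS)
    · exact congrArg (· • _) (hcons _ _)
    · obtain ⟨t, p⟩ := p
      cases p with
      | nil => rw [hnil, zero_smul]
      | cons p e => exact absurd ⟨⟨⟨_, p⟩, _, e⟩, rfl⟩ hp
  have h2 : HasSum (fun p : PathsFrom s => c p • _root_.actionShift act P par (pathMeasure par p.2))
      S := h1.sigma fun p => (hasSum_pathMeasure_cons p.2).const_smul (c p)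
  have h3 : HasSum (fun p : PathsFrom s => c p • _root_.actionShift act P par (pathMeasure par p.2))
      (_root_.actionShift act P par f) := by
    refine Eq.mp (congrArg (HasSum · _) (funext fun p => ?_))
      (hf.map (_root_.actionShift act P par) (continuous_weightedShift _))
    exact map_smul _ _ _
  rw [h3.unique h2]
  exact hS

/-- A sum over all paths may be computed by summing over the paths of each length first. -/
theorem hasSum_of_length {s : ActionGraph act P b} {c : PathsFrom s → K}
    {u : ℕ → SuperSeries K (xVars par) H} (hu : ∀ n, (u n).IsOrderGE n)
    (h : ∀ n, HasSum (fun p : PathsFrom s =>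
      (if p.2.length = n then c p else 0) • pathMeasure par p.2) (u n)) :
    HasSum (fun p => c p • pathMeasure par p.2) (orderSum u) := by
  -- Summability over all paths is known beforehand, so the sum may be computed along the fibres of
  -- the length.
  obtain ⟨S, hS⟩ := summable_pathMeasure (par := par) s c
  let l : PathsFrom s → ℕ := fun p => p.2.length
  have h1 := (Equiv.sigmaFiberEquiv l).hasSum_iff.2 hS
  have h2 : HasSum u S := h1.sigma fun n => by
    have h3 := h n
    have h4 : (fun p : PathsFrom s => (if p.2.length = n then c p else 0) • pathMeasure par p.2) =
        Set.indicator {p | l p = n} (fun p => c p • pathMeasure par p.2) := by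
      funext p
      classical
      rw [Set.indicator_apply]
      simp only [Set.mem_ofPred_eq, l]
      split_ifs
      · rfl
      · rw [zero_smul]
    rw [h4] at h3
    exact hasSum_subtype_iff_indicator.2 h3
  rw [(hasSum_orderSum hu).unique h2]
  exact hS

end Paths

/-! ### Path integrals and the factorization -/

section Quiver

variable {V : Type*} [Quiver V] {S : Set V}

theorem edgesFrom_cons_of_mem {s t u : V} (p : Quiver.Path s t) (e : t ⟶ u) (ht : t ∈ S) :
    edgesFrom S (p.cons e) = edgesFrom S p + 1 :=
  congrArg (edgesFrom S p + ·) (if_pos ht)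

theorem edgesFrom_cons_of_notMem {s t u : V} (p : Quiver.Path s t) (e : t ⟶ u) (ht : t ∉ S) :
    edgesFrom S (p.cons e) = edgesFrom S p :=
  congrArg (edgesFrom S p + ·) (if_neg ht)

theorem edgesFrom_le_length {s t : V} (p : Quiver.Path s t) : edgesFrom S p ≤ p.length := by
  induction p with
  | nil => exact le_rfl
  | @cons t u p e ih =>
    rw [Quiver.Path.length_cons]
    by_cases ht : t ∈ S
    · rw [edgesFrom_cons_of_mem p e ht]; omega
    · rw [edgesFrom_cons_of_notMem p e ht]; omega

/-- If `S` cannot be entered from outside, then a path that ends in `S` lies in `S`. -/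
theorem edgesFrom_eq_length (hS : ∀ {t u : V}, (t ⟶ u) → u ∈ S → t ∈ S) {s t : V}
    (p : Quiver.Path s t) (ht : t ∈ S) : edgesFrom S p = p.length := by
  induction p with
  | nil => rfl
  | @cons t u p e ih =>
    rw [edgesFrom_cons_of_mem p e (hS e ht), ih (hS e ht), Quiver.Path.length_cons]

end Quiver

/-! ### Power series in the shift operator as sums over paths -/

section PathSums

open SuperSeries

variable {K E H I J : Type*} [Field K] [AddCommGroup E] [Module K E] [AddCommGroup H]
  [Module K H] {act : E →ₗ[K] H →ₗ[K] H} {P : Module.Basis I K E} {b : Module.Basis J K H}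
  [LinearOrder I] {par : I → ZMod 2} {s : ActionGraph act P b}

open Classical in
/-- The powers of the shift operator are sums over the paths of a given length. -/
theorem hasSum_length_eq (n : ℕ) :
    HasSum (fun p : PathsFrom s => (if p.2.length = n then (1 : K) else 0) • pathMeasure par p.2)
      ((actionShift act P par ^ n) (constSeries K (xVars par) (b s))) := by
  induction n with
  | zero =>
    have h1 : constSeries K (xVars par) (b s) =
        (if (Quiver.Path.nil : Quiver.Path s s).length = 0 then (1 : K) else 0) •
          pathMeasure par (Quiver.Path.nil : Quiver.Path s s) := by
      rw [if_pos (Quiver.Path.length_nil), one_smul]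
      refine ext_coeff fun γ => ?_
      have h0 : ∀ s ∈ (xVars par).sqZero, (0 : I →₀ ℕ) s ≤ 1 := fun _ _ => Nat.zero_le _
      rw [coeff_pathMeasure, pathWeight, coeff_one]
      refine (coeff_monomial h0 (b s) γ).trans ?_
      split_ifs <;> simp
    rw [pow_zero, Module.End.one_apply, h1]
    refine hasSum_single (⟨s, Quiver.Path.nil⟩ : PathsFrom s) ?_
    rintro ⟨t, p⟩ hp
    cases p with
    | nil => exact absurd rfl hp
    | cons p e => rw [if_neg (by simp), zero_smul]
  | succ n ih =>
    rw [pow_succ', Module.End.mul_apply]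
    refine ih.actionShift ?_ fun p e => ?_
    · simp
    · simp

theorem mapCoeff_pathMeasure (φ : H →ₗ[K] H) {t : ActionGraph act P b} (p : Quiver.Path s t)
    {k : K} (hφ : φ (b t) = k • b t) :
    mapCoeff φ (pathMeasure par p) = k • pathMeasure par p := by
  refine ext_coeff fun γ => ?_
  rw [coeff_mapCoeff, coeff_smul, coeff_pathMeasure, map_smul, hφ, smul_comm]

open Classical in
/-- The projection to the span of a set of vertices restricts sums over paths. -/
theorem HasSum.restrict_target {c : PathsFrom s → K} {f : SuperSeries K (xVars par) H}
    (hf : HasSum (fun p => c p • pathMeasure par p.2) f) (φ : H →ₗ[K] H)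
    {S : Set (ActionGraph act P b)} (hφ : ∀ t : ActionGraph act P b, φ (b t) = if t ∈ S then b t else 0) :
    HasSum (fun p => (if p.1 ∈ S then c p else 0) • pathMeasure par p.2) (mapCoeff φ f) := by
  refine Eq.mp (congrArg (HasSum · _) (funext fun p => ?_))
    (hf.map (mapCoeff φ) (continuous_mapCoeff φ))
  have h1 : φ (b p.1) = (if p.1 ∈ S then (1 : K) else 0) • b p.1 := by
    refine (hφ p.1).trans ?_
    split_ifs <;> simp
  rw [Function.comp_apply, map_smul, mapCoeff_pathMeasure φ p.2 h1, smul_smul, mul_ite, mul_one,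
    mul_zero]

open Classical in
/-- Moving from the complement of `S`, to which a projection is inserted after `i` steps. -/
theorem hasSum_pow_projection_pow {S R : Set (ActionGraph act P b)} (hR : ∀ t, t ∈ R ↔ t ∉ S)
    (hS : ∀ {t u : ActionGraph act P b}, (t ⟶ u) → u ∈ S → t ∈ S) (φ : H →ₗ[K] H)
    (hφ : ∀ t : ActionGraph act P b, φ (b t) = if t ∈ R then b t else 0) (m i : ℕ) :
    HasSum (fun p : PathsFrom s =>
        (if p.2.length = m + i ∧ edgesFrom S p.2 ≤ i ∧ p.1 ∉ S then (1 : K) else 0) •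
          pathMeasure par p.2)
      ((actionShift act P par ^ m) (mapCoeff φ
        ((actionShift act P par ^ i) (constSeries K (xVars par) (b s))))) := by
  induction m with
  | zero =>
    refine Eq.mp (congrArg (HasSum · _) (funext fun p => ?_))
      ((hasSum_length_eq (s := s) (par := par) i).restrict_target φ hφ)
    have h1 : edgesFrom S p.2 ≤ p.2.length := edgesFrom_le_length p.2
    congr 1
    -- For m = 0 the bound k(p) ≤ i is automatic, as k never exceeds the length.
    by_cases h2 : p.2.length = i
    · have h3 : p.2.length = 0 + i ∧ edgesFrom S p.2 ≤ i := ⟨by omega, h2 ▸ h1⟩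
      simp only [h2, if_true, hR, h3, true_and, zero_add]
    · rw [if_neg h2, ite_self, if_neg fun h => h2 (by omega)]
  | succ m ih =>
    rw [pow_succ', Module.End.mul_apply]
    refine ih.actionShift ?_ fun {t u} p e => if_congr ?_ rfl rfl
    · refine if_neg fun h => ?_
      have h1 := h.1
      rw [Quiver.Path.length_nil] at h1
      omega
    · change (p.cons e).length = _ ∧ edgesFrom S (p.cons e) ≤ i ∧ u ∉ S ↔
        p.length = _ ∧ edgesFrom S p ≤ i ∧ t ∉ S
      rw [Quiver.Path.length_cons]
      -- If the path before the last edge ends in `S`, all its edges issue from `S`, so k of the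
      -- longer path is m + 1 + i, which exceeds i. If it ends outside `S`, then the new edge cannot
      -- enter `S` and leaves k unchanged.
      by_cases ht : t ∈ S
      · have h1 := edgesFrom_eq_length hS p ht
        rw [edgesFrom_cons_of_mem p e ht]
        constructor
        · rintro ⟨h2, h3, _⟩; omega
        · rintro ⟨_, _, h⟩; exact absurd ht h
      · have hu : u ∉ S := fun hu => ht (hS e hu)
        rw [edgesFrom_cons_of_notMem p e ht]
        simp only [ht, hu, not_false_eq_true, and_true]
        constructor <;> rintro ⟨h2, h3⟩ <;> exact ⟨by omega, h3⟩

variable [CharZero K]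

theorem bernoulliCoeff_self (n : ℕ) : (bernoulliCoeff n n : K) = expCoeff K n := by
  simp [bernoulliCoeff, expCoeff]

-- The product of t/(e^t - 1) with the part of e^t of degree at least k; `q.2` is the summation
-- index i in the definition of c(k, n).
open Classical in
theorem sum_bernoulliExpCoeff_mul_expCoeff (k n : ℕ) :
    ∑ q ∈ Finset.HasAntidiagonal.antidiagonal n,
      (bernoulliExpCoeff K q.1 * expCoeff K q.2) * (if k ≤ q.2 then 1 else 0) =
      (bernoulliCoeff k n : K) := by
  rw [Finset.Nat.sum_antidiagonal_eq_sum_range_succ_mk, ← Finset.sum_range_reflect, bernoulliCoeff,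
    Rat.cast_sum]
  have h1 : Finset.Icc k n = (Finset.range (n + 1)).filter (k ≤ ·) := by
    ext i; simp; omega
  rw [h1, Finset.sum_filter]
  refine Finset.sum_congr rfl fun i hi => ?_
  have hi : i ≤ n := Nat.lt_succ_iff.1 (Finset.mem_range.1 hi)
  have h2 : n + 1 - 1 - i = n - i := rfl
  have h3 : n - (n - i) = i := by omega
  rw [h2, h3, mul_ite, mul_one, mul_zero]
  split_ifs
  · rw [bernoulliExpCoeff, expCoeff]
    push_cast
    rw [div_eq_mul_inv, mul_inv]
    ring
  · rfl

open Classical in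
/-- The sum over the paths that end in `S`. -/
theorem hasSum_pathCoeff_mem {S : Set (ActionGraph act P b)}
    (hS : ∀ {t u : ActionGraph act P b}, (t ⟶ u) → u ∈ S → t ∈ S) (φ : H →ₗ[K] H)
    (hφ : ∀ t : ActionGraph act P b, φ (b t) = if t ∈ S then b t else 0) :
    HasSum (fun p : PathsFrom s => (if p.1 ∈ S then pathCoeff K S p.2 else 0) •
        pathMeasure par p.2)
      (mapCoeff φ (powerSum (expCoeff K) (actionShift act P par)
        (constSeries K (xVars par) (b s)))) := by
  have hT : RaisesOrder (actionShift act P par) := weightedShift_raisesOrder _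
  have h1 : HasSum (fun p : PathsFrom s => expCoeff K p.2.length • pathMeasure par p.2)
      (powerSum (expCoeff K) (actionShift act P par) (constSeries K (xVars par) (b s))) := by
    refine hasSum_of_length (hT.isOrderGE _ _) fun n => ?_
    refine Eq.mp (congrArg (HasSum · _) (funext fun p => ?_))
      ((hasSum_length_eq (s := s) (par := par) n).const_smul (expCoeff K n))
    rw [smul_smul, mul_ite, mul_one, mul_zero]
    congr 1
    split_ifs with h
    · rw [h]
    · rfl
  refine Eq.mp (congrArg (HasSum · _) (funext fun p => ?_)) (h1.restrict_target φ hφ)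
  congr 1
  split_ifs with h
  · rw [pathCoeff, edgesFrom_eq_length hS p.2 h, bernoulliCoeff_self]
  · rfl

open Classical in
/-- The sum over the paths that end outside `S`. -/
theorem hasSum_pathCoeff_notMem {S R : Set (ActionGraph act P b)} (hR : ∀ t, t ∈ R ↔ t ∉ S)
    (hS : ∀ {t u : ActionGraph act P b}, (t ⟶ u) → u ∈ S → t ∈ S) (φ : H →ₗ[K] H)
    (hφ : ∀ t : ActionGraph act P b, φ (b t) = if t ∈ R then b t else 0) :
    HasSum (fun p : PathsFrom s => (if p.1 ∈ R then pathCoeff K S p.2 else 0) •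
        pathMeasure par p.2)
      (powerSum (bernoulliExpCoeff K) (actionShift act P par) (mapCoeff φ
        (powerSum (expCoeff K) (actionShift act P par) (constSeries K (xVars par) (b s))))) := by
  have hT : RaisesOrder (actionShift act P par) := weightedShift_raisesOrder _
  -- The projection preserves the degree in X, so it may be applied to e^T term by term.
  set u : ℕ → SuperSeries K (xVars par) H := fun i => expCoeff K i • mapCoeff φ
    ((actionShift act P par ^ i) (constSeries K (xVars par) (b s))) with hu
  have hu' : ∀ i, (u i).IsOrderGE i := fun i γ hγ => by
    have h1 := hT.isOrderGE (expCoeff K) (constSeries K (xVars par) (b s)) i γ hγ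
    rw [hu]
    simp only
    rw [← map_smul, coeff_mapCoeff, h1, map_zero]
  have h1 : mapCoeff φ (powerSum (expCoeff K) (actionShift act P par)
      (constSeries K (xVars par) (b s))) = orderSum u := by
    refine ext_coeff fun γ => ?_
    simp only [powerSum_apply, coeff_mapCoeff, coeff_orderSum, map_sum, coeff_smul, map_smul, hu]
  rw [h1, powerSum_orderSum hT _ hu']
  refine hasSum_of_length (fun n => IsOrderGE.sum fun q hq => ?_) fun n => ?_
  · have := (hT.pow (hu' q.2) q.1).smul (bernoulliExpCoeff K q.1)
    rwa [add_comm, Finset.HasAntidiagonal.mem_antidiagonal.1 hq] at this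
  · have h2 := hasSum_sum fun q (_ : q ∈ Finset.HasAntidiagonal.antidiagonal n) =>
      (hasSum_pow_projection_pow (s := s) (par := par) hR hS φ hφ q.1 q.2).const_smul
        (bernoulliExpCoeff K q.1 * expCoeff K q.2)
    have h3 : ∑ q ∈ Finset.HasAntidiagonal.antidiagonal n,
        bernoulliExpCoeff K q.1 • (actionShift act P par ^ q.1) (u q.2) =
        ∑ q ∈ Finset.HasAntidiagonal.antidiagonal n,
          (bernoulliExpCoeff K q.1 * expCoeff K q.2) • (actionShift act P par ^ q.1) (mapCoeff φ
            ((actionShift act P par ^ q.2) (constSeries K (xVars par) (b s)))) :=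
      Finset.sum_congr rfl fun q _ => by rw [hu, map_smul, smul_smul]
    rw [h3]
    refine Eq.mp (congrArg (HasSum · _) (funext fun p => ?_)) h2
    simp only [smul_smul]
    rw [← Finset.sum_smul]
    congr 1
    -- On the antidiagonal the length condition reads length = n and no longer depends on q. Only
    -- k(p) ≤ q.2 stays under the sum, which then evaluates to c(k(p), n).
    have h4 : ∀ q ∈ Finset.HasAntidiagonal.antidiagonal n,
        (bernoulliExpCoeff K q.1 * expCoeff K q.2) *
          (if p.2.length = q.1 + q.2 ∧ edgesFrom S p.2 ≤ q.2 ∧ p.1 ∉ S then (1 : K) else 0) =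
        ((bernoulliExpCoeff K q.1 * expCoeff K q.2) * (if edgesFrom S p.2 ≤ q.2 then 1 else 0)) *
          (if p.2.length = n ∧ p.1 ∉ S then 1 else 0) := fun q hq => by
      rw [Finset.HasAntidiagonal.mem_antidiagonal.1 hq, mul_assoc (_ * _),
        ite_zero_mul_ite_zero, mul_one]
      congr 1
      exact if_congr and_left_comm rfl rfl
    rw [Finset.sum_congr rfl h4, ← Finset.sum_mul, sum_bernoulliExpCoeff_mul_expCoeff, mul_ite,
      mul_one, mul_zero, ite_and]
    by_cases h5 : p.2.length = n
    · rw [if_pos h5, if_pos h5, pathCoeff, h5]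
      exact if_congr (hR p.1).symm rfl rfl
    · rw [if_neg h5, if_neg h5]

end PathSums

/-! ### The basis P ∪ Q and the two kinds of vertices -/

section UnionBasis

open SuperSeries

variable {K g I J : Type*} [Field K] [AddCommGroup g] [Module K g] [LieSuperalgebra K g]
  {gm h : Submodule K g} (hc : IsCompl gm h) (P : Module.Basis I K gm) (Q : Module.Basis J K h)

omit [LieSuperalgebra K g] in
theorem unionBasis_inl (i : I) : unionBasis hc P Q (Sum.inl i) = (P i : g) := by
  simp [unionBasis]

omit [LieSuperalgebra K g] in
theorem unionBasis_inr (j : J) : unionBasis hc P Q (Sum.inr j) = (Q j : g) := by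
  simp [unionBasis]

omit [LieSuperalgebra K g] in
theorem unionBasis_mem (t : I ⊕ J) : unionBasis hc P Q t ∈ gm ∨ unionBasis hc P Q t ∈ h := by
  rcases t with i | j
  · exact Or.inl (unionBasis_inl hc P Q i ▸ (P i).2)
  · exact Or.inr (unionBasis_inr hc P Q j ▸ (Q j).2)

omit [LieSuperalgebra K g] in
theorem notMem_right_of_mem_left (t : I ⊕ J) (ht : unionBasis hc P Q t ∈ gm) :
    unionBasis hc P Q t ∉ h := fun h' =>
  (unionBasis hc P Q).ne_zero t (Submodule.disjoint_def.1 hc.disjoint _ ht h')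

theorem mem_verticesMinus_iff (t : AdGraph hc P Q) :
    t ∈ verticesMinus hc P Q ↔ t ∉ verticesH hc P Q :=
  ⟨notMem_right_of_mem_left hc P Q t, (unionBasis_mem hc P Q t).resolve_right⟩

open Classical in
theorem projection_left_unionBasis (t : AdGraph hc P Q) :
    (gm.subtype ∘ₗ Submodule.projectionOnto gm h hc) (unionBasis hc P Q t) =
      if t ∈ verticesMinus hc P Q then unionBasis hc P Q t else 0 := by
  split_ifs with ht
  · exact congrArg Subtype.val (Submodule.projectionOnto_apply_left hc ⟨_, ht⟩)
  · have ht' : unionBasis hc P Q t ∈ h := (unionBasis_mem hc P Q t).resolve_left ht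
    exact congrArg Subtype.val (Submodule.projectionOnto_apply_right hc ⟨_, ht'⟩)

open Classical in
theorem projection_right_unionBasis (t : AdGraph hc P Q) :
    (h.subtype ∘ₗ Submodule.projectionOnto h gm hc.symm) (unionBasis hc P Q t) =
      if t ∈ verticesH hc P Q then unionBasis hc P Q t else 0 := by
  split_ifs with ht
  · exact congrArg Subtype.val (Submodule.projectionOnto_apply_left hc.symm ⟨_, ht⟩)
  · have ht' : unionBasis hc P Q t ∈ gm := (unionBasis_mem hc P Q t).resolve_right ht
    exact congrArg Subtype.val (Submodule.projectionOnto_apply_right hc.symm ⟨_, ht'⟩)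

omit [LieSuperalgebra K g] in
theorem unionBasis_repr_of_mem_left {x : g} (hx : x ∈ gm) (j : J) :
    (unionBasis hc P Q).repr x (Sum.inr j) = 0 := by
  have h1 : (Submodule.prodEquivOfIsCompl gm h hc).symm x = (⟨x, hx⟩, 0) := by
    rw [LinearEquiv.symm_apply_eq]
    simp
  simp [unionBasis, h1]

/-- No edge of the action graph leads from `gm` to `h`. -/
theorem mem_verticesH_of_edge (hgm : IsLieSubsuperalgebra K gm) {t u : AdGraph hc P Q}
    (e : t ⟶ u) (hu : u ∈ verticesH hc P Q) : t ∈ verticesH hc P Q := by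
  refine (unionBasis_mem hc P Q t).resolve_left fun ht => ?_
  have h1 : adAction gm (P e.1) (unionBasis hc P Q t) ∈ gm :=
    hgm.bracket_mem _ (P e.1).2 _ ht
  rcases u with i | j
  · exact notMem_right_of_mem_left hc P Q (Sum.inl i) (unionBasis_inl hc P Q i ▸ (P i).2) hu
  · exact e.2 (unionBasis_repr_of_mem_left hc P Q h1 j)

end UnionBasis

/-! ### The maps G and H as path integrals -/

section PathIntegral

open SuperSeries

variable {K g I J : Type*} [Field K] [CharZero K] [AddCommGroup g] [Module K g]
  [LieSuperalgebra K g] [LinearOrder I] {gm h : Submodule K g} {hc : IsCompl gm h}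
  {P : Module.Basis I K gm} {Q : Module.Basis J K h} {par : I → ZMod 2}

omit [CharZero K] in
theorem hasSum_pathIntegral (M : AdGraph hc P Q)
    (c : ∀ t : AdGraph hc P Q, Quiver.Path M t → K) :
    HasSum (fun p : PathsFrom M => c p.1 p.2 • pathMeasure par p.2) (pathIntegral par M c) :=
  (summable_pathMeasure M fun p => c p.1 p.2).hasSum

omit [CharZero K] in
open Classical in
theorem HasSum.restrict_paths {M : AdGraph hc P Q} {S : Set (AdGraph hc P Q)} {c : PathsFrom M → K}
    {f : SuperSeries K (xVars par) g}
    (hf : HasSum (fun p : PathsFrom M => (if p.1 ∈ S then c p else 0) • pathMeasure par p.2) f) :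
    HasSum (fun p : Σ t : S, Quiver.Path M t.1 => c ⟨p.1.1, p.2⟩ • pathMeasure par p.2) f := by
  let φ : (Σ t : S, Quiver.Path M t.1) → PathsFrom M := fun p => ⟨p.1.1, p.2⟩
  have hφ : Function.Injective φ := by
    rintro ⟨⟨t, ht⟩, p⟩ ⟨⟨t', ht'⟩, p'⟩ heq
    cases heq
    rfl
  refine Eq.mp (congrArg (HasSum · _) (funext fun p => ?_)) ((hφ.hasSum_iff fun p hp => ?_).2 hf)
  · exact congrArg (· • _) (if_pos p.1.2)
  · rw [if_neg fun ht => hp ⟨⟨⟨p.1, ht⟩, p.2⟩, rfl⟩, zero_smul]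

-- The inclusion of g_- commutes with T, so T/(e^T - 1) may be applied to g-valued series, where T
-- is the shift operator of the action graph.
open Classical in
theorem hasSum_factorLeft (hgm : IsLieSubsuperalgebra K gm) (M : AdGraph hc P Q) :
    HasSum (fun p : PathsFrom M =>
        (if p.1 ∈ verticesMinus hc P Q then pathCoeff K (verticesH hc P Q) p.2 else 0) •
          pathMeasure par p.2)
      (mapCoeff gm.subtype (factorLeft hgm hc P par (unionBasis hc P Q M))) := by
  rw [factorLeft, LinearMap.comp_apply, LinearMap.comp_apply,
    powerSum_intertwine _ (mapCoeff_adShiftSub hgm P par)]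
  exact hasSum_pathCoeff_notMem (s := M) (par := par) (mem_verticesMinus_iff hc P Q)
    (mem_verticesH_of_edge hc P Q hgm) (gm.subtype ∘ₗ Submodule.projectionOnto gm h hc)
    (projection_left_unionBasis hc P Q)

open Classical in
theorem hasSum_factorRight (hgm : IsLieSubsuperalgebra K gm) (M : AdGraph hc P Q) :
    HasSum (fun p : PathsFrom M =>
        (if p.1 ∈ verticesH hc P Q then pathCoeff K (verticesH hc P Q) p.2 else 0) •
          pathMeasure par p.2)
      (mapCoeff h.subtype (factorRight hc P par (unionBasis hc P Q M))) :=
  hasSum_pathCoeff_mem (s := M) (par := par) (mem_verticesH_of_edge hc P Q hgm)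
    (h.subtype ∘ₗ Submodule.projectionOnto h gm hc.symm) (projection_right_unionBasis hc P Q)

/-- Both sides, included in g, are sums of one and the same family: the terms of the path integral
whose paths end in g_-. -/
theorem factorLeft_eq_pathIntegral (hgm : IsLieSubsuperalgebra K gm) (M : AdGraph hc P Q) :
    factorLeft hgm hc P par (unionBasis hc P Q M) = mapCoeff (Submodule.projectionOnto gm h hc)
      (pathIntegral par M fun _ p => pathCoeff K (verticesH hc P Q) p) := by
  classical
  have h1 := (hasSum_pathIntegral (par := par) M fun _ p => pathCoeff K (verticesH hc P Q) p)
    |>.restrict_target (gm.subtype ∘ₗ Submodule.projectionOnto gm h hc)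
      (projection_left_unionBasis hc P Q)
  exact mapCoeff_injective gm.injective_subtype ((hasSum_factorLeft hgm M).unique h1)

theorem factorRight_eq_pathIntegral (hgm : IsLieSubsuperalgebra K gm) (M : AdGraph hc P Q) :
    factorRight hc P par (unionBasis hc P Q M) = mapCoeff (Submodule.projectionOnto h gm hc.symm)
      (pathIntegral par M fun _ p => pathCoeff K (verticesH hc P Q) p) := by
  classical
  have h1 := (hasSum_pathIntegral (par := par) M fun _ p => pathCoeff K (verticesH hc P Q) p)
    |>.restrict_target (h.subtype ∘ₗ Submodule.projectionOnto h gm hc.symm)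
      (projection_right_unionBasis hc P Q)
  exact mapCoeff_injective h.injective_subtype ((hasSum_factorRight hgm M).unique h1)

end PathIntegral

theorem mainTheorem4 {K g I J : Type*} [Field K] [CharZero K] [AddCommGroup g] [Module K g]
    [LieSuperalgebra K g] (gm h : Submodule K g)
    (hgm : IsLieSubsuperalgebra K gm) (hh : IsLieSubsuperalgebra K h) (hc : IsCompl gm h)
    [LinearOrder I] (P : Module.Basis I K gm) (Q : Module.Basis J K h)
    (par : I → ZMod 2) (hpar : ∀ i, IsHomogeneous K (par i) (P i : g)) :
    (∃ (G : g →ₗ[K] SuperSeries K (xVars par) gm) (H : g →ₗ[K] SuperSeries K (xVars par) h),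
      IsFactorization P par G H) ∧
    ∀ (G : g →ₗ[K] SuperSeries K (xVars par) gm) (H : g →ₗ[K] SuperSeries K (xVars par) h),
      IsFactorization P par G H →
      ∀ M : AdGraph hc P Q,
        Summable (fun p : Σ t : AdGraph hc P Q, Quiver.Path M t =>
          pathCoeff K (verticesH hc P Q) p.2 • pathMeasure par p.2) ∧
        G (unionBasis hc P Q M) = SuperSeries.mapCoeff (Submodule.projectionOnto gm h hc)
          (pathIntegral par M fun _ p => pathCoeff K (verticesH hc P Q) p) ∧
        H (unionBasis hc P Q M) = SuperSeries.mapCoeff (Submodule.projectionOnto h gm hc.symm)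
          (pathIntegral par M fun _ p => pathCoeff K (verticesH hc P Q) p) ∧
        HasSum (fun p : Σ t : verticesMinus hc P Q, Quiver.Path M t.1 =>
            pathCoeff K (verticesH hc P Q) p.2 • pathMeasure par p.2)
          (SuperSeries.mapCoeff gm.subtype (G (unionBasis hc P Q M))) ∧
        HasSum (fun p : Σ t : verticesH hc P Q, Quiver.Path M t.1 =>
            pathCoeff K (verticesH hc P Q) p.2 • pathMeasure par p.2)
          (SuperSeries.mapCoeff h.subtype (H (unionBasis hc P Q M))) := by
  refine ⟨⟨_, _, isFactorization_factor hgm hh hc P hpar⟩, fun G H hGH M => ?_⟩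
  obtain ⟨rfl, rfl⟩ := hGH.eq_factor hgm hc hpar
  exact ⟨summable_pathMeasure M fun p => pathCoeff K (verticesH hc P Q) p.2,
    factorLeft_eq_pathIntegral hgm M, factorRight_eq_pathIntegral hgm M,
    (hasSum_factorLeft hgm M).restrict_paths, (hasSum_factorRight hgm M).restrict_paths⟩
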